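/- Let $N\ge 2$, $\mathfrak g=\mathfrak{sl}_N(\mathbb C)$, $(A|B)=\operatorname{tr}(AB)$, $\varepsilon=e^{2\pi i/N}$, let $\beta$ be the cyclic shift matrix ($\beta_{i,i+1}=1$ for $i$ modulo $N$, other entries $0$), $\gamma=\operatorname{diag}(1,\varepsilon^{-1},\dots,\varepsilon^{1-N})$, and let $\mathfrak h\subset\mathfrak g$ be the Cartan subalgebra of traceless diagonal matrices. Let $L\ge1$, let $t_1,\dots,t_L\in\mathbb C^{*}$ lie on pairwise distinct orbits of $t\mapsto\varepsilon t$, and let $k\in\mathbb C$. *Lie algebras.* For each $i$ let $\hat{\mathfrak g}^{Q_i}=\mathfrak g((t-t_i))\oplus\mathbb C\hat k$ be the central extension with cocycle $\operatorname{Res}_{t=t_i}(dA|B)$. Let $\hat{\mathfrak g}^{(0)}$ and $\hat{\mathfrak g}^{(\infty)}$ be the central extensions, with cocycle $\frac1N\operatorname{Res}(dA|B)$ at $t=0$ resp. $t=\infty$, of the Lie algebras of $\mathfrak g$-valued formal Laurent series $A$ in $t$, resp. in $t^{-1}$, with $A(\varepsilon t)=\gamma A(t)\gamma^{-1}$. Let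 $\mathfrak g^{\mathrm{orb}}_{\mathrm{out}}$ be the Lie algebra of $\mathfrak g$-valued rational functions $f(t)$ on $\mathbb P^1$ with $f(\varepsilon t)=\gamma f(t)\gamma^{-1}$ whose poles lie in $\{\varepsilon^a t_i\}\cup\{0,\infty\}$, and let $\mathfrak g^{\mathrm{trig}}_{\mathrm{out}}$ be the subalgebra of those $f$ that are regular at $0$ and $\infty$ and satisfy $f(\infty)=\beta f(0)\beta^{-1}$. These algebras act on tensor products of modules through Laurent expansions at the $t_i$ (and at $0,\infty$ for modules inserted there). Put $CC_{\mathrm{trig}}(M)=M/\mathfrak g^{\mathrm{trig}}_{\mathrm{out}}M$ for $M=M_1\otimes\cdots\otimes M_L$, with $M_i$ a $\hat{\mathfrak g}^{Q_i}$-module, and $CC_{\mathrm{orb}}(M_0\otimes M\otimes M_\infty)=(M_0\otimes M\otimes M_\infty)/\mathfrak g^{\mathrm{orb}}_{\mathrm{out}}(M_0\otimes M\otimes M_\infty)$, with $M_0$ a $\hat{\mathfrak g}^{(0)}$-module and $M_\infty$ a $\hat{\mathfrak g}^{(\infty)}$-module. *Modules.* Let $V_1,\dots,V_L$ be finite-dimensional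 $\mathfrak g$-modules, $V=V_1\otimes\cdots\otimes V_L$, $V_\lambda$ the $\lambda$-weight space of $V$ for $\lambda\in\mathfrak h^*$, and $\mathrm{wt}(V)=\{\lambda: V_\lambda\ne0\}$. Let $M(V_i)$ be the Weyl module: the $\hat{\mathfrak g}^{Q_i}$-module induced from $V_i$, on which $\mathfrak g[[t-t_i]]$ acts through its value at $t=t_i$ and $\hat k$ acts as $k$. Put $M(V)=M(V_1)\otimes\cdots\otimes M(V_L)\supset V$. For $\mu\in\mathfrak h^*$ let $M_\mu$ be the Verma module of level $k$ at $0$ or at $\infty$, that is $U/J$ with $J$ the left ideal generated by the series with strictly positive powers of the local parameter ($t$ at $0$, $t^{-1}$ at $\infty$), by $H-\mu(H)$ for $H\in\mathfrak h$, and by $\hat k-k$; let $1_\mu$ be the class of $1$. For $\lambda\in\mathfrak h^*$ put $\tilde\lambda=\lambda\circ(1-\operatorname{Ad}\beta)^{-1}\circ\operatorname{Ad}\beta$ and $\tilde\lambda'=-\lambda\circ(1-\operatorname{Ad}\beta)^{-1}$, where $1-\operatorname{Ad}\beta$ is invertible on $\mathfrak h$. Insert $M_{\tilde\lambda}$ at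 $0$ and $M_{\tilde\lambda'}$ at $\infty$. *Theorem.* 1. The map $V\to CC_{\mathrm{trig}}(M(V))$, $v\mapsto[v]$, is a linear isomorphism. 2. For every $\lambda\in\mathfrak h^*$ the map $V_\lambda\to CC_{\mathrm{orb}}(M_{\tilde\lambda}\otimes M(V)\otimes M_{\tilde\lambda'})$, $v\mapsto[1_{\tilde\lambda}\otimes v\otimes 1_{\tilde\lambda'}]$, is a linear isomorphism. 3. $V=\bigoplus_{\lambda\in\mathrm{wt}(V)}V_\lambda$, and there is a linear isomorphism (the factorisation) $$\Phi: CC_{\mathrm{trig}}(M(V))\to\bigoplus_{\lambda\in\mathrm{wt}(V)}CC_{\mathrm{orb}}(M_{\tilde\lambda}\otimes M(V)\otimes M_{\tilde\lambda'}),\qquad \Phi([m])=\bigl([1_{\tilde\lambda}\otimes m\otimes 1_{\tilde\lambda'}]\bigr)_{\lambda}\quad(m\in M(V)),$$ which under the identifications of 1 and 2 is the weight space decomposition of $V$: if $v=\sum_\lambda v_\lambda$ with $v_\lambda\in V_\lambda$, then $\Phi([v])=([1_{\tilde\lambda}\otimes v_\lambda\otimes 1_{\tilde\lambda'}])_{\lambda}$.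 -/

import Mathlib

open scoped LaurentSeries TensorProduct DirectSum

attribute [local instance 100] LieRing.ofAssociativeRing

noncomputable section

namespace TwistedWZW

universe u v w

/-! ### Formal Laurent series -/

/-- The usual `ℂ`-algebra structure on formal Laurent series, preferred over the propositionally
equal one that factors through formal power series. -/
instance (priority := 2000) laurentAlgebra : Algebra ℂ ℂ⸨X⸩ := HahnSeries.instAlgebra

instance : IsScalarTower ℂ ℂ⸨X⸩ ℂ⸨X⸩ :=
  ⟨fun a f g => by simp only [smul_eq_mul, ← HahnSeries.C_mul_eq_smul, mul_assoc]⟩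

instance : SMulCommClass ℂ ℂ⸨X⸩ ℂ⸨X⸩ :=
  ⟨fun a f g => by simp only [smul_eq_mul, ← HahnSeries.C_mul_eq_smul, mul_left_comm]⟩

theorem derivative_mul (f g : ℂ⸨X⸩) :
    LaurentSeries.derivative ℂ (f * g) =
      LaurentSeries.derivative ℂ f * g + f * LaurentSeries.derivative ℂ g := by
  have key : ∀ h : ℂ⸨X⸩, ∀ n : ℤ,
      (HahnSeries.single (1 : ℤ) (1 : ℂ) * LaurentSeries.derivative ℂ h).coeff n
        = n * h.coeff n := by
    intro h n
    have := HahnSeries.coeff_single_mul_add (r := (1 : ℂ)) (x := LaurentSeries.derivative ℂ h)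
      (a := n - 1) (b := 1)
    rw [sub_add_cancel] at this
    rw [this]
    simp [LaurentSeries.hasseDeriv_coeff]
  have hne : (HahnSeries.single (1 : ℤ) (1 : ℂ) : ℂ⸨X⸩) ≠ 0 := by simp
  apply mul_left_cancel₀ hne
  have hs : ∀ h : ℂ⸨X⸩,
      (HahnSeries.single (1 : ℤ) (1 : ℂ) * LaurentSeries.derivative ℂ h).support ⊆ h.support := by
    intro h n hn
    rw [HahnSeries.mem_support, key] at hn
    rw [HahnSeries.mem_support]
    exact right_ne_zero_of_mul hn
  ext n
  rw [key, mul_add, HahnSeries.coeff_add, ← mul_assoc,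
    mul_left_comm (HahnSeries.single (1 : ℤ) (1 : ℂ)) f,
    HahnSeries.coeff_mul_left' f.isPWO_support (hs f),
    HahnSeries.coeff_mul_right' g.isPWO_support (hs g), HahnSeries.coeff_mul,
    ← Finset.sum_add_distrib, Finset.mul_sum]
  refine Finset.sum_congr rfl fun ij hij => ?_
  rw [key, key]
  have : ij.1 + ij.2 = n := (Finset.mem_antidiagonal.1 hij).2.2
  rw [← this]
  push_cast
  ring

/-- The residue: the coefficient of `ξ⁻¹`. -/
def residue : ℂ⸨X⸩ →ₗ[ℂ] ℂ where
  toFun f := f.coeff (-1)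
  map_add' _ _ := rfl
  map_smul' _ _ := rfl

theorem residue_derivative (f : ℂ⸨X⸩) : residue (LaurentSeries.derivative ℂ f) = 0 := by
  simp [residue, LaurentSeries.hasseDeriv_coeff]

/-- The substitution `f(t) ↦ f(ω t)`, i.e. `∑ fₙ tⁿ ↦ ∑ ωⁿ fₙ tⁿ`. -/
def scale (ω : ℂˣ) : ℂ⸨X⸩ →ₐ[ℂ] ℂ⸨X⸩ :=
  let s : ℂ⸨X⸩ → ℂ⸨X⸩ := fun f =>
    ⟨fun n => ((ω ^ n : ℂˣ) : ℂ) * f.coeff n, f.isPWO_support.mono fun _ h => right_ne_zero_of_mul h⟩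
  AlgHom.ofLinearMap
    { toFun := s
      map_add' := fun f g => by ext n; simp [s, mul_add]
      map_smul' := fun c f => by ext n; simp [s, mul_left_comm] }
    (by
      ext n
      by_cases h : n = 0
      · subst h; simp [s]
      · simp [s, HahnSeries.coeff_one, h])
    (by
      intro f g
      have hs : ∀ f : ℂ⸨X⸩, (s f).support ⊆ f.support := fun f n h => right_ne_zero_of_mul h
      ext n
      change ((ω ^ n : ℂˣ) : ℂ) * (f * g).coeff n = (s f * s g).coeff n
      have h1 : (s f * s g).coeff n = ∑ ij ∈ Finset.antidiagonal f.isPWO_support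
          g.isPWO_support n, (s f).coeff ij.1 * (s g).coeff ij.2 := by
        rw [HahnSeries.coeff_mul_left' f.isPWO_support (hs f)]
        refine Finset.sum_subset ?_ ?_
        · intro ij hij
          rw [Finset.mem_antidiagonal] at hij ⊢
          exact ⟨hij.1, hs g hij.2.1, hij.2.2⟩
        · intro ij hij hn
          rw [Finset.mem_antidiagonal] at hij hn
          have : (s g).coeff ij.2 = 0 := by
            by_contra h
            exact hn ⟨hij.1, h, hij.2.2⟩
          rw [this, mul_zero]
      rw [h1, HahnSeries.coeff_mul, Finset.mul_sum]
      refine Finset.sum_congr rfl fun ij hij => ?_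
      have : ij.1 + ij.2 = n := (Finset.mem_antidiagonal.1 hij).2.2
      rw [← this, zpow_add]
      simp only [s, Units.val_mul]
      ring)

@[simp] theorem scale_coeff (ω : ℂˣ) (f : ℂ⸨X⸩) (n : ℤ) :
    (scale ω f).coeff n = ((ω ^ n : ℂˣ) : ℂ) * f.coeff n := rfl

/-- The formal power series, as a subalgebra of the formal Laurent series. -/
def regular : Subalgebra ℂ ℂ⸨X⸩ where
  __ := (HahnSeries.ofPowerSeries ℤ ℂ).range
  algebraMap_mem' r := ⟨PowerSeries.C r, HahnSeries.ofPowerSeries_C r⟩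

theorem coeff_zero_mul_of_regular {f g : ℂ⸨X⸩} (hf : f ∈ regular) (hg : g ∈ regular) :
    (f * g).coeff 0 = f.coeff 0 * g.coeff 0 := by
  obtain ⟨f, rfl⟩ := hf
  obtain ⟨g, rfl⟩ := hg
  have h : ∀ p : PowerSeries ℂ,
      (HahnSeries.ofPowerSeries ℤ ℂ p).coeff 0 = PowerSeries.constantCoeff p := by
    intro p
    have := HahnSeries.ofPowerSeries_apply_coeff (Γ := ℤ) p 0
    simpa using this
  rw [← map_mul, h, h, h, map_mul]

theorem mem_regular_iff {f : ℂ⸨X⸩} : f ∈ regular ↔ ∀ n < 0, f.coeff n = 0 := by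
  constructor
  · rintro ⟨f, rfl⟩ n hn
    refine HahnSeries.embDomain_of_notMem_range ?_
    rintro ⟨m, hm⟩
    simp at hm
    omega
  · intro h
    refine ⟨PowerSeries.mk fun n => f.coeff n, ?_⟩
    ext n
    obtain hn | hn := lt_or_ge n 0
    · rw [h n hn]
      refine HahnSeries.embDomain_of_notMem_range ?_
      rintro ⟨m, hm⟩
      simp at hm
      omega
    · lift n to ℕ using hn
      exact (HahnSeries.ofPowerSeries_apply_coeff (Γ := ℤ) _ n).trans (by simp)

theorem residue_regular {f : ℂ⸨X⸩} (hf : f ∈ regular) : residue f = 0 :=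
  mem_regular_iff.1 hf _ (by norm_num)

theorem derivative_regular {f : ℂ⸨X⸩} (hf : f ∈ regular) :
    LaurentSeries.derivative ℂ f ∈ regular := by
  rw [mem_regular_iff] at hf ⊢
  intro n hn
  obtain h | h : n = -1 ∨ n + 1 < 0 := by omega
  · subst h; simp [LaurentSeries.hasseDeriv_coeff]
  · have := hf _ h
    simp [LaurentSeries.hasseDeriv_coeff, this]

/-! ### Rational functions of the coordinate `t` of the Riemann sphere -/

theorem transcendental_single : Transcendental ℂ (HahnSeries.single (1 : ℤ) (1 : ℂ) : ℂ⸨X⸩) := by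
  rw [transcendental_iff]
  intro p hp
  have h : ∀ q : Polynomial ℂ, Polynomial.aeval (HahnSeries.single (1 : ℤ) (1 : ℂ) : ℂ⸨X⸩) q =
      HahnSeries.ofPowerSeries ℤ ℂ (q : PowerSeries ℂ) := by
    intro q
    induction q using Polynomial.induction_on' with
    | add p q hp hq => simp [hp, hq]
    | monomial n a =>
      simp only [Polynomial.aeval_monomial, Polynomial.coe_monomial]
      have : PowerSeries.monomial n a = PowerSeries.C a * PowerSeries.X ^ n := by
        rw [PowerSeries.X_pow_eq, ← PowerSeries.smul_eq_C_mul, ← map_smul, smul_eq_mul, mul_one]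
      rw [this, map_mul, map_pow, HahnSeries.ofPowerSeries_C, HahnSeries.ofPowerSeries_X]
      rfl
  rw [h] at hp
  have h2 : (p : PowerSeries ℂ) = 0 :=
    HahnSeries.ofPowerSeries_injective (Γ := ℤ) (hp.trans (map_zero _).symm)
  exact Polynomial.coe_injective ℂ (by simpa using h2)

/-- The local parameter `t = a + ξ` at a finite point `a` is transcendental. -/
theorem transcendental_at (a : ℂ) :
    Transcendental ℂ (algebraMap ℂ ℂ⸨X⸩ a + HahnSeries.single (1 : ℤ) (1 : ℂ)) := by
  intro h
  refine transcendental_single ?_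
  have := h.sub (isAlgebraic_algebraMap (R := ℂ) (A := ℂ⸨X⸩) a)
  simpa using this

/-- The local parameter `t = ξ⁻¹` at infinity is transcendental. -/
theorem transcendental_infty :
    Transcendental ℂ ((HahnSeries.single (1 : ℤ) (1 : ℂ) : ℂ⸨X⸩)⁻¹) := by
  intro h
  exact transcendental_single (by simpa using h.inv)

theorem transcendental_mul (ω : ℂˣ) :
    Transcendental ℂ (algebraMap ℂ (RatFunc ℂ) ω * RatFunc.X) := by
  intro h
  refine RatFunc.transcendental_X (K := ℂ) ?_
  have := (isAlgebraic_algebraMap (R := ℂ) (A := RatFunc ℂ) (ω⁻¹ : ℂˣ)).mul h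
  rwa [← mul_assoc, ← map_mul, Units.inv_mul, map_one, one_mul] at this

/-- The substitution of a transcendental element `x` of a field for the variable `t`. -/
def substitute {K : Type} [Field K] [Algebra ℂ K] (x : K) (hx : Transcendental ℂ x) :
    RatFunc ℂ →ₐ[ℂ] K :=
  RatFunc.liftAlgHom (Polynomial.aeval x)
    (nonZeroDivisors_le_comap_nonZeroDivisors_of_injective _
      (transcendental_iff_injective.1 hx))

/-- The Laurent expansion of a rational function at `a ∈ ℂ` in the parameter `ξ = t - a`. -/
def expandAt (a : ℂ) : RatFunc ℂ →ₐ[ℂ] ℂ⸨X⸩ := substitute _ (transcendental_at a)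

/-- The Laurent expansion of a rational function at `∞` in the parameter `ξ = t⁻¹`. -/
def expandInfty : RatFunc ℂ →ₐ[ℂ] ℂ⸨X⸩ := substitute _ transcendental_infty

/-- The rotation `f(t) ↦ f(ω t)` of rational functions. -/
def rotate (ω : ℂˣ) : RatFunc ℂ →ₐ[ℂ] RatFunc ℂ := substitute _ (transcendental_mul ω)

theorem substitute_X {K : Type} [Field K] [Algebra ℂ K] (x : K) (hx : Transcendental ℂ x) :
    substitute x hx RatFunc.X = x := by
  have h := RatFunc.liftAlgHom_apply_div (Polynomial.aeval x)
    (nonZeroDivisors_le_comap_nonZeroDivisors_of_injective _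
      (transcendental_iff_injective.1 hx)) Polynomial.X 1
  simpa [substitute] using h

theorem ratFunc_hom_ext {K : Type} [Field K] [Algebra ℂ K] {φ ψ : RatFunc ℂ →ₐ[ℂ] K}
    (h : φ RatFunc.X = ψ RatFunc.X) (f : RatFunc ℂ) : φ f = ψ f := by
  have hp : ∀ p : Polynomial ℂ, φ (algebraMap _ _ p) = ψ (algebraMap _ _ p) := by
    intro p
    have : φ.comp (IsScalarTower.toAlgHom ℂ (Polynomial ℂ) (RatFunc ℂ)) =
        ψ.comp (IsScalarTower.toAlgHom ℂ (Polynomial ℂ) (RatFunc ℂ)) := by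
      ext
      simpa using h
    exact DFunLike.congr_fun this p
  induction f using RatFunc.induction_on with
  | f p q hq => rw [map_div₀, map_div₀, hp, hp]

theorem scale_expandAt_zero (ω : ℂˣ) (f : RatFunc ℂ) :
    scale ω (expandAt 0 f) = expandAt 0 (rotate ω f) := by
  refine ratFunc_hom_ext (φ := (scale ω).comp (expandAt 0)) (ψ := (expandAt 0).comp (rotate ω)) ?_ f
  simp only [AlgHom.comp_apply, expandAt, rotate, substitute_X, map_mul, map_zero, zero_add,
    AlgHom.commutes]
  ext n
  rw [HahnSeries.algebraMap_apply, HahnSeries.C_mul_eq_smul]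
  by_cases h : n = 1
  · subst h; simp
  · simp [HahnSeries.coeff_single_of_ne h]

theorem scale_expandInfty (ω : ℂˣ) (f : RatFunc ℂ) :
    scale ω⁻¹ (expandInfty f) = expandInfty (rotate ω f) := by
  refine ratFunc_hom_ext (φ := (scale ω⁻¹).comp expandInfty) (ψ := expandInfty.comp (rotate ω)) ?_ f
  simp only [AlgHom.comp_apply, expandInfty, rotate, substitute_X, map_mul, AlgHom.commutes]
  rw [HahnSeries.inv_single]
  ext n
  rw [HahnSeries.algebraMap_apply, HahnSeries.C_mul_eq_smul]
  by_cases h : n = -1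
  · subst h; simp
  · simp [HahnSeries.coeff_single_of_ne h]

/-! ### The matrices `β`, `γ` and the Cartan subalgebra of `sl_N(ℂ)` -/

/-- The primitive root of unity `ε = exp(2πi/N)`. -/
def eps (N : ℕ) : ℂˣ := Units.mk0 (Complex.exp (2 * Real.pi * Complex.I / N)) (Complex.exp_ne_zero _)

/-- The cyclic shift `β`, with entries `1` at `(i, i + 1)` for `i` modulo `N`. -/
def betaMat (N : ℕ) [NeZero N] : Matrix (Fin N) (Fin N) ℂ :=
  Matrix.of fun i j => if j = i + 1 then 1 else 0

/-- The clock matrix `γ = diag(1, ε⁻¹, …, ε^{1-N})`. -/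
def gammaMat (N : ℕ) : Matrix (Fin N) (Fin N) ℂ :=
  Matrix.diagonal fun i => (((eps N)⁻¹ ^ (i : ℕ) : ℂˣ) : ℂ)

theorem betaMat_mul_apply (N : ℕ) [NeZero N] (A : Matrix (Fin N) (Fin N) ℂ) (i j : Fin N) :
    (betaMat N * A) i j = A (i + 1) j := by
  simp [Matrix.mul_apply, betaMat]

theorem mul_betaMat_apply (N : ℕ) [NeZero N] (A : Matrix (Fin N) (Fin N) ℂ) (i j : Fin N) :
    (A * betaMat N) i (j + 1) = A i j := by
  simp [Matrix.mul_apply, betaMat]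

theorem isUnit_betaMat (N : ℕ) [NeZero N] : IsUnit (betaMat N) := by
  have h : betaMat N * (betaMat N).transpose = 1 := by
    ext i j
    rw [betaMat_mul_apply, Matrix.transpose_apply, betaMat, Matrix.of_apply, Matrix.one_apply]
    simp
  exact IsUnit.of_mul_eq_one _ h

theorem isUnit_gammaMat (N : ℕ) : IsUnit (gammaMat N) := by
  rw [gammaMat, Matrix.isUnit_diagonal, Pi.isUnit_iff]
  exact fun i => Units.isUnit _

/-- The Cartan subalgebra `𝔥` of `sl_N(ℂ)`: the traceless diagonal matrices. -/
def cartan (N : ℕ) : Submodule ℂ (LieAlgebra.SpecialLinear.sl (Fin N) ℂ) where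
  carrier := {H | (H : Matrix (Fin N) (Fin N) ℂ).IsDiag}
  add_mem' hA hB := Matrix.IsDiag.add hA hB
  zero_mem' := Matrix.isDiag_zero
  smul_mem' c _ hA := Matrix.IsDiag.smul c hA

/-- The matrix underlying an element of the Cartan subalgebra. -/
def cartanMat {N : ℕ} (H : cartan N) : Matrix (Fin N) (Fin N) ℂ := H.1.1

theorem cartanMat_injective {N : ℕ} {H H' : cartan N} (h : cartanMat H = cartanMat H') : H = H' :=
  Subtype.ext (Subtype.ext h)

theorem trace_conj {N : ℕ} {g : Matrix (Fin N) (Fin N) ℂ} (hg : IsUnit g)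
    (A : Matrix (Fin N) (Fin N) ℂ) : (g * A * g⁻¹).trace = A.trace := by
  rw [Matrix.trace_mul_comm, ← mul_assoc,
    Matrix.nonsing_inv_mul _ ((Matrix.isUnit_iff_isUnit_det _).1 hg), one_mul]

theorem conj_betaMat_apply (N : ℕ) [NeZero N] (A : Matrix (Fin N) (Fin N) ℂ) (i j : Fin N) :
    (betaMat N * A * (betaMat N)⁻¹) i j = A (i + 1) (j + 1) := by
  rw [← mul_betaMat_apply N (betaMat N * A * (betaMat N)⁻¹) i j, mul_assoc,
    Matrix.nonsing_inv_mul _ ((Matrix.isUnit_iff_isUnit_det _).1 (isUnit_betaMat N)), mul_one,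
    betaMat_mul_apply]

/-- `Ad β` on the Cartan subalgebra. -/
def adBeta (N : ℕ) [NeZero N] : cartan N →ₗ[ℂ] cartan N where
  toFun H := ⟨⟨betaMat N * cartanMat H * (betaMat N)⁻¹, by
      have h : (cartanMat H).trace = 0 := H.1.2
      change (betaMat N * cartanMat H * (betaMat N)⁻¹).trace = 0
      exact (trace_conj (isUnit_betaMat N) _).trans h⟩, by
      intro i j hij
      have h : (cartanMat H).IsDiag := H.2
      change (betaMat N * cartanMat H * (betaMat N)⁻¹) i j = 0
      rw [conj_betaMat_apply]
      exact h (by simpa using hij)⟩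
  map_add' A B := cartanMat_injective (by
    change betaMat N * (cartanMat A + cartanMat B) * (betaMat N)⁻¹ =
      betaMat N * cartanMat A * (betaMat N)⁻¹ + betaMat N * cartanMat B * (betaMat N)⁻¹
    rw [mul_add, add_mul])
  map_smul' c A := cartanMat_injective (by
    change betaMat N * (c • cartanMat A) * (betaMat N)⁻¹ =
      c • (betaMat N * cartanMat A * (betaMat N)⁻¹)
    rw [Matrix.mul_smul, Matrix.smul_mul])

theorem one_sub_adBeta_injective (N : ℕ) [NeZero N] :
    Function.Injective (LinearMap.id - adBeta N : cartan N →ₗ[ℂ] cartan N) := by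
  rw [injective_iff_map_eq_zero]
  intro H hH
  have hH' : adBeta N H = H := (sub_eq_zero.1 hH).symm
  have h1 : ∀ i, cartanMat H (i + 1) (i + 1) = cartanMat H i i := by
    intro i
    rw [← conj_betaMat_apply N (cartanMat H) i i]
    exact congrFun (congrFun (congrArg cartanMat hH') i) i
  have h2 : ∀ (n : ℕ) (hn : n < N), cartanMat H ⟨n, hn⟩ ⟨n, hn⟩ = cartanMat H 0 0 := by
    intro n
    induction n with
    | zero => intro _; rfl
    | succ n ih =>
      intro hn
      have : (⟨n + 1, hn⟩ : Fin N) = ⟨n, by omega⟩ + 1 := by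
        apply Fin.ext
        rw [Fin.val_add, Fin.val_one', Nat.mod_eq_of_lt (a := 1) (by omega),
          Nat.mod_eq_of_lt hn]
      rw [this, h1, ih]
  have h3 : ∀ i, cartanMat H i i = cartanMat H 0 0 := fun i => h2 i i.2
  have ht : ∑ i, cartanMat H i i = 0 := H.1.2
  simp only [h3, Finset.sum_const, Finset.card_univ, Fintype.card_fin, nsmul_eq_mul, mul_eq_zero,
    Nat.cast_eq_zero, NeZero.ne N, false_or] at ht
  apply cartanMat_injective
  ext i j
  by_cases hij : i = j
  · subst hij; rw [h3, ht]; rfl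
  · exact H.2 hij

/-- The invertible operator `1 - Ad β` on the Cartan subalgebra. -/
def oneSubAdBeta (N : ℕ) [NeZero N] : cartan N ≃ₗ[ℂ] cartan N :=
  LinearEquiv.ofInjectiveEndo (LinearMap.id - adBeta N) (one_sub_adBeta_injective N)

/-- `λ̃ = λ ∘ (1 - Ad β)⁻¹ ∘ Ad β = -λ ∘ (1 - Ad β⁻¹)⁻¹`. -/
def weightAtZero {N : ℕ} [NeZero N] (l : Module.Dual ℂ (cartan N)) : Module.Dual ℂ (cartan N) :=
  l ∘ₗ (oneSubAdBeta N).symm.toLinearMap ∘ₗ adBeta N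

/-- `λ̃' = -λ ∘ (1 - Ad β)⁻¹`. -/
def weightAtInfty {N : ℕ} [NeZero N] (l : Module.Dual ℂ (cartan N)) : Module.Dual ℂ (cartan N) :=
  -(l ∘ₗ (oneSubAdBeta N).symm.toLinearMap)

/-! ### Loop algebras and sections of the twisted bundle -/

/-- `sl_N(K)` as a complex Lie algebra; for `K = ℂ((ξ))` this is the loop algebra `𝔤((ξ))`. -/
def slOver (N : ℕ) (K : Type) [Field K] [Algebra ℂ K] : LieSubalgebra ℂ (Matrix (Fin N) (Fin N) K) where
  carrier := {A | A.trace = 0}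
  add_mem' {A B} hA hB := by
    simp only [Set.mem_ofPred_eq] at *; rw [Matrix.trace_add, hA, hB, add_zero]
  zero_mem' := Matrix.trace_zero _ _
  smul_mem' c A hA := by
    simp only [Set.mem_ofPred_eq] at *; rw [Matrix.trace_smul, hA, smul_zero]
  lie_mem' {A B} _ _ := LieAlgebra.matrix_trace_commutator_zero _ _ A B

/-- The constant matrix over `K` with complex entries. -/
def constMat {N : ℕ} (K : Type) [Field K] [Algebra ℂ K] (A : Matrix (Fin N) (Fin N) ℂ) :
    Matrix (Fin N) (Fin N) K := A.map (algebraMap ℂ K)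

/-- `sl_N`-valued functions `A` with `A(ωt) = Ad γ (A(t))`, where `σ` is the substitution
`f(t) ↦ f(ωt)`. -/
def twisted (N : ℕ) {K : Type} [Field K] [Algebra ℂ K] (σ : K →ₐ[ℂ] K) :
    LieSubalgebra ℂ (Matrix (Fin N) (Fin N) K) where
  carrier := {A | A.trace = 0 ∧
    A.map σ = constMat K (gammaMat N) * A * constMat K ((gammaMat N)⁻¹)}
  add_mem' {A B} hA hB := by
    refine ⟨(slOver N K).add_mem hA.1 hB.1, ?_⟩
    rw [Matrix.map_add _ (map_add σ), hA.2, hB.2, mul_add, add_mul]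
  zero_mem' := ⟨(slOver N K).zero_mem, by
    rw [Matrix.map_zero _ (map_zero σ), mul_zero, zero_mul]⟩
  smul_mem' c A hA := by
    refine ⟨(slOver N K).smul_mem c hA.1, ?_⟩
    rw [Matrix.map_smul _ _ (fun a => map_smul σ c a), hA.2, Matrix.mul_smul, Matrix.smul_mul]
  lie_mem' {A B} hA hB := by
    refine ⟨(slOver N K).lie_mem hA.1 hB.1, ?_⟩
    have hu : constMat K ((gammaMat N)⁻¹) * constMat K (gammaMat N) = 1 := by
      rw [constMat, constMat, ← Matrix.map_mul,
        Matrix.nonsing_inv_mul _ ((Matrix.isUnit_iff_isUnit_det _).1 (isUnit_gammaMat N)),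
        Matrix.map_one _ (map_zero _) (map_one _)]
    have hmul : ∀ X Y : Matrix (Fin N) (Fin N) K,
        constMat K (gammaMat N) * X * constMat K ((gammaMat N)⁻¹) *
          (constMat K (gammaMat N) * Y * constMat K ((gammaMat N)⁻¹)) =
        constMat K (gammaMat N) * (X * Y) * constMat K ((gammaMat N)⁻¹) := by
      intro X Y
      calc _ = constMat K (gammaMat N) * X * (constMat K ((gammaMat N)⁻¹) * constMat K (gammaMat N))
            * (Y * constMat K ((gammaMat N)⁻¹)) := by noncomm_ring
        _ = _ := by rw [hu]; noncomm_ring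
    have hm : ∀ X Y : Matrix (Fin N) (Fin N) K, (X * Y).map σ = X.map σ * Y.map σ :=
      fun X Y => Matrix.map_mul (f := (σ : K →+* K))
    rw [LieRing.of_associative_ring_bracket, Matrix.map_sub _ (map_sub σ), hm, hm, hA.2, hB.2,
      hmul, hmul, mul_sub, sub_mul]

/-- The loop algebra `𝔤((ξ))`. -/
abbrev loop (N : ℕ) : LieSubalgebra ℂ (Matrix (Fin N) (Fin N) ℂ⸨X⸩) := slOver N ℂ⸨X⸩

/-- The twisted loop algebra at the fixed point `t = 0`, in the parameter `t`. -/
abbrev loopZero (N : ℕ) : LieSubalgebra ℂ (Matrix (Fin N) (Fin N) ℂ⸨X⸩) :=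
  twisted N (scale (eps N))

/-- The twisted loop algebra at the fixed point `t = ∞`, in the parameter `t⁻¹`. -/
abbrev loopInfty (N : ℕ) : LieSubalgebra ℂ (Matrix (Fin N) (Fin N) ℂ⸨X⸩) :=
  twisted N (scale (eps N)⁻¹)

/-- The global meromorphic sections of the twisted bundle on the orbifold: `sl_N`-valued rational
functions `f(t)` on the Riemann sphere with `f(εt) = Ad γ (f(t))`. -/
abbrev orbSections (N : ℕ) : LieSubalgebra ℂ (Matrix (Fin N) (Fin N) (RatFunc ℂ)) :=
  twisted N (rotate (eps N))

theorem trace_map_eq_zero {N : ℕ} {K K' : Type} [Field K] [Field K'] [Algebra ℂ K] [Algebra ℂ K']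
    (φ : K →ₐ[ℂ] K') {A : Matrix (Fin N) (Fin N) K} (hA : A.trace = 0) : (A.map φ).trace = 0 := by
  have : (A.map φ).trace = φ A.trace := by simp [Matrix.trace]
  rw [this, hA, map_zero]

theorem map_mem_twisted {N : ℕ} {K K' : Type} [Field K] [Field K'] [Algebra ℂ K] [Algebra ℂ K']
    (φ : K →ₐ[ℂ] K') (σ : K →ₐ[ℂ] K) (σ' : K' →ₐ[ℂ] K') (h : ∀ f, σ' (φ f) = φ (σ f))
    {A : Matrix (Fin N) (Fin N) K} (hA : A ∈ twisted N σ) : A.map φ ∈ twisted N σ' := by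
  refine ⟨trace_map_eq_zero φ hA.1, ?_⟩
  have hm : ∀ X Y : Matrix (Fin N) (Fin N) K, (X * Y).map φ = X.map φ * Y.map φ :=
    fun X Y => Matrix.map_mul (f := (φ : K →+* K'))
  have hc : ∀ B : Matrix (Fin N) (Fin N) ℂ, (constMat K B).map φ = constMat K' B := by
    intro B; ext i j; simp [constMat]
  have : (A.map φ).map σ' = (A.map σ).map φ := by
    ext i j : 2
    exact h _
  rw [this, hA.2, hm, hm, hc, hc]

/-- The germ of a section at the point with coordinate `a`, in the parameter `t - a`. -/
def germAt {N : ℕ} (a : ℂ) (f : orbSections N) : loop N :=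
  ⟨f.1.map (expandAt a), trace_map_eq_zero _ f.2.1⟩

/-- The germ of a section at `t = 0`. -/
def germZero {N : ℕ} (f : orbSections N) : loopZero N :=
  ⟨f.1.map (expandAt 0), map_mem_twisted _ _ _ (scale_expandAt_zero _) f.2⟩

/-- The germ of a section at `t = ∞`. -/
def germInfty {N : ℕ} (f : orbSections N) : loopInfty N :=
  ⟨f.1.map expandInfty, map_mem_twisted _ _ _ (scale_expandInfty _) f.2⟩

/-- A Laurent series of matrices without polar part. -/
def IsRegular {N : ℕ} (A : Matrix (Fin N) (Fin N) ℂ⸨X⸩) : Prop := ∀ i j, A i j ∈ regular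

/-- The constant term of a Laurent series of matrices. -/
def constTerm {N : ℕ} (A : Matrix (Fin N) (Fin N) ℂ⸨X⸩) : Matrix (Fin N) (Fin N) ℂ :=
  A.map fun f => f.coeff 0

theorem IsRegular.mul {N : ℕ} {A B : Matrix (Fin N) (Fin N) ℂ⸨X⸩} (hA : IsRegular A)
    (hB : IsRegular B) : IsRegular (A * B) := fun i j => by
  rw [Matrix.mul_apply]
  exact sum_mem fun k _ => mul_mem (hA _ _) (hB _ _)

theorem IsRegular.lie {N : ℕ} {A B : Matrix (Fin N) (Fin N) ℂ⸨X⸩} (hA : IsRegular A)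
    (hB : IsRegular B) : IsRegular ⁅A, B⁆ := fun i j =>
  sub_mem ((hA.mul hB) i j) ((hB.mul hA) i j)

theorem constTerm_mul {N : ℕ} {A B : Matrix (Fin N) (Fin N) ℂ⸨X⸩} (hA : IsRegular A)
    (hB : IsRegular B) : constTerm (A * B) = constTerm A * constTerm B := by
  ext i j
  simp only [constTerm, Matrix.map_apply, Matrix.mul_apply]
  rw [HahnSeries.coeff_sum]
  exact Finset.sum_congr rfl fun k _ => coeff_zero_mul_of_regular (hA _ _) (hB _ _)

theorem constTerm_lie {N : ℕ} {A B : Matrix (Fin N) (Fin N) ℂ⸨X⸩} (hA : IsRegular A)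
    (hB : IsRegular B) : constTerm ⁅A, B⁆ = ⁅constTerm A, constTerm B⁆ := by
  rw [LieRing.of_associative_ring_bracket, LieRing.of_associative_ring_bracket,
    ← constTerm_mul hA hB, ← constTerm_mul hB hA]
  rfl

/-! ### Affine Lie algebras -/

/-- Entrywise derivative of a Laurent series of matrices. -/
def matDeriv {N : ℕ} : Matrix (Fin N) (Fin N) ℂ⸨X⸩ →ₗ[ℂ] Matrix (Fin N) (Fin N) ℂ⸨X⸩ :=
  LinearMap.mapMatrix (LaurentSeries.derivative ℂ)

theorem matDeriv_mul {N : ℕ} (A B : Matrix (Fin N) (Fin N) ℂ⸨X⸩) :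
    matDeriv (A * B) = matDeriv A * B + A * matDeriv B := by
  refine Matrix.ext fun i j => ?_
  change LaurentSeries.derivative ℂ (∑ k, A i k * B k j) =
    (∑ k, LaurentSeries.derivative ℂ (A i k) * B k j) +
      ∑ k, A i k * LaurentSeries.derivative ℂ (B k j)
  rw [map_sum, ← Finset.sum_add_distrib]
  exact Finset.sum_congr rfl fun k _ => derivative_mul _ _

theorem trace_matDeriv {N : ℕ} (A : Matrix (Fin N) (Fin N) ℂ⸨X⸩) :
    residue (matDeriv A).trace = 0 := by
  have : (matDeriv A).trace = LaurentSeries.derivative ℂ A.trace := by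
    simp only [Matrix.trace, map_sum]
    rfl
  rw [this, residue_derivative]

/-- The residue pairing `Res (∇A | B) = Res tr (A' B) dξ`. -/
def resPairing {N : ℕ} (A B : Matrix (Fin N) (Fin N) ℂ⸨X⸩) : ℂ :=
  residue (matDeriv A * B).trace

theorem resPairing_smul_left {N : ℕ} (r : ℂ) (A B : Matrix (Fin N) (Fin N) ℂ⸨X⸩) :
    resPairing (r • A) B = r * resPairing A B := by
  have h : matDeriv (r • A) * B = r • (matDeriv A * B) := by
    rw [map_smul]; exact Matrix.smul_mul r _ B
  rw [resPairing, h, Matrix.trace_smul, map_smul, smul_eq_mul, resPairing]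

theorem resPairing_smul_right {N : ℕ} (r : ℂ) (A B : Matrix (Fin N) (Fin N) ℂ⸨X⸩) :
    resPairing A (r • B) = r * resPairing A B := by
  have h : matDeriv A * (r • B) = r • (matDeriv A * B) := Matrix.mul_smul _ r B
  rw [resPairing, h, Matrix.trace_smul, map_smul, smul_eq_mul, resPairing]

theorem resPairing_regular {N : ℕ} {A B : Matrix (Fin N) (Fin N) ℂ⸨X⸩} (hA : IsRegular A)
    (hB : IsRegular B) : resPairing A B = 0 := by
  have h : IsRegular (matDeriv A) := fun i j => derivative_regular (hA i j)
  exact residue_regular (sum_mem fun i _ => (h.mul hB) i i)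

theorem resPairing_self {N : ℕ} (A : Matrix (Fin N) (Fin N) ℂ⸨X⸩) : resPairing A A = 0 := by
  have h := trace_matDeriv (A * A)
  rw [matDeriv_mul, Matrix.trace_add, Matrix.trace_mul_comm A, map_add] at h
  exact add_self_eq_zero.1 h

theorem resPairing_cocycle {N : ℕ} (A B C : Matrix (Fin N) (Fin N) ℂ⸨X⸩) :
    resPairing A ⁅B, C⁆ = resPairing ⁅A, B⁆ C + resPairing B ⁅A, C⁆ := by
  simp only [resPairing, LieRing.of_associative_ring_bracket, map_sub, matDeriv_mul]
  rw [← map_add, ← Matrix.trace_add]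
  congr 1
  have h1 := Matrix.trace_mul_comm B (matDeriv A * C)
  have h2 := Matrix.trace_mul_comm A (matDeriv B * C)
  simp only [mul_sub, sub_mul, add_mul, Matrix.trace_sub, Matrix.trace_add, ← mul_assoc] at *
  linear_combination h1 - h2

/-- The 2-cocycle `(A, B) ↦ c · Res (∇A | B)` on a Lie algebra of Laurent series of matrices. -/
def affineCocycle {N : ℕ} (𝔏 : LieSubalgebra ℂ (Matrix (Fin N) (Fin N) ℂ⸨X⸩)) (c : ℂ) :
    LieModule.Cohomology.twoCocycle ℂ 𝔏 (TrivialLieModule ℂ 𝔏 ℂ) :=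
  ⟨⟨LinearMap.mk₂ ℂ (fun A B => (TrivialLieModule.equiv ℂ 𝔏 ℂ).symm (c * resPairing A.1 B.1))
      (fun A A' B => by
        rw [← map_add, ← mul_add]; congr 2
        simp [resPairing, add_mul])
      (fun r A B => by
        rw [← map_smul, smul_eq_mul, mul_left_comm]
        exact congrArg (fun z => (TrivialLieModule.equiv ℂ 𝔏 ℂ).symm (c * z))
          (resPairing_smul_left r A.1 B.1))
      (fun A B B' => by
        rw [← map_add, ← mul_add]; congr 2
        simp [resPairing, mul_add])
      (fun r A B => by
        rw [← map_smul, smul_eq_mul, mul_left_comm]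
        exact congrArg (fun z => (TrivialLieModule.equiv ℂ 𝔏 ℂ).symm (c * z))
          (resPairing_smul_right r A.1 B.1)),
    fun A => by
      change (TrivialLieModule.equiv ℂ 𝔏 ℂ).symm (c * resPairing A.1 A.1) = 0
      rw [resPairing_self, mul_zero, map_zero]⟩,
    by
      rw [LieModule.Cohomology.mem_twoCocycle_iff_of_trivial]
      intro A B C
      change (TrivialLieModule.equiv ℂ 𝔏 ℂ).symm (c * resPairing A.1 ⁅B.1, C.1⁆) =
        (TrivialLieModule.equiv ℂ 𝔏 ℂ).symm (c * resPairing ⁅A.1, B.1⁆ C.1) +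
        (TrivialLieModule.equiv ℂ 𝔏 ℂ).symm (c * resPairing B.1 ⁅A.1, C.1⁆)
      rw [← map_add, ← mul_add, resPairing_cocycle]⟩

/-- The central extension `𝔏 ⊕ ℂ k̂` with bracket `[A, B] = [A, B]° ⊕ c · Res (∇A | B) k̂`. -/
abbrev Affine {N : ℕ} (𝔏 : LieSubalgebra ℂ (Matrix (Fin N) (Fin N) ℂ⸨X⸩)) (c : ℂ) : Type :=
  LieAlgebra.ofTwoCocycle (affineCocycle 𝔏 c)

/-- The element `A ⊕ r k̂` of the central extension. -/
def Affine.mk {N : ℕ} {𝔏 : LieSubalgebra ℂ (Matrix (Fin N) (Fin N) ℂ⸨X⸩)} {c : ℂ} (A : 𝔏) (r : ℂ) :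
    Affine 𝔏 c := LieAlgebra.ofProd _ (A, (TrivialLieModule.equiv ℂ 𝔏 ℂ).symm r)

/-- The `𝔏`-component of an element of the central extension. -/
def Affine.toLoop {N : ℕ} {𝔏 : LieSubalgebra ℂ (Matrix (Fin N) (Fin N) ℂ⸨X⸩)} {c : ℂ}
    (x : Affine 𝔏 c) : 𝔏 := x.carrier.1

/-- The coefficient of `k̂` in an element of the central extension. -/
def Affine.level {N : ℕ} {𝔏 : LieSubalgebra ℂ (Matrix (Fin N) (Fin N) ℂ⸨X⸩)} {c : ℂ}
    (x : Affine 𝔏 c) : ℂ := TrivialLieModule.equiv ℂ 𝔏 ℂ x.carrier.2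

theorem Affine.mk_lie_mk {N : ℕ} {𝔏 : LieSubalgebra ℂ (Matrix (Fin N) (Fin N) ℂ⸨X⸩)} {c : ℂ}
    (A B : 𝔏) (r s : ℂ) :
    ⁅(Affine.mk A r : Affine 𝔏 c), (Affine.mk B s : Affine 𝔏 c)⁆ =
      Affine.mk ⁅A, B⁆ (c * resPairing A.1 B.1) := by
  rw [LieAlgebra.bracket_ofTwoCocycle]
  simp only [trivial_lie_zero, add_zero, sub_zero]
  rfl

/-- The affine Lie algebra at an ordinary marked point. -/
abbrev AffineAt (N : ℕ) : Type := Affine (loop N) 1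

/-- The twisted affine Lie algebra at `t = 0`, with cocycle `(1/N) Res`. -/
abbrev AffineZero (N : ℕ) : Type := Affine (loopZero N) (1 / N)

/-- The twisted affine Lie algebra at `t = ∞`, with cocycle `(1/N) Res`. -/
abbrev AffineInfty (N : ℕ) : Type := Affine (loopInfty N) (1 / N)

/-- The subalgebra `𝔤[[ξ]] ⊕ ℂ k̂` of the affine Lie algebra. -/
def affinePlus (N : ℕ) : LieSubalgebra ℂ (AffineAt N) where
  carrier := {x | IsRegular x.toLoop.1}
  add_mem' hA hB := fun i j => add_mem (hA i j) (hB i j)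
  zero_mem' := fun _ _ => zero_mem _
  smul_mem' c _ hA := fun i j => Subalgebra.smul_mem _ (hA i j) c
  lie_mem' hA hB := hA.lie hB

/-! ### Induced modules, Weyl modules and Verma modules -/

section Induced

variable {𝔞 : Type v} [LieRing 𝔞] [LieAlgebra ℂ 𝔞]

/-- The Lie module structure on a module over the enveloping algebra. -/
abbrev lieRingModuleOfEnveloping (Q : Type w) [AddCommGroup Q]
    [Module (UniversalEnvelopingAlgebra ℂ 𝔞) Q] : LieRingModule 𝔞 Q where
  bracket x q := UniversalEnvelopingAlgebra.ι ℂ x • q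
  add_lie x y q := by rw [map_add, add_smul]
  lie_add x q q' := smul_add _ _ _
  leibniz_lie x y q := by
    rw [LieHom.map_lie, LieRing.of_associative_ring_bracket, sub_smul, mul_smul, mul_smul,
      sub_add_cancel]

/-- The relations `x ⊗ v = 1 ⊗ x v`, `x ∈ 𝔟`, defining the induced module. -/
def inducedRelations (𝔟 : LieSubalgebra ℂ 𝔞) {V : Type w} [AddCommGroup V] [Module ℂ V]
    (ρ : 𝔟 →ₗ⁅ℂ⁆ Module.End ℂ V) :
    Submodule (UniversalEnvelopingAlgebra ℂ 𝔞) (UniversalEnvelopingAlgebra ℂ 𝔞 ⊗[ℂ] V) :=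
  Submodule.span _ {z | ∃ (x : 𝔟) (v : V),
    z = UniversalEnvelopingAlgebra.ι ℂ (x : 𝔞) ⊗ₜ[ℂ] v - 1 ⊗ₜ[ℂ] ρ x v}

/-- The induced module `Ind_𝔟^𝔞 V = U(𝔞) ⊗_{U(𝔟)} V`. -/
def Induced (𝔟 : LieSubalgebra ℂ 𝔞) {V : Type w} [AddCommGroup V] [Module ℂ V]
    (ρ : 𝔟 →ₗ⁅ℂ⁆ Module.End ℂ V) : Type (max v w) :=
  (UniversalEnvelopingAlgebra ℂ 𝔞 ⊗[ℂ] V) ⧸ inducedRelations 𝔟 ρ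

variable (𝔟 : LieSubalgebra ℂ 𝔞) {V : Type w} [AddCommGroup V] [Module ℂ V]
  (ρ : 𝔟 →ₗ⁅ℂ⁆ Module.End ℂ V)

instance : AddCommGroup (Induced 𝔟 ρ) :=
  inferInstanceAs (AddCommGroup (_ ⧸ inducedRelations 𝔟 ρ))

instance : Module (UniversalEnvelopingAlgebra ℂ 𝔞) (Induced 𝔟 ρ) :=
  inferInstanceAs (Module (UniversalEnvelopingAlgebra ℂ 𝔞) (_ ⧸ inducedRelations 𝔟 ρ))

instance : Module ℂ (Induced 𝔟 ρ) :=
  inferInstanceAs (Module ℂ (_ ⧸ inducedRelations 𝔟 ρ))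

instance : IsScalarTower ℂ (UniversalEnvelopingAlgebra ℂ 𝔞) (Induced 𝔟 ρ) :=
  inferInstanceAs (IsScalarTower ℂ (UniversalEnvelopingAlgebra ℂ 𝔞) (_ ⧸ inducedRelations 𝔟 ρ))

instance : LieRingModule 𝔞 (Induced 𝔟 ρ) := lieRingModuleOfEnveloping _

instance : LieModule ℂ 𝔞 (Induced 𝔟 ρ) where
  smul_lie c x q := by
    change UniversalEnvelopingAlgebra.ι ℂ (c • x) • q = c • UniversalEnvelopingAlgebra.ι ℂ x • q
    rw [map_smul, smul_assoc]
  lie_smul c x q := smul_algebra_smul_comm c (UniversalEnvelopingAlgebra.ι ℂ x) q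

/-- The canonical map `V → Ind V`, `v ↦ 1 ⊗ v`. -/
def Induced.incl : V →ₗ[ℂ] Induced 𝔟 ρ :=
  ((inducedRelations 𝔟 ρ).mkQ.restrictScalars ℂ) ∘ₗ
    TensorProduct.mk ℂ (UniversalEnvelopingAlgebra ℂ 𝔞) V 1

/-- The cyclic module `U(𝔞) / J` for a left ideal `J`. -/
def Cyclic (J : Submodule (UniversalEnvelopingAlgebra ℂ 𝔞) (UniversalEnvelopingAlgebra ℂ 𝔞)) :
    Type v := UniversalEnvelopingAlgebra ℂ 𝔞 ⧸ J

variable (J : Submodule (UniversalEnvelopingAlgebra ℂ 𝔞) (UniversalEnvelopingAlgebra ℂ 𝔞))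

instance : AddCommGroup (Cyclic J) := inferInstanceAs (AddCommGroup (_ ⧸ J))

instance : Module (UniversalEnvelopingAlgebra ℂ 𝔞) (Cyclic J) :=
  inferInstanceAs (Module (UniversalEnvelopingAlgebra ℂ 𝔞) (_ ⧸ J))

instance : Module ℂ (Cyclic J) := inferInstanceAs (Module ℂ (_ ⧸ J))

instance : IsScalarTower ℂ (UniversalEnvelopingAlgebra ℂ 𝔞) (Cyclic J) :=
  inferInstanceAs (IsScalarTower ℂ (UniversalEnvelopingAlgebra ℂ 𝔞) (_ ⧸ J))

instance : LieRingModule 𝔞 (Cyclic J) := lieRingModuleOfEnveloping _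

instance : LieModule ℂ 𝔞 (Cyclic J) where
  smul_lie c x q := by
    change UniversalEnvelopingAlgebra.ι ℂ (c • x) • q = c • UniversalEnvelopingAlgebra.ι ℂ x • q
    rw [map_smul, smul_assoc]
  lie_smul c x q := smul_algebra_smul_comm c (UniversalEnvelopingAlgebra.ι ℂ x) q

/-- The class of `1` in `U(𝔞) / J`. -/
def Cyclic.vac : Cyclic J := J.mkQ 1

end Induced

section Weyl

variable {N : ℕ} (k : ℂ) (V : Type u) [AddCommGroup V] [Module ℂ V]
  [LieRingModule (LieAlgebra.SpecialLinear.sl (Fin N) ℂ) V]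
  [LieModule ℂ (LieAlgebra.SpecialLinear.sl (Fin N) ℂ) V]

/-- The value at `ξ = 0` of an element of `𝔤[[ξ]] ⊕ ℂ k̂`. -/
def evalAtPoint (x : affinePlus N) : LieAlgebra.SpecialLinear.sl (Fin N) ℂ :=
  ⟨constTerm x.1.toLoop.1, by
    have h : (x.1.toLoop.1).trace = 0 := x.1.toLoop.2
    have h' := congrArg (fun f : ℂ⸨X⸩ => f.coeff 0) h
    simp only [Matrix.trace, HahnSeries.coeff_sum] at h'
    exact h'⟩

/-- The action of `𝔤[[ξ]] ⊕ ℂ k̂` on a `𝔤`-module: `𝔤[[ξ]]` acts through its value at `ξ = 0` and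
`k̂` acts as the scalar `k`. -/
def evalRep : affinePlus N →ₗ⁅ℂ⁆ Module.End ℂ V where
  toFun x := LieModule.toEnd ℂ (LieAlgebra.SpecialLinear.sl (Fin N) ℂ) V (evalAtPoint x) +
    (k * x.1.level) • LinearMap.id
  map_add' x y := by
    have h1 : evalAtPoint (x + y) = evalAtPoint x + evalAtPoint y := rfl
    have h2 : (x + y).1.level = x.1.level + y.1.level := rfl
    rw [h1, h2, map_add, mul_add, add_smul]
    abel
  map_smul' c x := by
    have h1 : evalAtPoint (c • x) = c • evalAtPoint x := rfl
    have h2 : (c • x).1.level = c * x.1.level := rfl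
    rw [h1, h2, map_smul, RingHom.id_apply, smul_add, smul_smul, mul_left_comm]
  map_lie' {x y} := by
    have h1 : evalAtPoint ⁅x, y⁆ = ⁅evalAtPoint x, evalAtPoint y⁆ :=
      Subtype.ext (constTerm_lie x.2 y.2)
    have h2 : (⁅x, y⁆ : affinePlus N).1.level = 0 := by
      have h := congrArg Affine.level
        (Affine.mk_lie_mk (c := 1) x.1.toLoop y.1.toLoop x.1.level y.1.level)
      refine h.trans ?_
      change 1 * resPairing x.1.toLoop.1 y.1.toLoop.1 = 0
      rw [resPairing_regular x.2 y.2, mul_zero]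
    rw [h1, h2, LieHom.map_lie, mul_zero, zero_smul, add_zero]
    ext v
    simp only [LieRing.of_associative_ring_bracket, LinearMap.sub_apply, Module.End.mul_apply,
      LinearMap.add_apply, LinearMap.smul_apply, LinearMap.id_apply, map_add, map_smul, smul_add,
      smul_smul]
    rw [mul_comm (k * y.1.level)]
    abel

/-- The Weyl module `M(V)` of level `k`, induced from `𝔤[[ξ]] ⊕ ℂ k̂`. -/
abbrev Weyl : Type u := Induced (affinePlus N) (evalRep k V)

/-- The canonical map `V → M(V)`. -/
abbrev Weyl.incl : V →ₗ[ℂ] Weyl (N := N) k V := Induced.incl (affinePlus N) (evalRep k V)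

end Weyl

section Verma

variable {N : ℕ}

/-- A Laurent series of matrices with strictly positive powers only. -/
def IsPositive (A : Matrix (Fin N) (Fin N) ℂ⸨X⸩) : Prop := ∀ i j, ∀ n ≤ 0, (A i j).coeff n = 0

theorem const_mem_twisted {K : Type} [Field K] [Algebra ℂ K] (σ : K →ₐ[ℂ] K) (H : cartan N) :
    constMat K (cartanMat H) ∈ twisted N σ := by
  have hconj : gammaMat N * cartanMat H * (gammaMat N)⁻¹ = cartanMat H := by
    have hd : Matrix.diagonal (cartanMat H).diag = cartanMat H :=
      Matrix.IsDiag.diagonal_diag H.2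
    have hc : gammaMat N * cartanMat H = cartanMat H * gammaMat N := by
      rw [← hd, gammaMat, Matrix.diagonal_mul_diagonal, Matrix.diagonal_mul_diagonal]
      simp only [mul_comm]
    rw [hc, mul_assoc, Matrix.mul_nonsing_inv _
      ((Matrix.isUnit_iff_isUnit_det _).1 (isUnit_gammaMat N)), mul_one]
  refine ⟨trace_map_eq_zero (Algebra.ofId ℂ K) (A := cartanMat H) H.1.2, ?_⟩
  have hσ : (constMat K (cartanMat H)).map σ = constMat K (cartanMat H) := by
    ext i j
    simp [constMat]
  rw [hσ]
  conv_lhs => rw [← hconj]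
  simp only [constMat, Matrix.map_mul]

/-- An element of the Cartan subalgebra as a constant function. -/
def constCartan {ω : ℂˣ} (H : cartan N) : twisted N (scale ω) :=
  ⟨constMat ℂ⸨X⸩ (cartanMat H), const_mem_twisted _ H⟩

/-- The left ideal generated by `𝔫₊`, by `H - l(H)` for `H ∈ 𝔥`, and by `k̂ - k`. -/
def vermaIdeal (ω : ℂˣ) (c k : ℂ) (l : Module.Dual ℂ (cartan N)) :
    Submodule (UniversalEnvelopingAlgebra ℂ (Affine (twisted N (scale ω)) c))
      (UniversalEnvelopingAlgebra ℂ (Affine (twisted N (scale ω)) c)) :=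
  Submodule.span _
    ({y | ∃ A : twisted N (scale ω), IsPositive A.1 ∧
        y = UniversalEnvelopingAlgebra.ι ℂ (Affine.mk A 0)} ∪
     {y | ∃ H : cartan N, y = UniversalEnvelopingAlgebra.ι ℂ (Affine.mk (constCartan H) 0) -
        algebraMap ℂ _ (l H)} ∪
     {UniversalEnvelopingAlgebra.ι ℂ (Affine.mk 0 1) - algebraMap ℂ _ k})

/-- The Verma module of highest weight `l` and level `k` of the twisted affine algebra at `0`. -/
abbrev VermaZero (k : ℂ) (l : Module.Dual ℂ (cartan N)) : Type :=
  Cyclic (vermaIdeal (eps N) (1 / N) k l)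

/-- The Verma module of highest weight `l` and level `k` of the twisted affine algebra at `∞`. -/
abbrev VermaInfty (k : ℂ) (l : Module.Dual ℂ (cartan N)) : Type :=
  Cyclic (vermaIdeal (eps N)⁻¹ (1 / N) k l)

end Verma

/-! ### Conformal coinvariants -/

section Coinvariants

variable {N : ℕ} {L : ℕ}

/-- The endomorphism `∑ᵢ 1 ⊗ ⋯ ⊗ eᵢ ⊗ ⋯ ⊗ 1` of a tensor product. -/
def tensorSum {M : Fin L → Type u} [∀ i, AddCommGroup (M i)] [∀ i, Module ℂ (M i)]
    (e : ∀ i, Module.End ℂ (M i)) : Module.End ℂ (⨂[ℂ] i, M i) :=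
  ∑ i, PiTensorProduct.map (Function.update (fun _ => LinearMap.id) i (e i))

/-- `a` lies on the orbit under the cyclic group `C_N` of one of the points `t i`. -/
def IsMarked (N : ℕ) (t : Fin L → ℂ) (a : ℂ) : Prop := ∃ (i : Fin L) (j : ℤ), a = (eps N ^ j : ℂˣ) * t i

theorem map_lie {K K' : Type} [Field K] [Field K'] [Algebra ℂ K] [Algebra ℂ K'] (φ : K →ₐ[ℂ] K')
    (A B : Matrix (Fin N) (Fin N) K) : ⁅A, B⁆.map φ = ⁅A.map φ, B.map φ⁆ := by
  have hm : ∀ X Y : Matrix (Fin N) (Fin N) K, (X * Y).map φ = X.map φ * Y.map φ :=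
    fun X Y => Matrix.map_mul (f := (φ : K →+* K'))
  rw [LieRing.of_associative_ring_bracket, LieRing.of_associative_ring_bracket,
    Matrix.map_sub _ (map_sub φ), hm, hm]

/-- The Lie algebra of sections of the twisted bundle on the orbifold, with poles at the marked
points, at `0` and at `∞`. -/
def gOrb (N : ℕ) (t : Fin L → ℂ) : LieSubalgebra ℂ (orbSections N) where
  carrier := {f | ∀ a : ℂ, a ≠ 0 → ¬ IsMarked N t a → IsRegular (germAt a f).1}
  add_mem' {f g} hf hg a h0 ha i j := by
    have h : (germAt a (f + g)).1 i j = (germAt a f).1 i j + (germAt a g).1 i j :=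
      map_add (expandAt a) _ _
    rw [h]
    exact add_mem (hf a h0 ha i j) (hg a h0 ha i j)
  zero_mem' a _ _ i j := by
    have h : (germAt a (0 : orbSections N)).1 i j = 0 := map_zero (expandAt a)
    rw [h]
    exact zero_mem _
  smul_mem' c f hf a h0 ha i j := by
    have h : (germAt a (c • f)).1 i j = c • (germAt a f).1 i j :=
      map_smul (expandAt a) _ _
    rw [h]
    exact regular.smul_mem (hf a h0 ha i j) c
  lie_mem' {f g} hf hg a h0 ha := by
    have h : (germAt a ⁅f, g⁆).1 = ⁅(germAt a f).1, (germAt a g).1⁆ := map_lie _ _ _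
    rw [h]
    exact (hf a h0 ha).lie (hg a h0 ha)

theorem conj_lie {g : Matrix (Fin N) (Fin N) ℂ} (hg : IsUnit g) (A B : Matrix (Fin N) (Fin N) ℂ) :
    g * ⁅A, B⁆ * g⁻¹ = ⁅g * A * g⁻¹, g * B * g⁻¹⁆ := by
  have hu : g⁻¹ * g = 1 := Matrix.nonsing_inv_mul _ ((Matrix.isUnit_iff_isUnit_det _).1 hg)
  have hmul : ∀ X Y : Matrix (Fin N) (Fin N) ℂ, g * X * g⁻¹ * (g * Y * g⁻¹) = g * (X * Y) * g⁻¹ := by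
    intro X Y
    calc _ = g * X * (g⁻¹ * g) * (Y * g⁻¹) := by noncomm_ring
      _ = _ := by rw [hu]; noncomm_ring
  rw [LieRing.of_associative_ring_bracket, LieRing.of_associative_ring_bracket, hmul, hmul,
    mul_sub, sub_mul]

/-- The Lie algebra of sections of the twisted bundle on the degenerate curve, with poles at the
marked points: `f` is regular at `0` and `∞` and `f(∞) = Ad β (f(0))`. -/
def gTrig (N : ℕ) [NeZero N] (t : Fin L → ℂ) : LieSubalgebra ℂ (orbSections N) where
  carrier := {f | f ∈ gOrb N t ∧ IsRegular (germZero f).1 ∧ IsRegular (germInfty f).1 ∧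
    constTerm (germInfty f).1 = betaMat N * constTerm (germZero f).1 * (betaMat N)⁻¹}
  add_mem' {f g} hf hg := by
    have h0 : (germZero (f + g)).1 = (germZero f).1 + (germZero g).1 :=
      Matrix.map_add _ (map_add _) _ _
    have h1 : (germInfty (f + g)).1 = (germInfty f).1 + (germInfty g).1 :=
      Matrix.map_add _ (map_add _) _ _
    have hc : ∀ A B : Matrix (Fin N) (Fin N) ℂ⸨X⸩, constTerm (A + B) = constTerm A + constTerm B :=
      fun _ _ => rfl
    refine ⟨add_mem hf.1 hg.1, ?_, ?_, ?_⟩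
    · rw [h0]; exact fun i j => add_mem (hf.2.1 i j) (hg.2.1 i j)
    · rw [h1]; exact fun i j => add_mem (hf.2.2.1 i j) (hg.2.2.1 i j)
    · rw [h0, h1, hc, hc, hf.2.2.2, hg.2.2.2, mul_add, add_mul]
  zero_mem' := by
    have h0 : (germZero (0 : orbSections N)).1 = 0 := Matrix.map_zero _ (map_zero _)
    have h1 : (germInfty (0 : orbSections N)).1 = 0 := Matrix.map_zero _ (map_zero _)
    have hc : constTerm (0 : Matrix (Fin N) (Fin N) ℂ⸨X⸩) = 0 := rfl
    refine ⟨zero_mem _, ?_, ?_, ?_⟩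
    · rw [h0]; exact fun i j => zero_mem _
    · rw [h1]; exact fun i j => zero_mem _
    · rw [h0, h1, hc, mul_zero, zero_mul]
  smul_mem' c f hf := by
    have h0 : (germZero (c • f)).1 = c • (germZero f).1 :=
      Matrix.map_smul _ _ (fun a => map_smul _ c a) _
    have h1 : (germInfty (c • f)).1 = c • (germInfty f).1 :=
      Matrix.map_smul _ _ (fun a => map_smul _ c a) _
    have hc : ∀ A : Matrix (Fin N) (Fin N) ℂ⸨X⸩, constTerm (c • A) = c • constTerm A :=
      fun _ => rfl
    refine ⟨(gOrb N t).smul_mem c hf.1, ?_, ?_, ?_⟩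
    · rw [h0]; exact fun i j => regular.smul_mem (hf.2.1 i j) c
    · rw [h1]; exact fun i j => regular.smul_mem (hf.2.2.1 i j) c
    · rw [h0, h1, hc, hc, hf.2.2.2, Matrix.mul_smul, Matrix.smul_mul]
  lie_mem' {f g} hf hg := by
    have h0 : (germZero ⁅f, g⁆).1 = ⁅(germZero f).1, (germZero g).1⁆ := map_lie _ _ _
    have h1 : (germInfty ⁅f, g⁆).1 = ⁅(germInfty f).1, (germInfty g).1⁆ := map_lie _ _ _
    refine ⟨(gOrb N t).lie_mem hf.1 hg.1, ?_, ?_, ?_⟩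
    · rw [h0]; exact hf.2.1.lie hg.2.1
    · rw [h1]; exact hf.2.2.1.lie hg.2.2.1
    · rw [h0, h1, constTerm_lie hf.2.2.1 hg.2.2.1, constTerm_lie hf.2.1 hg.2.1, hf.2.2.2,
        hg.2.2.2, conj_lie (isUnit_betaMat N)]

section Trig

variable (t : Fin L → ℂ) (M : Fin L → Type u) [∀ i, AddCommGroup (M i)] [∀ i, Module ℂ (M i)]
  [∀ i, LieRingModule (AffineAt N) (M i)] [∀ i, LieModule ℂ (AffineAt N) (M i)]

/-- The action of a section on `M₁ ⊗ ⋯ ⊗ M_L` through its germs at the marked points. -/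
def actMarked (f : orbSections N) : Module.End ℂ (⨂[ℂ] i, M i) :=
  tensorSum fun i => LieModule.toEnd ℂ (AffineAt N) (M i) (Affine.mk (germAt (t i) f) 0)

/-- The subspace `𝔤_out^trig M`. -/
def trigRelations [NeZero N] : Submodule ℂ (⨂[ℂ] i, M i) :=
  Submodule.span ℂ {y | ∃ f ∈ gTrig N t, ∃ m, y = actMarked t M f m}

/-- The space of conformal coinvariants `CC_trig(M) = M / 𝔤_out^trig M`. -/
abbrev CCTrig [NeZero N] : Type u := (⨂[ℂ] i, M i) ⧸ trigRelations (N := N) t M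

end Trig

section Orb

variable (t : Fin L → ℂ) (M₀ : Type v) (M : Fin L → Type u) (M₁ : Type w)
  [AddCommGroup M₀] [Module ℂ M₀] [LieRingModule (AffineZero N) M₀] [LieModule ℂ (AffineZero N) M₀]
  [∀ i, AddCommGroup (M i)] [∀ i, Module ℂ (M i)]
  [∀ i, LieRingModule (AffineAt N) (M i)] [∀ i, LieModule ℂ (AffineAt N) (M i)]
  [AddCommGroup M₁] [Module ℂ M₁] [LieRingModule (AffineInfty N) M₁]
  [LieModule ℂ (AffineInfty N) M₁]

/-- The action of a section on `M₀ ⊗ (M₁ ⊗ ⋯ ⊗ M_L) ⊗ M_∞` through its germs at `0`, at the marked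
points and at `∞`. -/
def actOrb (f : orbSections N) : Module.End ℂ (M₀ ⊗[ℂ] ((⨂[ℂ] i, M i) ⊗[ℂ] M₁)) :=
  TensorProduct.map (LieModule.toEnd ℂ (AffineZero N) M₀ (Affine.mk (germZero f) 0)) LinearMap.id +
  TensorProduct.map LinearMap.id (TensorProduct.map (actMarked t M f) LinearMap.id) +
  TensorProduct.map LinearMap.id (TensorProduct.map LinearMap.id
    (LieModule.toEnd ℂ (AffineInfty N) M₁ (Affine.mk (germInfty f) 0)))

/-- The subspace `𝔤_out^orb (M₀ ⊗ M ⊗ M_∞)`. -/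
def orbRelations : Submodule ℂ (M₀ ⊗[ℂ] ((⨂[ℂ] i, M i) ⊗[ℂ] M₁)) :=
  Submodule.span ℂ {y | ∃ f ∈ gOrb N t, ∃ m, y = actOrb t M₀ M M₁ f m}

/-- The space of conformal coinvariants `CC_orb(M₀ ⊗ M ⊗ M_∞)`, with `M₀` and `M_∞` inserted at `0`
and `∞`. -/
abbrev CCOrb : Type (max u v w) :=
  (M₀ ⊗[ℂ] ((⨂[ℂ] i, M i) ⊗[ℂ] M₁)) ⧸ orbRelations (N := N) t M₀ M M₁

end Orb

/-! ### The case of Weyl modules -/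

section WeylCase

variable [NeZero N] (t : Fin L → ℂ) (k : ℂ) (V : Fin L → Type u) [∀ i, AddCommGroup (V i)]
  [∀ i, Module ℂ (V i)]
  [∀ i, LieRingModule (LieAlgebra.SpecialLinear.sl (Fin N) ℂ) (V i)]
  [∀ i, LieModule ℂ (LieAlgebra.SpecialLinear.sl (Fin N) ℂ) (V i)]

/-- The `l`-weight space of `V = V₁ ⊗ ⋯ ⊗ V_L`. -/
def weightSpace (l : Module.Dual ℂ (cartan N)) : Submodule ℂ (⨂[ℂ] i, V i) where
  carrier := {v | ∀ H : cartan N, tensorSum (fun i =>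
    LieModule.toEnd ℂ (LieAlgebra.SpecialLinear.sl (Fin N) ℂ) (V i) H.1) v = l H • v}
  add_mem' hv hw H := by rw [map_add, hv H, hw H, smul_add]
  zero_mem' H := by rw [map_zero, smul_zero]
  smul_mem' c v hv H := by rw [map_smul, hv H, smul_comm]

/-- The set `wt(V)` of weights of `V`. -/
abbrev Weights : Type := {l : Module.Dual ℂ (cartan N) // weightSpace V l ≠ ⊥}

/-- The summation map `⨁_{l ∈ wt(V)} V_l → V`. -/
def weightSum : (⨁ l : Weights (N := N) V, weightSpace V l.1) →ₗ[ℂ] ⨂[ℂ] i, V i := by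
  classical
  exact DirectSum.coeLinearMap fun l : Weights (N := N) V => weightSpace V l.1

/-- The map `V → M(V) = M(V₁) ⊗ ⋯ ⊗ M(V_L)`. -/
def weylIncl : (⨂[ℂ] i, V i) →ₗ[ℂ] ⨂[ℂ] i, Weyl (N := N) k (V i) :=
  PiTensorProduct.map fun i => Weyl.incl k (V i)

/-- The map `V → CC_trig(M(V))`, `v ↦ [v]`. -/
def trigMap : (⨂[ℂ] i, V i) →ₗ[ℂ] CCTrig (N := N) t fun i => Weyl (N := N) k (V i) :=
  (trigRelations (N := N) t fun i => Weyl (N := N) k (V i)).mkQ ∘ₗ weylIncl k V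

/-- The space `CC_orb(M_{λ̃} ⊗ M(V) ⊗ M_{λ̃'})`. -/
abbrev CCOrbWeyl (l : Module.Dual ℂ (cartan N)) : Type u :=
  CCOrb (N := N) t (VermaZero k (weightAtZero l)) (fun i => Weyl (N := N) k (V i))
    (VermaInfty k (weightAtInfty l))

/-- The map `M(V) → CC_orb(M_{λ̃} ⊗ M(V) ⊗ M_{λ̃'})`, `m ↦ [1_{λ̃} ⊗ m ⊗ 1_{λ̃'}]`. -/
def orbClass (l : Module.Dual ℂ (cartan N)) :
    (⨂[ℂ] i, Weyl (N := N) k (V i)) →ₗ[ℂ] CCOrbWeyl t k V l :=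
  (orbRelations (N := N) t (VermaZero k (weightAtZero l)) (fun i => Weyl (N := N) k (V i))
    (VermaInfty k (weightAtInfty l))).mkQ ∘ₗ
    TensorProduct.mk ℂ _ _ (Cyclic.vac _) ∘ₗ
    (TensorProduct.mk ℂ (⨂[ℂ] i, Weyl (N := N) k (V i))
      (VermaInfty k (weightAtInfty l))).flip (Cyclic.vac _)

/-- The map `V_λ → CC_orb(M_{λ̃} ⊗ M(V) ⊗ M_{λ̃'})`, `v ↦ [1_{λ̃} ⊗ v ⊗ 1_{λ̃'}]`. -/
def orbMap (l : Module.Dual ℂ (cartan N)) : weightSpace V l →ₗ[ℂ] CCOrbWeyl t k V l :=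
  orbClass t k V l ∘ₗ weylIncl k V ∘ₗ (weightSpace V l).subtype

end WeylCase

end Coinvariants

end TwistedWZW

end

/-!
The sum `𝔞` of the affine Lie algebras at `0`, at the marked points and at `∞` has two subalgebras:
the elements `𝔟` without polar parts, and the germs `𝔠` of sections of the twisted bundle, with
central parts adding up to zero. The latter are closed under the bracket by the residue theorem
(`sum_resPairing_eq_zero`). Principal parts can be prescribed by averaging partial fractions over
the cyclic group (`exists_section`), so `𝔞 = 𝔟 + 𝔠`, and a section without poles is a constant of
the Cartan subalgebra (`exists_eq_constSection`), so `𝔟 ∩ 𝔠` consists, up to central elements, of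
such constants.

The product of the Verma and Weyl modules is generated over `𝔞` by the `𝔟`-module `V`, embedded as
`1 ⊗ v ⊗ 1`, and a filtration argument shows that `V` spans its coinvariants under `𝔠`
(`sup_relations_eq_top`). A constant `H` acts on the class of a vector of weight `μ` by
`(μ - λ)(H)`, since the highest weights satisfy `λ̃ + λ̃' = -λ`, so only `V_λ` contributes
(`orbClass_weylIncl_eq_zero`).

That `V_λ` injects into the coinvariants is shown without the Poincaré–Birkhoff–Witt theorem, by a
coinduced module. Writing `𝔞 = 𝔟 + 𝔠` through a linear projection to `𝔟`, the linear maps from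
`U(𝔟)` to `V` vanishing on `(𝔟 ∩ 𝔠) U(𝔟)` form an `𝔞`-module; it receives an equivariant map from
`V`, and evaluation at `1` is a `𝔠`-invariant map out of it (`exists_coinduced`). Frobenius
reciprocity (`exists_equivariant_extension`) extends the former to the product of the Verma and
Weyl modules, and the composite is a `𝔠`-invariant map which restricts to the identity of `V_λ`
(`exists_orb_functional`).

On the trigonometric side `V` spans the coinvariants for the same reason. The weights `λ̃` and `λ̃'`
are such that the actions of `f(0)` and `f(∞)` on the highest weight vectors cancel for a
trigonometric section `f`; hence `m ↦ [1 ⊗ m ⊗ 1]` is defined on the trigonometric coinvariants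
(`orbClass_eq_zero_of_mem_trigRelations`). Its components recover the weight components of
`v ∈ V`, so the injectivity on the trigonometric side and the factorisation follow from the
bijectivity on the orbifold side and from the weight decomposition of `V`, which rests on the
semisimplicity of `h` in representations of `sl₂` (`isSemisimple_of_slTwo`).
-/

noncomputable section

namespace TwistedWZW

universe u v w

/-! ### Representations of the enveloping algebra -/

section Enveloping

variable {𝔟 : Type*} [LieRing 𝔟] [LieAlgebra ℂ 𝔟]
  {P : Type*} [AddCommGroup P] [Module ℂ P] {Q : Type*} [AddCommGroup Q] [Module ℂ Q]

theorem enveloping_induction {motive : UniversalEnvelopingAlgebra ℂ 𝔟 → Prop}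
    (algebraMap : ∀ c : ℂ, motive (algebraMap ℂ _ c))
    (ι : ∀ x, motive (UniversalEnvelopingAlgebra.ι ℂ x))
    (mul : ∀ u v, motive u → motive v → motive (u * v))
    (add : ∀ u v, motive u → motive v → motive (u + v)) (u : UniversalEnvelopingAlgebra ℂ 𝔟) :
    motive u := by
  obtain ⟨a, rfl⟩ : ∃ a, UniversalEnvelopingAlgebra.mkAlgHom ℂ 𝔟 a = u := by
    obtain ⟨a, ha⟩ := Quotient.exists_rep u
    exact ⟨a, ha⟩
  induction a using TensorAlgebra.induction with
  | algebraMap r => simpa using algebraMap r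
  | ι x => simpa using ι x
  | mul a b ha hb => rw [map_mul]; exact mul _ _ ha hb
  | add a b ha hb => rw [map_add]; exact add _ _ ha hb

/-- A linear map out of `U(𝔟)` compatible with left multiplication by `𝔟` is the orbit map of the
image of `1`. -/
theorem eq_lift_apply_of_equivariant (r : 𝔟 →ₗ⁅ℂ⁆ Module.End ℂ P)
    (F : UniversalEnvelopingAlgebra ℂ 𝔟 →ₗ[ℂ] P)
    (hF : ∀ b u, F (UniversalEnvelopingAlgebra.ι ℂ b * u) = r b (F u))
    (u : UniversalEnvelopingAlgebra ℂ 𝔟) :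
    F u = UniversalEnvelopingAlgebra.lift ℂ r u (F 1) := by
  have key : ∀ u w : UniversalEnvelopingAlgebra ℂ 𝔟,
      F (u * w) = UniversalEnvelopingAlgebra.lift ℂ r u (F w) := by
    intro u
    induction u using enveloping_induction with
    | algebraMap c =>
      intro w
      rw [AlgHom.commutes, Module.algebraMap_end_apply, ← map_smul, Algebra.smul_def]
    | ι x => intro w; rw [UniversalEnvelopingAlgebra.lift_ι_apply, hF]
    | mul a b ha hb => intro w; rw [mul_assoc, ha, hb, map_mul]; rfl
    | add a b ha hb => intro w; rw [add_mul, map_add, ha, hb, map_add]; rfl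
  simpa using key u 1

theorem eq_of_equivariant (r : 𝔟 →ₗ⁅ℂ⁆ Module.End ℂ P)
    {F G : UniversalEnvelopingAlgebra ℂ 𝔟 →ₗ[ℂ] P}
    (hF : ∀ b u, F (UniversalEnvelopingAlgebra.ι ℂ b * u) = r b (F u))
    (hG : ∀ b u, G (UniversalEnvelopingAlgebra.ι ℂ b * u) = r b (G u)) (h : F 1 = G 1) :
    F = G := by
  ext u
  rw [eq_lift_apply_of_equivariant r F hF, eq_lift_apply_of_equivariant r G hG, h]

/-- The tensor product of two representations. -/
def tensorRep (r : 𝔟 →ₗ⁅ℂ⁆ Module.End ℂ P) (s : 𝔟 →ₗ⁅ℂ⁆ Module.End ℂ Q) :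
    𝔟 →ₗ⁅ℂ⁆ Module.End ℂ (P ⊗[ℂ] Q) where
  toFun x := TensorProduct.map (r x) LinearMap.id + TensorProduct.map LinearMap.id (s x)
  map_add' x y := by
    rw [map_add, map_add, TensorProduct.map_add_left, TensorProduct.map_add_right]
    abel
  map_smul' c x := by
    rw [map_smul, map_smul, TensorProduct.map_smul_left, TensorProduct.map_smul_right, smul_add]
    rfl
  map_lie' {x y} := by
    refine TensorProduct.ext' fun p q => ?_
    simp only [LieHom.map_lie, LieRing.of_associative_ring_bracket, LinearMap.add_apply,
      TensorProduct.map_tmul, LinearMap.sub_apply, Module.End.mul_apply, LinearMap.id_apply,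
      map_add, TensorProduct.sub_tmul, TensorProduct.tmul_sub]
    abel

theorem tensorRep_tmul (r : 𝔟 →ₗ⁅ℂ⁆ Module.End ℂ P) (s : 𝔟 →ₗ⁅ℂ⁆ Module.End ℂ Q) (x : 𝔟) (p : P)
    (q : Q) : tensorRep r s x (p ⊗ₜ q) = r x p ⊗ₜ q + p ⊗ₜ s x q := rfl

/-- The left regular representation of `𝔟` on `U(𝔟)`. -/
def leftRep (𝔟 : Type*) [LieRing 𝔟] [LieAlgebra ℂ 𝔟] :
    𝔟 →ₗ⁅ℂ⁆ Module.End ℂ (UniversalEnvelopingAlgebra ℂ 𝔟) where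
  toFun x := LinearMap.mulLeft ℂ (UniversalEnvelopingAlgebra.ι ℂ x)
  map_add' x y := by ext u; simp [add_mul]
  map_smul' c x := by ext u; simp
  map_lie' {x y} := by
    ext u
    simp only [LinearMap.mulLeft_apply, LieHom.map_lie, LieRing.of_associative_ring_bracket,
      LinearMap.sub_apply, Module.End.mul_apply, sub_mul, mul_assoc]

/-- The representation on an invariant subspace. -/
def restrictRep (r : 𝔟 →ₗ⁅ℂ⁆ Module.End ℂ P) (S : Submodule ℂ P)
    (h : ∀ x, ∀ s ∈ S, r x s ∈ S) : 𝔟 →ₗ⁅ℂ⁆ Module.End ℂ S where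
  toFun x := (r x).restrict (h x)
  map_add' x y := by ext s; simp
  map_smul' c x := by ext s; simp
  map_lie' {x y} := by
    ext s
    simp [LieRing.of_associative_ring_bracket]

end Enveloping

/-! ### Coinduction along a pair of complementary subalgebras -/

section Coinduction

variable {𝔞 : Type*} [LieRing 𝔞] [LieAlgebra ℂ 𝔞] (𝔟 𝔠 : LieSubalgebra ℂ 𝔞) (p : 𝔞 →ₗ[ℂ] 𝔟)

/-- The adjoint action of a subalgebra `𝔟` on `𝔞`. -/
def adRep : 𝔟 →ₗ⁅ℂ⁆ Module.End ℂ 𝔞 := (LieAlgebra.ad ℂ 𝔞).comp 𝔟.incl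

theorem adRep_apply (b : 𝔟) (x : 𝔞) : adRep 𝔟 b x = ⁅(b : 𝔞), x⁆ := rfl

/-- The diagonal action of `𝔟` on `𝔞 ⊗ U(𝔟)`. -/
def diagRep : 𝔟 →ₗ⁅ℂ⁆ Module.End ℂ (𝔞 ⊗[ℂ] UniversalEnvelopingAlgebra ℂ 𝔟) :=
  tensorRep (adRep 𝔟) (leftRep 𝔟)

/-- The map `u ↦ u · (x ⊗ 1)`, that is `u ↦ ∑ Ad(u₍₁₎) x ⊗ u₍₂₎` in Sweedler notation. -/
def adOrbit (x : 𝔞) :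
    UniversalEnvelopingAlgebra ℂ 𝔟 →ₗ[ℂ] 𝔞 ⊗[ℂ] UniversalEnvelopingAlgebra ℂ 𝔟 :=
  LinearMap.applyₗ (x ⊗ₜ[ℂ] (1 : UniversalEnvelopingAlgebra ℂ 𝔟)) ∘ₗ
    (UniversalEnvelopingAlgebra.lift ℂ (diagRep 𝔟)).toLinearMap

theorem adOrbit_apply (x : 𝔞) (u : UniversalEnvelopingAlgebra ℂ 𝔟) :
    adOrbit 𝔟 x u = UniversalEnvelopingAlgebra.lift ℂ (diagRep 𝔟) u (x ⊗ₜ 1) := rfl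

theorem adOrbit_one (x : 𝔞) : adOrbit 𝔟 x 1 = x ⊗ₜ 1 := by
  rw [adOrbit_apply, map_one]; rfl

theorem adOrbit_ι_mul (x : 𝔞) (b : 𝔟) (u : UniversalEnvelopingAlgebra ℂ 𝔟) :
    adOrbit 𝔟 x (UniversalEnvelopingAlgebra.ι ℂ b * u) = diagRep 𝔟 b (adOrbit 𝔟 x u) := by
  rw [adOrbit_apply, map_mul, UniversalEnvelopingAlgebra.lift_ι_apply]; rfl

/-- The map `a ⊗ u ↦ p(a) u`. -/
def projMul : 𝔞 ⊗[ℂ] UniversalEnvelopingAlgebra ℂ 𝔟 →ₗ[ℂ] UniversalEnvelopingAlgebra ℂ 𝔟 :=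
  LinearMap.mul' ℂ _ ∘ₗ
    TensorProduct.map ((UniversalEnvelopingAlgebra.ι ℂ : 𝔟 →ₗ⁅ℂ⁆ _).toLinearMap ∘ₗ p) LinearMap.id

theorem projMul_tmul (a : 𝔞) (u : UniversalEnvelopingAlgebra ℂ 𝔟) :
    projMul 𝔟 p (a ⊗ₜ u) = UniversalEnvelopingAlgebra.ι ℂ (p a) * u := rfl

/-- The right operation of `x ∈ 𝔞` on `U(𝔟)`, `u ↦ ∑ p(Ad(u₍₁₎) x) u₍₂₎`. It is what right
multiplication of `u` by `x` becomes after discarding the elements of `𝔠 U(𝔞)`. -/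
def rightOp : 𝔞 →ₗ[ℂ] Module.End ℂ (UniversalEnvelopingAlgebra ℂ 𝔟) where
  toFun x := projMul 𝔟 p ∘ₗ adOrbit 𝔟 x
  map_add' x y := by
    ext u
    simp only [LinearMap.comp_apply, adOrbit_apply, TensorProduct.add_tmul, map_add,
      LinearMap.add_apply]
  map_smul' c x := by
    ext u
    simp only [LinearMap.comp_apply, adOrbit_apply, ← TensorProduct.smul_tmul', map_smul,
      LinearMap.smul_apply, RingHom.id_apply]

theorem rightOp_apply (x : 𝔞) (u : UniversalEnvelopingAlgebra ℂ 𝔟) :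
    rightOp 𝔟 p x u = projMul 𝔟 p (adOrbit 𝔟 x u) := rfl

theorem rightOp_one (x : 𝔞) : rightOp 𝔟 p x 1 = UniversalEnvelopingAlgebra.ι ℂ (p x) := by
  rw [rightOp_apply, adOrbit_one, projMul_tmul, mul_one]

/-- On `𝔟` itself the operation is right multiplication. -/
theorem rightOp_of_mem (hp : ∀ b : 𝔟, p b = b) (x : 𝔟) (u : UniversalEnvelopingAlgebra ℂ 𝔟) :
    rightOp 𝔟 p x u = u * UniversalEnvelopingAlgebra.ι ℂ x := by
  let τ : 𝔟 →ₗ⁅ℂ⁆ Module.End ℂ (𝔟 ⊗[ℂ] UniversalEnvelopingAlgebra ℂ 𝔟) :=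
    tensorRep (LieAlgebra.ad ℂ 𝔟) (leftRep 𝔟)
  let F : UniversalEnvelopingAlgebra ℂ 𝔟 →ₗ[ℂ] 𝔟 ⊗[ℂ] UniversalEnvelopingAlgebra ℂ 𝔟 :=
    LinearMap.applyₗ (x ⊗ₜ[ℂ] (1 : UniversalEnvelopingAlgebra ℂ 𝔟)) ∘ₗ
      (UniversalEnvelopingAlgebra.lift ℂ τ).toLinearMap
  have hFι : ∀ b u, F (UniversalEnvelopingAlgebra.ι ℂ b * u) = τ b (F u) := by
    intro b u
    change UniversalEnvelopingAlgebra.lift ℂ τ _ _ = _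
    rw [map_mul, UniversalEnvelopingAlgebra.lift_ι_apply]; rfl
  have hF1 : F 1 = x ⊗ₜ 1 := by
    change UniversalEnvelopingAlgebra.lift ℂ τ _ _ = _
    rw [map_one]; rfl
  let j : 𝔟 ⊗[ℂ] UniversalEnvelopingAlgebra ℂ 𝔟 →ₗ[ℂ] 𝔞 ⊗[ℂ] UniversalEnvelopingAlgebra ℂ 𝔟 :=
    TensorProduct.map 𝔟.incl.toLinearMap LinearMap.id
  have hj : ∀ b z, j (τ b z) = diagRep 𝔟 b (j z) := by
    intro b z
    induction z with
    | zero => simp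
    | add y z hy hz => simp only [map_add, hy, hz]
    | tmul a u => rfl
  have h1 : adOrbit 𝔟 x = j ∘ₗ F := by
    refine eq_of_equivariant (diagRep 𝔟) (adOrbit_ι_mul 𝔟 _) (fun b u => ?_) ?_
    · rw [LinearMap.comp_apply, hFι, hj]; rfl
    · rw [LinearMap.comp_apply, hF1, adOrbit_one]; rfl
  have h2 : rightOp 𝔟 p x = LinearMap.mulRight ℂ (UniversalEnvelopingAlgebra.ι ℂ x) := by
    refine eq_of_equivariant (leftRep 𝔟) (fun b u => ?_) (fun b u => ?_) ?_
    · simp only [rightOp_apply, h1, LinearMap.comp_apply, hFι]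
      generalize F u = z
      induction z with
      | zero => simp
      | add y z hy hz => simp only [map_add, hy, hz]
      | tmul a u =>
        rw [tensorRep_tmul, map_add, map_add]
        change UniversalEnvelopingAlgebra.ι ℂ (p ((⁅b, a⁆ : 𝔟) : 𝔞)) * u +
          UniversalEnvelopingAlgebra.ι ℂ (p a) * (UniversalEnvelopingAlgebra.ι ℂ b * u) =
          UniversalEnvelopingAlgebra.ι ℂ b * (UniversalEnvelopingAlgebra.ι ℂ (p a) * u)
        rw [hp, hp, LieHom.map_lie, LieRing.of_associative_ring_bracket]
        noncomm_ring
    · exact (mul_assoc _ _ _)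
    · rw [rightOp_one, hp]; simp
  rw [h2, LinearMap.mulRight_apply]

/-- The subspace `(𝔟 ∩ 𝔠) U(𝔟)`. -/
def interIdeal : Submodule ℂ (UniversalEnvelopingAlgebra ℂ 𝔟) :=
  Submodule.span ℂ {y | ∃ (h : 𝔟) (u : UniversalEnvelopingAlgebra ℂ 𝔟), (h : 𝔞) ∈ 𝔠 ∧
    y = UniversalEnvelopingAlgebra.ι ℂ h * u}

variable {𝔟 𝔠 p}

theorem ι_mul_mem_interIdeal {h : 𝔟} (hh : (h : 𝔞) ∈ 𝔠) (u : UniversalEnvelopingAlgebra ℂ 𝔟) :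
    UniversalEnvelopingAlgebra.ι ℂ h * u ∈ interIdeal 𝔟 𝔠 :=
  Submodule.subset_span ⟨h, u, hh, rfl⟩

theorem proj_mem_of_mem (hc : ∀ x : 𝔞, x - p x ∈ 𝔠) {x : 𝔞} (hx : x ∈ 𝔠) : (p x : 𝔞) ∈ 𝔠 := by
  simpa using 𝔠.sub_mem hx (hc x)

theorem rightOp_mem_interIdeal (hp : ∀ b : 𝔟, p b = b) (hc : ∀ x : 𝔞, x - p x ∈ 𝔠) (x : 𝔞)
    {u : UniversalEnvelopingAlgebra ℂ 𝔟} (hu : u ∈ interIdeal 𝔟 𝔠) :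
    rightOp 𝔟 p x u ∈ interIdeal 𝔟 𝔠 := by
  induction hu using Submodule.span_induction with
  | zero => simp
  | add y z _ _ hy hz => rw [map_add]; exact add_mem hy hz
  | smul c y _ hy => rw [map_smul]; exact Submodule.smul_mem _ c hy
  | mem y hy =>
    obtain ⟨h, u, hh, rfl⟩ := hy
    rw [rightOp_apply, adOrbit_ι_mul]
    generalize adOrbit 𝔟 x u = z
    induction z with
    | zero => simp
    | add y z hy hz => simp only [map_add]; exact add_mem hy hz
    | tmul a w =>
      rw [diagRep, tensorRep_tmul, map_add, projMul_tmul, projMul_tmul, adRep_apply]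
      have h1 : UniversalEnvelopingAlgebra.ι ℂ (p ⁅(h : 𝔞), a⁆) * w +
          UniversalEnvelopingAlgebra.ι ℂ (p a) * leftRep 𝔟 h w =
          UniversalEnvelopingAlgebra.ι ℂ (p ⁅(h : 𝔞), a - p a⁆) * w +
          UniversalEnvelopingAlgebra.ι ℂ h * (UniversalEnvelopingAlgebra.ι ℂ (p a) * w) := by
        have h2 : p ⁅(h : 𝔞), (p a : 𝔞)⁆ = ⁅h, p a⁆ := hp ⁅h, p a⁆
        change _ + UniversalEnvelopingAlgebra.ι ℂ (p a) * (UniversalEnvelopingAlgebra.ι ℂ h * w) = _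
        rw [lie_sub, map_sub, h2, map_sub, LieHom.map_lie, LieRing.of_associative_ring_bracket]
        noncomm_ring
      rw [h1]
      exact add_mem (ι_mul_mem_interIdeal (proj_mem_of_mem hc (𝔠.lie_mem hh (hc a))) _)
        (ι_mul_mem_interIdeal hh _)

/-- Modulo `(𝔟 ∩ 𝔠) U(𝔟)` the right operations form a right action of `𝔞`. Both composites
`u x y` and `u y x` are images of the same element `u · (x ⊗ y ⊗ 1)` of `𝔞 ⊗ 𝔞 ⊗ U(𝔟)`, which
reduces the claim to `p [a - p a, a' - p a'] ∈ 𝔟 ∩ 𝔠`. -/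
theorem rightOp_lie (hp : ∀ b : 𝔟, p b = b) (hc : ∀ x : 𝔞, x - p x ∈ 𝔠) (x y : 𝔞)
    (u : UniversalEnvelopingAlgebra ℂ 𝔟) :
    rightOp 𝔟 p y (rightOp 𝔟 p x u) - rightOp 𝔟 p x (rightOp 𝔟 p y u) - rightOp 𝔟 p ⁅x, y⁆ u ∈
      interIdeal 𝔟 𝔠 := by
  let τ := tensorRep (adRep 𝔟) (diagRep 𝔟)
  let B : 𝔞 → 𝔞 ⊗[ℂ] UniversalEnvelopingAlgebra ℂ 𝔟 →ₗ[ℂ]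
    𝔞 ⊗[ℂ] (𝔞 ⊗[ℂ] UniversalEnvelopingAlgebra ℂ 𝔟) :=
    fun y => TensorProduct.map LinearMap.id (adOrbit 𝔟 y)
  have hB : ∀ y b z, B y (diagRep 𝔟 b z) = τ b (B y z) := by
    intro y b z
    induction z with
    | zero => simp
    | add z z' hz hz' => simp only [map_add, hz, hz']
    | tmul a w =>
      change B y ((adRep 𝔟 b a) ⊗ₜ w + a ⊗ₜ (UniversalEnvelopingAlgebra.ι ℂ b * w)) =
        (adRep 𝔟 b a) ⊗ₜ adOrbit 𝔟 y w + a ⊗ₜ (diagRep 𝔟 b (adOrbit 𝔟 y w))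
      rw [map_add, ← adOrbit_ι_mul]; rfl
  have hBA : ∀ x y b u, B y (adOrbit 𝔟 x (UniversalEnvelopingAlgebra.ι ℂ b * u)) =
      τ b (B y (adOrbit 𝔟 x u)) := fun x y b u => by rw [adOrbit_ι_mul, hB]
  let σ : 𝔞 ⊗[ℂ] (𝔞 ⊗[ℂ] UniversalEnvelopingAlgebra ℂ 𝔟) →ₗ[ℂ]
      𝔞 ⊗[ℂ] (𝔞 ⊗[ℂ] UniversalEnvelopingAlgebra ℂ 𝔟) :=
    (TensorProduct.leftComm ℂ 𝔞 𝔞 (UniversalEnvelopingAlgebra ℂ 𝔟)).toLinearMap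
  have hστ : ∀ b z, σ (τ b z) = τ b (σ z) := by
    intro b z
    induction z with
    | zero => simp
    | add z z' hz hz' => simp only [map_add, hz, hz']
    | tmul a z =>
      induction z with
      | zero => simp
      | add z z' hz hz' => simp only [map_add, TensorProduct.tmul_add, hz, hz']
      | tmul a' w =>
        change σ ((adRep 𝔟 b a) ⊗ₜ (a' ⊗ₜ w) + a ⊗ₜ ((adRep 𝔟 b a') ⊗ₜ w + a' ⊗ₜ leftRep 𝔟 b w)) =
          (adRep 𝔟 b a') ⊗ₜ (a ⊗ₜ w) + a' ⊗ₜ ((adRep 𝔟 b a) ⊗ₜ w + a ⊗ₜ leftRep 𝔟 b w)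
        simp only [TensorProduct.tmul_add, map_add]
        change a' ⊗ₜ (adRep 𝔟 b a ⊗ₜ w) +
          (adRep 𝔟 b a' ⊗ₜ (a ⊗ₜ w) + a' ⊗ₜ (a ⊗ₜ leftRep 𝔟 b w)) = _
        abel
  let β : 𝔞 ⊗[ℂ] (𝔞 ⊗[ℂ] UniversalEnvelopingAlgebra ℂ 𝔟) →ₗ[ℂ]
      𝔞 ⊗[ℂ] UniversalEnvelopingAlgebra ℂ 𝔟 :=
    TensorProduct.map (TensorProduct.lift (LieModule.toEnd ℂ 𝔞 𝔞 : 𝔞 →ₗ[ℂ] 𝔞 →ₗ[ℂ] 𝔞))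
      LinearMap.id ∘ₗ
      (TensorProduct.assoc ℂ 𝔞 𝔞 (UniversalEnvelopingAlgebra ℂ 𝔟)).symm.toLinearMap
  have hβ : ∀ a a' w, β (a ⊗ₜ (a' ⊗ₜ w)) = ⁅a, a'⁆ ⊗ₜ w := fun a a' w => rfl
  have hβτ : ∀ b z, β (τ b z) = diagRep 𝔟 b (β z) := by
    intro b z
    induction z with
    | zero => simp
    | add z z' hz hz' => simp only [map_add, hz, hz']
    | tmul a z =>
      induction z with
      | zero => simp
      | add z z' hz hz' => simp only [map_add, TensorProduct.tmul_add, hz, hz']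
      | tmul a' w =>
        change β ((adRep 𝔟 b a) ⊗ₜ (a' ⊗ₜ w) + a ⊗ₜ ((adRep 𝔟 b a') ⊗ₜ w + a' ⊗ₜ leftRep 𝔟 b w)) =
          (adRep 𝔟 b ⁅a, a'⁆) ⊗ₜ w + ⁅a, a'⁆ ⊗ₜ leftRep 𝔟 b w
        simp only [TensorProduct.tmul_add, map_add, hβ, adRep_apply, leibniz_lie (b : 𝔞),
          TensorProduct.add_tmul]
        abel
  have e1 : B x ∘ₗ adOrbit 𝔟 y = σ ∘ₗ B y ∘ₗ adOrbit 𝔟 x := by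
    refine eq_of_equivariant τ (fun b u => hBA y x b u) (fun b u => ?_) ?_
    · simp only [LinearMap.comp_apply, hBA, hστ]
    · simp only [LinearMap.comp_apply, adOrbit_one]
      change y ⊗ₜ adOrbit 𝔟 x 1 = σ (x ⊗ₜ adOrbit 𝔟 y 1)
      rw [adOrbit_one, adOrbit_one]; rfl
  have e2 : adOrbit 𝔟 ⁅x, y⁆ = β ∘ₗ B y ∘ₗ adOrbit 𝔟 x := by
    refine eq_of_equivariant (diagRep 𝔟) (adOrbit_ι_mul 𝔟 _) (fun b u => ?_) ?_
    · simp only [LinearMap.comp_apply, hBA, hβτ]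
    · simp only [LinearMap.comp_apply, adOrbit_one]
      change _ = β (x ⊗ₜ adOrbit 𝔟 y 1)
      rw [adOrbit_one, hβ]
  let Θ : 𝔞 ⊗[ℂ] (𝔞 ⊗[ℂ] UniversalEnvelopingAlgebra ℂ 𝔟) →ₗ[ℂ] UniversalEnvelopingAlgebra ℂ 𝔟 :=
    TensorProduct.lift (LinearMap.compRight ℂ (projMul 𝔟 p) ∘ₗ
      (diagRep 𝔟 : 𝔟 →ₗ[ℂ] Module.End ℂ (𝔞 ⊗[ℂ] UniversalEnvelopingAlgebra ℂ 𝔟)) ∘ₗ p)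
  have hΘ : ∀ a z, Θ (a ⊗ₜ z) = projMul 𝔟 p (diagRep 𝔟 (p a) z) := fun a z => rfl
  have hΘB : ∀ y z, rightOp 𝔟 p y (projMul 𝔟 p z) = Θ (B y z) := by
    intro y z
    induction z with
    | zero => simp
    | add z z' hz hz' => simp only [map_add, hz, hz']
    | tmul a w =>
      change _ = Θ (a ⊗ₜ adOrbit 𝔟 y w)
      rw [hΘ, projMul_tmul, rightOp_apply, adOrbit_ι_mul]
  have e1' : B x (adOrbit 𝔟 y u) = σ (B y (adOrbit 𝔟 x u)) := DFunLike.congr_fun e1 u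
  rw [rightOp_apply 𝔟 p x u, hΘB, rightOp_apply 𝔟 p y u, hΘB, e1', rightOp_apply, e2,
    LinearMap.comp_apply, LinearMap.comp_apply]
  generalize B y (adOrbit 𝔟 x u) = z
  induction z with
  | zero => simp
  | add z z' hz hz' =>
    have h := add_mem hz hz'
    simp only [map_add]
    convert h using 1
    abel
  | tmul a z =>
    induction z with
    | zero => simp
    | add z z' hz hz' =>
      have h := add_mem hz hz'
      simp only [map_add, TensorProduct.tmul_add]
      convert h using 1
      abel
    | tmul a' w =>
      change Θ (a ⊗ₜ (a' ⊗ₜ w)) - Θ (a' ⊗ₜ (a ⊗ₜ w)) - projMul 𝔟 p (β (a ⊗ₜ (a' ⊗ₜ w))) ∈ _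
      rw [hΘ, hΘ, hβ, diagRep, tensorRep_tmul, tensorRep_tmul, map_add, map_add]
      simp only [projMul_tmul, adRep_apply]
      have h1 : (p ⁅(p a : 𝔞), (p a' : 𝔞)⁆) = ⁅p a, p a'⁆ := hp ⁅p a, p a'⁆
      have h2 : p ⁅a - p a, a' - p a'⁆ =
          p ⁅a, a'⁆ - p ⁅(p a : 𝔞), a'⁆ + p ⁅(p a' : 𝔞), a⁆ + ⁅p a, p a'⁆ := by
        rw [sub_lie, lie_sub, lie_sub, ← lie_skew (p a' : 𝔞) a, map_sub, map_sub, map_sub, h1,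
          map_neg]
        abel
      have h3 := ι_mul_mem_interIdeal
        (proj_mem_of_mem hc (𝔠.lie_mem (hc a) (hc a'))) w
      rw [h2] at h3
      convert neg_mem h3 using 1
      simp only [map_add, map_sub, LieHom.map_lie, LieRing.of_associative_ring_bracket]
      change UniversalEnvelopingAlgebra.ι ℂ (p ⁅(p a : 𝔞), a'⁆) * w +
        UniversalEnvelopingAlgebra.ι ℂ (p a') * (UniversalEnvelopingAlgebra.ι ℂ (p a) * w) -
        (UniversalEnvelopingAlgebra.ι ℂ (p ⁅(p a' : 𝔞), a⁆) * w +
        UniversalEnvelopingAlgebra.ι ℂ (p a) * (UniversalEnvelopingAlgebra.ι ℂ (p a') * w)) - _ = _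
      noncomm_ring

variable {V : Type*} [AddCommGroup V] [Module ℂ V] {W : Type*} [AddCommGroup W] [Module ℂ W]

/-- The space of linear maps `U(𝔟) → W` vanishing on `(𝔟 ∩ 𝔠) U(𝔟)`. -/
def coindSpace (𝔟 𝔠 : LieSubalgebra ℂ 𝔞) (W : Type*) [AddCommGroup W] [Module ℂ W] :
    Submodule ℂ (UniversalEnvelopingAlgebra ℂ 𝔟 →ₗ[ℂ] W) where
  carrier := {F | ∀ u ∈ interIdeal 𝔟 𝔠, F u = 0}
  add_mem' {F G} hF hG u hu := by rw [LinearMap.add_apply, hF u hu, hG u hu, add_zero]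
  zero_mem' u _ := rfl
  smul_mem' c F hF u hu := by rw [LinearMap.smul_apply, hF u hu, smul_zero]

/-- The action of `𝔞` on the coinduced space, dual to the right operations on `U(𝔟)`. -/
def coindRep (hp : ∀ b : 𝔟, p b = b) (hc : ∀ x : 𝔞, x - p x ∈ 𝔠) (W : Type*) [AddCommGroup W]
    [Module ℂ W] : 𝔞 →ₗ⁅ℂ⁆ Module.End ℂ (coindSpace 𝔟 𝔠 W) where
  toFun x := (LinearMap.lcomp ℂ W (rightOp 𝔟 p x)).restrict fun F hF u hu =>
    hF _ (rightOp_mem_interIdeal hp hc x hu)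
  map_add' x y := by
    ext F u
    change F.1 (rightOp 𝔟 p (x + y) u) = F.1 (rightOp 𝔟 p x u) + F.1 (rightOp 𝔟 p y u)
    rw [map_add, LinearMap.add_apply, map_add]
  map_smul' c x := by
    ext F u
    change F.1 (rightOp 𝔟 p (c • x) u) = c • F.1 (rightOp 𝔟 p x u)
    rw [map_smul, LinearMap.smul_apply, map_smul]
  map_lie' {x y} := by
    ext F u
    have h := F.2 _ (rightOp_lie hp hc x y u)
    rw [map_sub, map_sub, sub_eq_zero] at h
    exact h.symm

/-- If `𝔞 = 𝔟 + 𝔠` and a linear map `π : V → W` out of a `𝔟`-module kills `(𝔟 ∩ 𝔠) V`, then there is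
an `𝔞`-module `X` with a `𝔟`-equivariant map `V → X` and a `𝔠`-invariant linear map `X → W` whose
composite is `π`. This is the part of the Poincaré–Birkhoff–Witt theorem needed to see that
coinvariants of induced modules are not too small. -/
theorem exists_coinduced (hp : ∀ b : 𝔟, p b = b) (hc : ∀ x : 𝔞, x - p x ∈ 𝔠)
    (ρ : 𝔟 →ₗ⁅ℂ⁆ Module.End ℂ V) (π : V →ₗ[ℂ] W)
    (hπ : ∀ b : 𝔟, (b : 𝔞) ∈ 𝔠 → ∀ v, π (ρ b v) = 0) :
    ∃ (φ : V →ₗ[ℂ] coindSpace 𝔟 𝔠 W) (ev : coindSpace 𝔟 𝔠 W →ₗ[ℂ] W),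
      (∀ b v, φ (ρ b v) = coindRep hp hc W b (φ v)) ∧
      (∀ x ∈ 𝔠, ∀ F, ev (coindRep hp hc W x F) = 0) ∧ ∀ v, ev (φ v) = π v := by
  let lft := UniversalEnvelopingAlgebra.lift ℂ ρ
  let φ₀ : V →ₗ[ℂ] UniversalEnvelopingAlgebra ℂ 𝔟 →ₗ[ℂ] W :=
    LinearMap.compRight ℂ π ∘ₗ lft.toLinearMap.flip
  have hφ₀ : ∀ v u, φ₀ v u = π (lft u v) := fun _ _ => rfl
  have hmem : ∀ v, φ₀ v ∈ coindSpace 𝔟 𝔠 W := by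
    intro v u hu
    induction hu using Submodule.span_induction with
    | zero => simp
    | add y z _ _ hy hz => rw [map_add, hy, hz, add_zero]
    | smul c y _ hy => rw [map_smul, hy, smul_zero]
    | mem y hy =>
      obtain ⟨h, u, hh, rfl⟩ := hy
      rw [hφ₀, map_mul, UniversalEnvelopingAlgebra.lift_ι_apply]
      exact hπ h hh _
  refine ⟨φ₀.codRestrict _ hmem, LinearMap.applyₗ 1 ∘ₗ (coindSpace 𝔟 𝔠 W).subtype, ?_, ?_, ?_⟩
  · intro b v
    ext u
    change π (lft u (ρ b v)) = π (lft (rightOp 𝔟 p b u) v)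
    rw [rightOp_of_mem 𝔟 p hp, map_mul, UniversalEnvelopingAlgebra.lift_ι_apply]; rfl
  · intro x hx F
    change F.1 (rightOp 𝔟 p x 1) = 0
    refine F.2 _ ?_
    rw [rightOp_one, ← mul_one (UniversalEnvelopingAlgebra.ι ℂ (p x))]
    exact ι_mul_mem_interIdeal (proj_mem_of_mem hc hx) _
  · intro v
    change π (lft 1 v) = π v
    rw [map_one]; rfl

end Coinduction

/-! ### Universal properties of induced and cyclic modules -/

section Universal

variable {𝔞 : Type v} [LieRing 𝔞] [LieAlgebra ℂ 𝔞] (𝔟 : LieSubalgebra ℂ 𝔞)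
  {V : Type w} [AddCommGroup V] [Module ℂ V] (ρ : 𝔟 →ₗ⁅ℂ⁆ Module.End ℂ V)
  {X : Type*} [AddCommGroup X] [Module ℂ X] (r : 𝔞 →ₗ⁅ℂ⁆ Module.End ℂ X)

theorem mem_of_forall_ι_smul_mem {M : Type*} [AddCommGroup M] [Module ℂ M]
    [Module (UniversalEnvelopingAlgebra ℂ 𝔞) M]
    [IsScalarTower ℂ (UniversalEnvelopingAlgebra ℂ 𝔞) M] (S : Submodule ℂ M)
    (hS : ∀ (x : 𝔞), ∀ m ∈ S, UniversalEnvelopingAlgebra.ι ℂ x • m ∈ S)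
    (u : UniversalEnvelopingAlgebra ℂ 𝔞) : ∀ m ∈ S, u • m ∈ S := by
  induction u using enveloping_induction with
  | algebraMap c => intro m hm; rw [algebraMap_smul]; exact S.smul_mem c hm
  | ι x => exact hS x
  | mul a b ha hb => intro m hm; rw [mul_smul]; exact ha _ (hb m hm)
  | add a b ha hb => intro m hm; rw [add_smul]; exact add_mem (ha m hm) (hb m hm)

/-- An induced module is generated by the module it is induced from. -/
theorem Induced.eq_top (S : Submodule ℂ (Induced 𝔟 ρ)) (h0 : ∀ v, Induced.incl 𝔟 ρ v ∈ S)
    (h1 : ∀ (x : 𝔞), ∀ m ∈ S, ⁅x, m⁆ ∈ S) : S = ⊤ := by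
  have h2 := mem_of_forall_ι_smul_mem S h1
  rw [eq_top_iff]
  rintro m -
  obtain ⟨z, rfl⟩ := Submodule.Quotient.mk_surjective (inducedRelations 𝔟 ρ) m
  induction z with
  | zero => exact S.zero_mem
  | add y z hy hz => exact S.add_mem hy hz
  | tmul u v =>
    have h := h2 u _ (h0 v)
    have h3 : u ⊗ₜ[ℂ] v = u • ((1 : UniversalEnvelopingAlgebra ℂ 𝔞) ⊗ₜ[ℂ] v) := by
      rw [TensorProduct.smul_tmul', smul_eq_mul, mul_one]
    rw [h3]
    exact h

theorem Induced.lie_incl (b : 𝔟) (v : V) :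
    ⁅(b : 𝔞), Induced.incl 𝔟 ρ v⁆ = Induced.incl 𝔟 ρ (ρ b v) := by
  have h : UniversalEnvelopingAlgebra.ι ℂ (b : 𝔞) ⊗ₜ[ℂ] v - 1 ⊗ₜ[ℂ] ρ b v ∈
      inducedRelations 𝔟 ρ := Submodule.subset_span ⟨b, v, rfl⟩
  have h2 := (Submodule.Quotient.eq (inducedRelations 𝔟 ρ)).2 h
  refine Eq.trans ?_ h2
  change Submodule.Quotient.mk (UniversalEnvelopingAlgebra.ι ℂ (b : 𝔞) •
    ((1 : UniversalEnvelopingAlgebra ℂ 𝔞) ⊗ₜ[ℂ] v)) = _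
  rw [TensorProduct.smul_tmul', smul_eq_mul, mul_one]

/-- The space `Hom_𝔟(V, X)`. -/
def equivariantMaps : Submodule ℂ (V →ₗ[ℂ] X) where
  carrier := {F | ∀ (b : 𝔟) v, F (ρ b v) = r b (F v)}
  add_mem' {F G} hF hG b v := by
    rw [LinearMap.add_apply, LinearMap.add_apply, hF, hG, map_add]
  zero_mem' b v := by simp
  smul_mem' c F hF b v := by rw [LinearMap.smul_apply, LinearMap.smul_apply, hF, map_smul]

/-- The map `u ⊗ v ↦ u F(v)`. -/
def envelopingExtend (F : V →ₗ[ℂ] X) : UniversalEnvelopingAlgebra ℂ 𝔞 ⊗[ℂ] V →ₗ[ℂ] X :=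
  TensorProduct.lift (LinearMap.lcomp ℂ X F ∘ₗ (UniversalEnvelopingAlgebra.lift ℂ r).toLinearMap)

theorem envelopingExtend_smul (F : V →ₗ[ℂ] X) (u : UniversalEnvelopingAlgebra ℂ 𝔞)
    (z : UniversalEnvelopingAlgebra ℂ 𝔞 ⊗[ℂ] V) :
    envelopingExtend r F (u • z) =
      UniversalEnvelopingAlgebra.lift ℂ r u (envelopingExtend r F z) := by
  induction z with
  | zero => simp
  | add y z hy hz => rw [smul_add, map_add, map_add, map_add, hy, hz]
  | tmul w v =>
    rw [TensorProduct.smul_tmul', smul_eq_mul]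
    change UniversalEnvelopingAlgebra.lift ℂ r (u * w) (F v) = _
    rw [map_mul]; rfl

variable {𝔟 ρ r} in
theorem envelopingExtend_eq_zero {F : V →ₗ[ℂ] X} (hF : F ∈ equivariantMaps 𝔟 ρ r)
    {z : UniversalEnvelopingAlgebra ℂ 𝔞 ⊗[ℂ] V} (hz : z ∈ inducedRelations 𝔟 ρ) :
    envelopingExtend r F z = 0 := by
  induction hz using Submodule.span_induction with
  | zero => simp
  | add y z _ _ hy hz => rw [map_add, hy, hz, add_zero]
  | smul u y _ hy => rw [envelopingExtend_smul, hy, map_zero]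
  | mem y hy =>
    obtain ⟨b, v, rfl⟩ := hy
    rw [map_sub, sub_eq_zero]
    change UniversalEnvelopingAlgebra.lift ℂ r (UniversalEnvelopingAlgebra.ι ℂ (b : 𝔞)) (F v) =
      UniversalEnvelopingAlgebra.lift ℂ r 1 (F (ρ b v))
    rw [UniversalEnvelopingAlgebra.lift_ι_apply, map_one, hF b v]; rfl

/-- Frobenius reciprocity: a `𝔟`-equivariant map `V → X` extends to the induced module. -/
def Induced.liftFun (F : equivariantMaps 𝔟 ρ r) : Induced 𝔟 ρ →ₗ[ℂ] X :=
  (((inducedRelations 𝔟 ρ).restrictScalars ℂ).liftQ (envelopingExtend r F.1)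
    fun _ hz => envelopingExtend_eq_zero F.2 hz) ∘ₗ
    (Submodule.Quotient.restrictScalarsEquiv ℂ (inducedRelations 𝔟 ρ)).symm.toLinearMap

theorem Induced.liftFun_incl (F : equivariantMaps 𝔟 ρ r) (v : V) :
    Induced.liftFun 𝔟 ρ r F (Induced.incl 𝔟 ρ v) = F.1 v := by
  change UniversalEnvelopingAlgebra.lift ℂ r 1 (F.1 v) = F.1 v
  rw [map_one]; rfl

theorem Induced.liftFun_lie (F : equivariantMaps 𝔟 ρ r) (x : 𝔞) (m : Induced 𝔟 ρ) :
    Induced.liftFun 𝔟 ρ r F ⁅x, m⁆ = r x (Induced.liftFun 𝔟 ρ r F m) := by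
  obtain ⟨z, rfl⟩ := Submodule.Quotient.mk_surjective (inducedRelations 𝔟 ρ) m
  change envelopingExtend r F.1 (UniversalEnvelopingAlgebra.ι ℂ x • z) =
    r x (envelopingExtend r F.1 z)
  rw [envelopingExtend_smul, UniversalEnvelopingAlgebra.lift_ι_apply]

variable {𝔟 ρ} in
theorem Induced.hom_ext {F G : Induced 𝔟 ρ →ₗ[ℂ] X} (hF : ∀ (x : 𝔞) m, F ⁅x, m⁆ = r x (F m))
    (hG : ∀ (x : 𝔞) m, G ⁅x, m⁆ = r x (G m))
    (h : ∀ v, F (Induced.incl 𝔟 ρ v) = G (Induced.incl 𝔟 ρ v)) : F = G := by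
  have h1 : LinearMap.eqLocus F G = ⊤ := by
    refine Induced.eq_top 𝔟 ρ _ h fun x m hm => ?_
    change F ⁅x, m⁆ = G ⁅x, m⁆
    rw [hF, hG, show F m = G m from hm]
  exact LinearMap.eqLocus_eq_top.1 h1

/-- The extension of equivariant maps to the induced module, as a linear map. -/
def Induced.lift : equivariantMaps 𝔟 ρ r →ₗ[ℂ] Induced 𝔟 ρ →ₗ[ℂ] X where
  toFun := Induced.liftFun 𝔟 ρ r
  map_add' F G := by
    refine Induced.hom_ext r (Induced.liftFun_lie 𝔟 ρ r _) (fun x m => ?_) fun v => ?_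
    · simp only [LinearMap.add_apply, Induced.liftFun_lie, map_add]
    · simp only [LinearMap.add_apply, Induced.liftFun_incl]; rfl
  map_smul' c F := by
    refine Induced.hom_ext r (Induced.liftFun_lie 𝔟 ρ r _) (fun x m => ?_) fun v => ?_
    · simp only [LinearMap.smul_apply, Induced.liftFun_lie, map_smul, RingHom.id_apply]
    · simp only [LinearMap.smul_apply, Induced.liftFun_incl, RingHom.id_apply]; rfl

theorem Induced.lift_incl (F : equivariantMaps 𝔟 ρ r) (v : V) :
    Induced.lift 𝔟 ρ r F (Induced.incl 𝔟 ρ v) = F.1 v := Induced.liftFun_incl 𝔟 ρ r F v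

theorem Induced.lift_lie (F : equivariantMaps 𝔟 ρ r) (x : 𝔞) (m : Induced 𝔟 ρ) :
    Induced.lift 𝔟 ρ r F ⁅x, m⁆ = r x (Induced.lift 𝔟 ρ r F m) := Induced.liftFun_lie 𝔟 ρ r F x m

variable (J : Submodule (UniversalEnvelopingAlgebra ℂ 𝔞) (UniversalEnvelopingAlgebra ℂ 𝔞))

theorem Cyclic.eq_top (S : Submodule ℂ (Cyclic J)) (h0 : Cyclic.vac J ∈ S)
    (h1 : ∀ (x : 𝔞), ∀ m ∈ S, ⁅x, m⁆ ∈ S) : S = ⊤ := by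
  have h2 := mem_of_forall_ι_smul_mem S h1
  rw [eq_top_iff]
  rintro m -
  obtain ⟨u, rfl⟩ := Submodule.Quotient.mk_surjective J m
  have h := h2 u _ h0
  have h3 : u • (1 : UniversalEnvelopingAlgebra ℂ 𝔞) = u := by rw [smul_eq_mul, mul_one]
  rw [← h3]
  exact h

theorem Cyclic.smul_vac_eq_zero {u : UniversalEnvelopingAlgebra ℂ 𝔞} (hu : u ∈ J) :
    u • Cyclic.vac J = 0 := by
  change J.mkQ (u • 1) = 0
  rw [smul_eq_mul, mul_one, Submodule.mkQ_apply, Submodule.Quotient.mk_eq_zero]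
  exact hu

/-- The vectors of `X` killed by a set `G` of elements of the enveloping algebra. -/
def killedBy (G : Set (UniversalEnvelopingAlgebra ℂ 𝔞)) : Submodule ℂ X where
  carrier := {x | ∀ u ∈ G, UniversalEnvelopingAlgebra.lift ℂ r u x = 0}
  add_mem' {x y} hx hy u hu := by rw [map_add, hx u hu, hy u hu, add_zero]
  zero_mem' u _ := map_zero _
  smul_mem' c x hx u hu := by rw [map_smul, hx u hu, smul_zero]

/-- A vector killed by generators of the left ideal `J` defines a map out of `U(𝔞) / J`. -/
def Cyclic.lift (G : Set (UniversalEnvelopingAlgebra ℂ 𝔞)) :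
    killedBy r G →ₗ[ℂ] Cyclic (Submodule.span (UniversalEnvelopingAlgebra ℂ 𝔞) G) →ₗ[ℂ] X where
  toFun x := (((Submodule.span (UniversalEnvelopingAlgebra ℂ 𝔞) G).restrictScalars ℂ).liftQ
      (LinearMap.applyₗ x.1 ∘ₗ (UniversalEnvelopingAlgebra.lift ℂ r).toLinearMap) (by
        intro y (hy : y ∈ Submodule.span (UniversalEnvelopingAlgebra ℂ 𝔞) G)
        change UniversalEnvelopingAlgebra.lift ℂ r y x.1 = 0
        induction hy using Submodule.span_induction with
        | zero => rw [map_zero]; rfl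
        | add y z _ _ hy hz => rw [map_add, LinearMap.add_apply, hy, hz, add_zero]
        | smul u y _ hy => rw [smul_eq_mul, map_mul, Module.End.mul_apply, hy, map_zero]
        | mem y hy => exact x.2 y hy)) ∘ₗ
    (Submodule.Quotient.restrictScalarsEquiv ℂ
      (Submodule.span (UniversalEnvelopingAlgebra ℂ 𝔞) G)).symm.toLinearMap
  map_add' x y := by
    ext m
    obtain ⟨u, rfl⟩ := Submodule.Quotient.mk_surjective _ m
    exact map_add (UniversalEnvelopingAlgebra.lift ℂ r u) x.1 y.1
  map_smul' c x := by
    ext m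
    obtain ⟨u, rfl⟩ := Submodule.Quotient.mk_surjective _ m
    exact map_smul (UniversalEnvelopingAlgebra.lift ℂ r u) c x.1

theorem Cyclic.lift_vac (G : Set (UniversalEnvelopingAlgebra ℂ 𝔞)) (x : killedBy r G) :
    Cyclic.lift r G x (Cyclic.vac _) = x := by
  change UniversalEnvelopingAlgebra.lift ℂ r 1 x.1 = x.1
  rw [map_one]; rfl

theorem Cyclic.lift_lie (G : Set (UniversalEnvelopingAlgebra ℂ 𝔞)) (x : killedBy r G) (a : 𝔞)
    (m : Cyclic (Submodule.span (UniversalEnvelopingAlgebra ℂ 𝔞) G)) :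
    Cyclic.lift r G x ⁅a, m⁆ = r a (Cyclic.lift r G x m) := by
  obtain ⟨u, rfl⟩ := Submodule.Quotient.mk_surjective _ m
  change UniversalEnvelopingAlgebra.lift ℂ r (UniversalEnvelopingAlgebra.ι ℂ a * u) x.1 =
    r a (UniversalEnvelopingAlgebra.lift ℂ r u x.1)
  rw [map_mul, UniversalEnvelopingAlgebra.lift_ι_apply]; rfl

/-- An operator commuting with the action of `𝔞` commutes with that of `U(𝔞)`. -/
theorem lift_apply_comm {e : Module.End ℂ X} (he : ∀ x y, r x (e y) = e (r x y))
    (u : UniversalEnvelopingAlgebra ℂ 𝔞) (y : X) :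
    UniversalEnvelopingAlgebra.lift ℂ r u (e y) = e (UniversalEnvelopingAlgebra.lift ℂ r u y) := by
  induction u using enveloping_induction generalizing y with
  | algebraMap c => rw [AlgHom.commutes, Module.algebraMap_end_apply, Module.algebraMap_end_apply,
      map_smul]
  | ι x => rw [UniversalEnvelopingAlgebra.lift_ι_apply, he]
  | mul a b ha hb => rw [map_mul, Module.End.mul_apply, hb, ha]; rfl
  | add a b ha hb => rw [map_add, LinearMap.add_apply, ha, hb, LinearMap.add_apply, map_add]

theorem killedBy_stable {e : Module.End ℂ X} (he : ∀ x y, r x (e y) = e (r x y))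
    (G : Set (UniversalEnvelopingAlgebra ℂ 𝔞)) {y : X} (hy : y ∈ killedBy r G) :
    e y ∈ killedBy r G := fun u hu => by rw [lift_apply_comm r he, hy u hu, map_zero]

end Universal

/-! ### Tensor products of induced modules -/

section MultiInduced

/-- Frobenius reciprocity for a tensor product of induced modules: a multilinear map which is
`𝔟`-equivariant in each argument extends to the induced modules. The arguments are extended one
after the other, starting from the last. -/
theorem exists_multilinear_extension {𝔞 : Type v} [LieRing 𝔞] [LieAlgebra ℂ 𝔞]
    (𝔟 : LieSubalgebra ℂ 𝔞) (L : ℕ) : ∀ (V : Fin L → Type u) [∀ i, AddCommGroup (V i)]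
    [∀ i, Module ℂ (V i)] (ρ : ∀ i, 𝔟 →ₗ⁅ℂ⁆ Module.End ℂ (V i)) (X : Type (max u w))
    [AddCommGroup X] [Module ℂ X] (r : Fin L → 𝔞 →ₗ⁅ℂ⁆ Module.End ℂ X)
    (_ : ∀ i j, i ≠ j → ∀ x y z, r i x (r j y z) = r j y (r i x z))
    (φ : MultilinearMap ℂ V X)
    (_ : ∀ i (b : 𝔟) v, φ (Function.update v i (ρ i b (v i))) = r i b (φ v)),
    ∃ Φ : MultilinearMap ℂ (fun i => Induced 𝔟 (ρ i)) X,
      (∀ v, Φ (fun i => Induced.incl 𝔟 (ρ i) (v i)) = φ v) ∧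
      ∀ i (x : 𝔞) m, Φ (Function.update m i ⁅x, m i⁆) = r i x (Φ m) := by
  induction L with
  | zero =>
    intro V _ _ ρ X _ _ r hr φ hφ
    refine ⟨MultilinearMap.constOfIsEmpty ℂ _ (φ 0), fun v => ?_, fun i => i.elim0⟩
    rw [MultilinearMap.constOfIsEmpty_apply]
    exact congrArg φ (Subsingleton.elim _ _)
  | succ n ih =>
    intro V _ _ ρ X _ _ r hr φ hφ
    let E := equivariantMaps 𝔟 (ρ (Fin.last n)) (r (Fin.last n))
    let post : Fin n → 𝔞 →ₗ⁅ℂ⁆ Module.End ℂ (V (Fin.last n) →ₗ[ℂ] X) := fun i =>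
      { toFun := fun x => LinearMap.compRight ℂ (r i.castSucc x)
        map_add' := fun x y => by ext F v; simp
        map_smul' := fun c x => by ext F v; simp
        map_lie' := fun {x y} => by ext F v; simp [LieRing.of_associative_ring_bracket] }
    have hpost : ∀ i x, ∀ F ∈ E, post i x F ∈ E := by
      intro i x F hF b v
      change r i.castSucc x (F _) = r (Fin.last n) b (r i.castSucc x (F v))
      rw [hF b v, hr _ _ (Fin.castSucc_lt_last i).ne]
    have hcurry : ∀ v, φ.curryRight v ∈ E := by
      intro v b z
      have h := hφ (Fin.last n) b (Fin.snoc v z)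
      rw [Fin.snoc_last, Fin.update_snoc_last] at h
      exact h
    obtain ⟨Φ, h1, h2⟩ := ih (fun i => V i.castSucc) (fun i => ρ i.castSucc) E
      (fun i => restrictRep (post i) E (hpost i))
      (fun i j hij x y F => Subtype.ext (LinearMap.ext fun v =>
        hr _ _ (fun h => hij (Fin.castSucc_injective n h)) x y _))
      (φ.curryRight.codRestrict E hcurry)
      (by
        intro i b v
        refine Subtype.ext (LinearMap.ext fun z => ?_)
        have h := hφ i.castSucc b (Fin.snoc v z)
        rw [Fin.snoc_castSucc, ← Fin.snoc_update] at h
        exact h)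
    let Λ := Induced.lift 𝔟 (ρ (Fin.last n)) (r (Fin.last n))
    refine ⟨MultilinearMap.uncurryRight (Λ.compMultilinearMap Φ), fun v => ?_, fun i x m => ?_⟩
    · rw [MultilinearMap.uncurryRight_apply, LinearMap.compMultilinearMap_apply, Induced.lift_incl]
      have h := congrArg Subtype.val (h1 (Fin.init v))
      have h' : (Fin.init fun i => Induced.incl 𝔟 (ρ i) (v i)) =
        fun i => Induced.incl 𝔟 (ρ i.castSucc) (Fin.init v i) := rfl
      rw [h', h]
      change φ (Fin.snoc (Fin.init v) (v (Fin.last n))) = φ v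
      rw [Fin.snoc_init_self]
    · rw [MultilinearMap.uncurryRight_apply, MultilinearMap.uncurryRight_apply]
      induction i using Fin.lastCases with
      | last =>
        rw [Fin.init_update_last, Function.update_self]
        exact Induced.lift_lie 𝔟 _ _ _ _ _
      | cast i =>
        rw [Fin.init_update_castSucc, Function.update_of_ne (Fin.castSucc_lt_last i).ne']
        have h := h2 i x (Fin.init m)
        rw [LinearMap.compMultilinearMap_apply, LinearMap.compMultilinearMap_apply]
        have h' : Φ (Function.update (Fin.init m) i ⁅x, m i.castSucc⁆) = _ := h
        rw [h']
        -- both sides are equivariant in the last argument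
        have key : Λ (restrictRep (post i) E (hpost i) x (Φ (Fin.init m))) =
            r i.castSucc x ∘ₗ Λ (Φ (Fin.init m)) := by
          refine Induced.hom_ext (r (Fin.last n)) (Induced.lift_lie 𝔟 _ _ _) (fun y q => ?_)
            fun v => ?_
          · rw [LinearMap.comp_apply, LinearMap.comp_apply, Induced.lift_lie,
              hr _ _ (Fin.castSucc_lt_last i).ne]
          · rw [LinearMap.comp_apply, Induced.lift_incl, Induced.lift_incl]; rfl
        rw [key]; rfl

end MultiInduced

/-! ### Representations on tensor products -/

section TensorSum

variable {L : ℕ} {M : Fin L → Type u} [∀ i, AddCommGroup (M i)] [∀ i, Module ℂ (M i)]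

/-- The endomorphism `1 ⊗ ⋯ ⊗ e ⊗ ⋯ ⊗ 1` with `e` in position `i`. -/
def slot (i : Fin L) (e : Module.End ℂ (M i)) : Module.End ℂ (⨂[ℂ] i, M i) :=
  PiTensorProduct.map (Function.update (fun _ => LinearMap.id) i e)

theorem slot_tprod (i : Fin L) (e : Module.End ℂ (M i)) (m : ∀ i, M i) :
    slot i e (PiTensorProduct.tprod ℂ m) =
      PiTensorProduct.tprod ℂ (Function.update m i (e (m i))) := by
  rw [slot, PiTensorProduct.map_tprod]
  congr 1
  funext j
  by_cases h : j = i
  · subst h; simp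
  · simp [h]

theorem tensorSum_eq (e : ∀ i, Module.End ℂ (M i)) : tensorSum e = ∑ i, slot i (e i) := rfl

theorem slot_add (i : Fin L) (e e' : Module.End ℂ (M i)) :
    slot i (e + e') = slot i e + slot i e' := by
  ext m
  simp [slot_tprod, MultilinearMap.map_update_add]

theorem slot_smul (i : Fin L) (c : ℂ) (e : Module.End ℂ (M i)) :
    slot i (c • e) = c • slot i e := by
  ext m
  simp [slot_tprod, MultilinearMap.map_update_smul]

theorem slot_sub (i : Fin L) (e e' : Module.End ℂ (M i)) :
    slot i (e - e') = slot i e - slot i e' := by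
  ext m
  simp [slot_tprod, MultilinearMap.map_update_sub]

theorem slot_id (i : Fin L) : slot (M := M) i LinearMap.id = LinearMap.id := by
  ext m
  simp [slot_tprod]

theorem slot_zero (i : Fin L) : slot (M := M) i 0 = 0 := by
  simpa using slot_smul (M := M) i 0 0

theorem slot_mul (i : Fin L) (e e' : Module.End ℂ (M i)) :
    slot i (e * e') = slot i e * slot i e' := by
  ext m
  simp [slot_tprod]

theorem slot_comm {i j : Fin L} (h : i ≠ j) (e : Module.End ℂ (M i)) (e' : Module.End ℂ (M j)) :
    slot i e * slot j e' = slot j e' * slot i e := by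
  ext m
  simp only [LinearMap.compMultilinearMap_apply, Module.End.mul_apply, slot_tprod,
    Function.update_of_ne h, Function.update_of_ne h.symm]
  rw [Function.update_comm h]

theorem tensorSum_lie (e e' : ∀ i, Module.End ℂ (M i)) :
    tensorSum (fun i => ⁅e i, e' i⁆) = ⁅tensorSum e, tensorSum e'⁆ := by
  simp only [tensorSum_eq, LieRing.of_associative_ring_bracket, Finset.sum_mul_sum]
  rw [Finset.sum_comm (f := fun i j => slot i (e' i) * slot j (e j)), ← Finset.sum_sub_distrib]
  refine Finset.sum_congr rfl fun i _ => ?_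
  rw [← Finset.sum_sub_distrib, Finset.sum_eq_single i]
  · rw [slot_sub, slot_mul, slot_mul]
  · intro j _ hj
    rw [slot_comm hj.symm, sub_self]
  · simp

/-- The tensor product of a finite family of representations. -/
def piTensorRep {𝔤 : Type*} [LieRing 𝔤] [LieAlgebra ℂ 𝔤] (r : ∀ i, 𝔤 →ₗ⁅ℂ⁆ Module.End ℂ (M i)) :
    𝔤 →ₗ⁅ℂ⁆ Module.End ℂ (⨂[ℂ] i, M i) where
  toFun x := tensorSum fun i => r i x
  map_add' x y := by
    simp only [tensorSum_eq, map_add, slot_add, Finset.sum_add_distrib]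
  map_smul' c x := by
    simp only [tensorSum_eq, map_smul, slot_smul, Finset.smul_sum, RingHom.id_apply]
  map_lie' {x y} := by
    rw [← tensorSum_lie]
    simp only [LieHom.map_lie]

theorem tensorSum_scalar (c : Fin L → ℂ) :
    tensorSum (M := M) (fun i => c i • LinearMap.id) = (∑ i, c i) • LinearMap.id := by
  simp only [tensorSum_eq, slot_smul, slot_id, Finset.sum_smul]

theorem tensorSum_add (e e' : ∀ i, Module.End ℂ (M i)) :
    tensorSum (fun i => e i + e' i) = tensorSum e + tensorSum e' := by
  simp only [tensorSum_eq, slot_add, Finset.sum_add_distrib]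

theorem tensorSum_map {M' : Fin L → Type v} [∀ i, AddCommGroup (M' i)] [∀ i, Module ℂ (M' i)]
    (f : ∀ i, M i →ₗ[ℂ] M' i) (e : ∀ i, Module.End ℂ (M i)) (e' : ∀ i, Module.End ℂ (M' i))
    (h : ∀ i m, e' i (f i m) = f i (e i m)) (z : ⨂[ℂ] i, M i) :
    tensorSum e' (PiTensorProduct.map f z) = PiTensorProduct.map f (tensorSum e z) := by
  have : tensorSum e' ∘ₗ PiTensorProduct.map f = PiTensorProduct.map f ∘ₗ tensorSum e := by
    ext m
    simp only [tensorSum_eq, LinearMap.compMultilinearMap_apply, LinearMap.comp_apply,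
      LinearMap.sum_apply, PiTensorProduct.map_tprod, slot_tprod, map_sum]
    refine Finset.sum_congr rfl fun i _ => congrArg _ (funext fun j => ?_)
    by_cases hj : j = i
    · subst hj; simp [h]
    · simp [hj]
  exact LinearMap.congr_fun this z

end TensorSum

section Generation

/-- A tensor product of induced modules is generated by the tensor product of the modules they are
induced from, under the operators acting in a single factor. -/
theorem tensor_induced_eq_top {𝔞 : Type v} [LieRing 𝔞] [LieAlgebra ℂ 𝔞] (𝔟 : LieSubalgebra ℂ 𝔞)
    {L : ℕ} {V : Fin L → Type u} [∀ i, AddCommGroup (V i)] [∀ i, Module ℂ (V i)]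
    (ρ : ∀ i, 𝔟 →ₗ⁅ℂ⁆ Module.End ℂ (V i)) (S : Submodule ℂ (⨂[ℂ] i, Induced 𝔟 (ρ i)))
    (h0 : ∀ v, PiTensorProduct.map (fun i => Induced.incl 𝔟 (ρ i)) v ∈ S)
    (h1 : ∀ i (x : 𝔞), ∀ m ∈ S, slot i (LieModule.toEnd ℂ 𝔞 (Induced 𝔟 (ρ i)) x) m ∈ S) :
    S = ⊤ := by
  have key : ∀ s : Finset (Fin L), ∀ m : ∀ i, Induced 𝔟 (ρ i),
      (∀ i ∉ s, m i ∈ LinearMap.range (Induced.incl 𝔟 (ρ i))) →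
      PiTensorProduct.tprod ℂ m ∈ S := by
    intro s
    induction s using Finset.induction_on with
    | empty =>
      intro m hm
      choose v hv using fun i => hm i (Finset.notMem_empty i)
      have h := h0 (PiTensorProduct.tprod ℂ v)
      rw [PiTensorProduct.map_tprod] at h
      simpa only [hv] using h
    | insert i s hi ih =>
      intro m hm
      let T : Submodule ℂ (Induced 𝔟 (ρ i)) :=
        S.comap ((PiTensorProduct.tprod ℂ).toLinearMap m i)
      have hT : T = ⊤ := by
        refine Induced.eq_top 𝔟 (ρ i) T (fun v => ?_) fun x q hq => ?_
        · refine ih _ fun j hj => ?_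
          by_cases hji : j = i
          · subst hji; simp
          · rw [Function.update_of_ne hji]
            exact hm j (by simp [hji, hj])
        · have h := h1 i x _ hq
          rw [MultilinearMap.toLinearMap_apply, slot_tprod, Function.update_self,
            Function.update_idem] at h
          exact h
      have h : m i ∈ T := hT ▸ Submodule.mem_top
      change PiTensorProduct.tprod ℂ (Function.update m i (m i)) ∈ S at h
      rwa [Function.update_eq_self] at h
  rw [eq_top_iff, ← PiTensorProduct.span_tprod_eq_top, Submodule.span_le]
  rintro _ ⟨m, rfl⟩
  exact key Finset.univ m fun i hi => absurd (Finset.mem_univ i) hi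

/-- If `𝔞 = 𝔟 + 𝔠` and `M` is generated over `𝔞` by a `𝔟`-stable subspace `V`, then `M = V + 𝔠 M`.
The proof is an induction on the number of elements of `𝔞` applied to `V`: each step of the
resulting filtration is `𝔟`-stable. -/
theorem sup_relations_eq_top {𝔞 : Type*} [LieRing 𝔞] [LieAlgebra ℂ 𝔞] {M : Type*} [AddCommGroup M]
    [Module ℂ M] (a : 𝔞 →ₗ⁅ℂ⁆ Module.End ℂ M) (𝔟 𝔠 : Set 𝔞)
    (hbc : ∀ x : 𝔞, ∃ b ∈ 𝔟, ∃ c ∈ 𝔠, x = b + c) (V R : Submodule ℂ M)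
    (hb : ∀ b ∈ 𝔟, ∀ v ∈ V, a b v ∈ V)
    (hgen : ∀ S : Submodule ℂ M, V ≤ S → (∀ x, ∀ m ∈ S, a x m ∈ S) → S = ⊤)
    (hR : ∀ c ∈ 𝔠, ∀ m, a c m ∈ R) : V ⊔ R = ⊤ := by
  let F : ℕ → Submodule ℂ M :=
    fun n => Nat.rec V (fun _ S => S ⊔ Submodule.span ℂ {y | ∃ x, ∃ m ∈ S, y = a x m}) n
  have hF : ∀ n, F (n + 1) = F n ⊔ Submodule.span ℂ {y | ∃ x, ∃ m ∈ F n, y = a x m} :=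
    fun _ => rfl
  have hmono : Monotone F := monotone_nat_of_le_succ fun n => by rw [hF]; exact le_sup_left
  have hFb : ∀ n, ∀ b ∈ 𝔟, ∀ m ∈ F n, a b m ∈ F n := by
    intro n
    induction n with
    | zero => exact hb
    | succ n ih =>
      intro b hb' m hm
      have hle : F (n + 1) ≤ (F (n + 1)).comap (a b) := by
        conv_lhs => rw [hF]
        refine sup_le (fun m hm => hmono n.le_succ (ih b hb' m hm)) (Submodule.span_le.2 ?_)
        rintro _ ⟨x, m, hm, rfl⟩
        change a b (a x m) ∈ F (n + 1)
        have h : a b (a x m) = a ⁅b, x⁆ m + a x (a b m) := by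
          rw [LieHom.map_lie, LieRing.of_associative_ring_bracket]
          simp
        rw [h, hF]
        exact Submodule.mem_sup_right (add_mem (Submodule.subset_span ⟨_, m, hm, rfl⟩)
          (Submodule.subset_span ⟨x, _, ih b hb' m hm, rfl⟩))
      exact hle hm
  have hFR : ∀ n, F n ≤ V ⊔ R := by
    intro n
    induction n with
    | zero => exact le_sup_left
    | succ n ih =>
      rw [hF]
      refine sup_le ih (Submodule.span_le.2 ?_)
      rintro _ ⟨x, m, hm, rfl⟩
      obtain ⟨b, hb', c, hc', rfl⟩ := hbc x
      rw [map_add, LinearMap.add_apply]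
      exact add_mem (ih (hFb n b hb' m hm)) (Submodule.mem_sup_right (hR c hc' m))
  have htop : (⨆ n, F n) = ⊤ := by
    refine hgen _ (le_iSup F 0) fun x m hm => ?_
    rw [Submodule.mem_iSup_of_directed _ hmono.directed_le] at hm ⊢
    obtain ⟨n, hn⟩ := hm
    refine ⟨n + 1, ?_⟩
    rw [hF]
    exact Submodule.mem_sup_right (Submodule.subset_span ⟨x, m, hn, rfl⟩)
  rw [eq_top_iff, ← htop]
  exact iSup_le hFR

end Generation

/-! ### Laurent expansions of rational functions -/

section Expansions

theorem expandAt_X (a : ℂ) :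
    expandAt a RatFunc.X = algebraMap ℂ ℂ⸨X⸩ a + HahnSeries.single (1 : ℤ) (1 : ℂ) :=
  substitute_X _ _

theorem expandInfty_X : expandInfty RatFunc.X = HahnSeries.single (-1 : ℤ) (1 : ℂ) := by
  rw [expandInfty, substitute_X, HahnSeries.inv_single, inv_one]

theorem algebraMap_coeff (c : ℂ) (n : ℤ) :
    (algebraMap ℂ ℂ⸨X⸩ c).coeff n = if n = 0 then c else 0 := by
  rw [HahnSeries.algebraMap_apply]
  by_cases h : n = 0
  · subst h; simp
  · simp [h, HahnSeries.C_apply]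

theorem algebraMap_mem_regular (c : ℂ) : algebraMap ℂ ℂ⸨X⸩ c ∈ regular :=
  regular.algebraMap_mem c

theorem single_mem_regular {n : ℤ} (hn : 0 ≤ n) (c : ℂ) :
    (HahnSeries.single n c : ℂ⸨X⸩) ∈ regular := by
  rw [mem_regular_iff]
  intro m hm
  exact HahnSeries.coeff_single_of_ne (by omega)

theorem scale_mem_regular (ω : ℂˣ) {f : ℂ⸨X⸩} (hf : f ∈ regular) : scale ω f ∈ regular := by
  rw [mem_regular_iff] at hf ⊢
  intro n hn
  rw [scale_coeff, hf n hn, mul_zero]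

theorem inv_mem_regular {f : ℂ⸨X⸩} (hf : f ∈ regular) (h0 : f.coeff 0 ≠ 0) : f⁻¹ ∈ regular := by
  obtain ⟨p, rfl⟩ := hf
  have hp : PowerSeries.constantCoeff p ≠ 0 := by
    have := HahnSeries.ofPowerSeries_apply_coeff (Γ := ℤ) p 0
    rw [Nat.cast_zero] at this
    change (HahnSeries.ofPowerSeries ℤ ℂ p).coeff 0 ≠ 0 at h0
    rw [this] at h0
    simpa using h0
  refine ⟨p⁻¹, ?_⟩
  refine eq_inv_of_mul_eq_one_left ?_
  change HahnSeries.ofPowerSeries ℤ ℂ p⁻¹ * HahnSeries.ofPowerSeries ℤ ℂ p = 1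
  rw [← map_mul, PowerSeries.inv_mul_cancel _ hp, map_one]

theorem expandAt_X_sub_C (a b : ℂ) :
    expandAt b (RatFunc.X - RatFunc.C a) =
      algebraMap ℂ ℂ⸨X⸩ (b - a) + HahnSeries.single (1 : ℤ) (1 : ℂ) := by
  have h : (RatFunc.C a : RatFunc ℂ) = algebraMap ℂ (RatFunc ℂ) a := rfl
  rw [map_sub, expandAt_X, h, AlgHom.commutes, map_sub]
  ring

theorem expandAt_polynomial (a : ℂ) (p : Polynomial ℂ) :
    expandAt a (algebraMap _ _ p) ∈ regular ∧
      (expandAt a (algebraMap _ _ p)).coeff 0 = p.eval a := by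
  have hX : expandAt a RatFunc.X ∈ regular := by
    rw [expandAt_X]
    exact add_mem (algebraMap_mem_regular a) (single_mem_regular (by norm_num) 1)
  have hX0 : (expandAt a RatFunc.X).coeff 0 = a := by
    rw [expandAt_X, HahnSeries.coeff_add, algebraMap_coeff, HahnSeries.coeff_single_of_ne (by simp)]
    simp
  induction p using Polynomial.induction_on with
  | C c =>
    have h : (algebraMap (Polynomial ℂ) (RatFunc ℂ) (Polynomial.C c)) =
      algebraMap ℂ (RatFunc ℂ) c := rfl
    rw [h, AlgHom.commutes, algebraMap_coeff]
    exact ⟨algebraMap_mem_regular c, by simp⟩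
  | add p q hp hq =>
    rw [map_add, map_add, HahnSeries.coeff_add, hp.2, hq.2, Polynomial.eval_add]
    exact ⟨add_mem hp.1 hq.1, rfl⟩
  | monomial n c h =>
    rw [pow_succ, ← mul_assoc, map_mul, RatFunc.algebraMap_X, map_mul,
      coeff_zero_mul_of_regular h.1 hX, h.2, hX0,
      Polynomial.eval_mul (p := _ * _), Polynomial.eval_X]
    exact ⟨mul_mem h.1 hX, rfl⟩

theorem coeff_single_mul (n m : ℤ) (f : ℂ⸨X⸩) :
    (HahnSeries.single n (1 : ℂ) * f).coeff m = f.coeff (m - n) := by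
  have := HahnSeries.coeff_single_mul_add (r := (1 : ℂ)) (x := f) (a := m - n) (b := n)
  rw [sub_add_cancel, one_mul] at this
  exact this

theorem single_one_pow (n : ℕ) :
    (HahnSeries.single (1 : ℤ) (1 : ℂ) : ℂ⸨X⸩) ^ n = HahnSeries.single (n : ℤ) 1 := by
  rw [HahnSeries.single_pow]; simp

theorem expandAt_polar_self (a : ℂ) (n : ℕ) :
    expandAt a ((RatFunc.X - RatFunc.C a)⁻¹ ^ n) = HahnSeries.single (-n : ℤ) (1 : ℂ) := by
  rw [map_pow, map_inv₀, expandAt_X_sub_C, sub_self, map_zero, zero_add, inv_pow, single_one_pow,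
    HahnSeries.inv_single, inv_one]

theorem expandAt_polar_of_ne {a b : ℂ} (h : b ≠ a) (n : ℕ) :
    expandAt b ((RatFunc.X - RatFunc.C a)⁻¹ ^ n) ∈ regular := by
  rw [map_pow, map_inv₀, expandAt_X_sub_C]
  refine pow_mem (inv_mem_regular ?_ ?_) n
  · exact add_mem (algebraMap_mem_regular _) (single_mem_regular (by norm_num) 1)
  · rw [HahnSeries.coeff_add, algebraMap_coeff, HahnSeries.coeff_single_of_ne (by simp)]
    simpa using sub_ne_zero.2 h

/-- The expansion of `(t - a)⁻ⁿ` at infinity is `ξⁿ` times a power series with constant term `1`. -/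
theorem expandInfty_polar (a : ℂ) (n : ℕ) : ∃ u ∈ regular, u.coeff 0 = 1 ∧
    expandInfty ((RatFunc.X - RatFunc.C a)⁻¹ ^ n) = HahnSeries.single (n : ℤ) (1 : ℂ) * u := by
  have hC : (RatFunc.C a : RatFunc ℂ) = algebraMap ℂ (RatFunc ℂ) a := rfl
  let w : ℂ⸨X⸩ := 1 - algebraMap ℂ ℂ⸨X⸩ a * HahnSeries.single (1 : ℤ) (1 : ℂ)
  have hw : w ∈ regular :=
    sub_mem (one_mem _) (mul_mem (algebraMap_mem_regular a) (single_mem_regular (by norm_num) 1))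
  have hw0 : w.coeff 0 = 1 := by
    rw [HahnSeries.coeff_sub, mul_comm, coeff_single_mul, algebraMap_coeff]
    simp
  have hne : w ≠ 0 := by
    intro h
    rw [h] at hw0
    simp at hw0
  have hu : w⁻¹ ∈ regular := inv_mem_regular hw (by rw [hw0]; exact one_ne_zero)
  have hu0 : (w⁻¹).coeff 0 = 1 := by
    have h := coeff_zero_mul_of_regular hu hw
    rw [inv_mul_cancel₀ hne, hw0, mul_one] at h
    rw [← h]
    simp
  have hpow : ∀ n : ℕ, ((w⁻¹) ^ n).coeff 0 = 1 := by
    intro n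
    induction n with
    | zero => simp
    | succ n ih =>
      rw [pow_succ, coeff_zero_mul_of_regular (pow_mem hu n) hu, ih, hu0, one_mul]
  refine ⟨w⁻¹ ^ n, pow_mem hu n, hpow n, ?_⟩
  have h1 : expandInfty (RatFunc.X - RatFunc.C a) = (HahnSeries.single (1 : ℤ) (1 : ℂ))⁻¹ * w := by
    rw [map_sub, expandInfty, substitute_X, hC, AlgHom.commutes, mul_sub, mul_one, mul_left_comm,
      inv_mul_cancel₀ (by simp), mul_one]
  rw [map_pow, map_inv₀, h1, mul_inv, inv_inv, mul_pow, single_one_pow]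

theorem expandInfty_X_pow (n : ℕ) :
    expandInfty (RatFunc.X ^ n) = HahnSeries.single (-n : ℤ) (1 : ℂ) := by
  rw [map_pow, expandInfty_X, HahnSeries.single_pow]; simp

theorem expandAt_X_pow (a : ℂ) (n : ℕ) : expandAt a (RatFunc.X ^ n) ∈ regular := by
  have h := (expandAt_polynomial a (Polynomial.X ^ n)).1
  rwa [map_pow, RatFunc.algebraMap_X] at h

theorem expandAt_algebraMap (a c : ℂ) :
    expandAt a (algebraMap ℂ (RatFunc ℂ) c) = algebraMap ℂ ℂ⸨X⸩ c := AlgHom.commutes _ _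

theorem exists_pole_bound (f : ℂ⸨X⸩) : ∃ d : ℕ, ∀ n : ℤ, n < -d → f.coeff n = 0 := by
  refine ⟨(-f.order).toNat, fun n hn => ?_⟩
  exact HahnSeries.coeff_eq_zero_of_lt_order (by omega)

/-- The space of polynomials in `(t - a)⁻¹` without constant term. -/
def polarParts (a : ℂ) : Submodule ℂ (RatFunc ℂ) :=
  Submodule.span ℂ (Set.range fun n : ℕ => (RatFunc.X - RatFunc.C a)⁻¹ ^ (n + 1))

/-- The space of polynomials in `t` without constant term. -/
def polarPartsInfty : Submodule ℂ (RatFunc ℂ) :=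
  Submodule.span ℂ (Set.range fun n : ℕ => RatFunc.X ^ (n + 1))

/-- A principal part is realised by elements `e n` whose expansions are `ξ⁻ⁿ⁻¹`. -/
theorem exists_principal_part (φ : RatFunc ℂ →ₐ[ℂ] ℂ⸨X⸩) (e : ℕ → RatFunc ℂ)
    (he : ∀ n : ℕ, φ (e n) = HahnSeries.single (-(n + 1 : ℕ) : ℤ) (1 : ℂ)) (f : ℂ⸨X⸩) :
    ∃ g ∈ Submodule.span ℂ (Set.range e), φ g - f ∈ regular := by
  obtain ⟨d, hd⟩ := exists_pole_bound f
  induction d generalizing f with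
  | zero =>
    refine ⟨0, zero_mem _, ?_⟩
    rw [map_zero, zero_sub]
    exact neg_mem (mem_regular_iff.2 fun n hn => hd n (by simpa using hn))
  | succ d ih =>
    obtain ⟨g, hg, h⟩ := ih (f - f.coeff (-(d + 1 : ℕ)) • φ (e d)) (by
      intro n hn
      rw [HahnSeries.coeff_sub, HahnSeries.coeff_smul, he]
      by_cases hnd : n = -((d + 1 : ℕ) : ℤ)
      · subst hnd
        rw [HahnSeries.coeff_single_same]
        simp
      · rw [HahnSeries.coeff_single_of_ne hnd, hd n (by push_cast at hnd ⊢; omega)]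
        simp)
    refine ⟨g + f.coeff (-(d + 1 : ℕ)) • e d, add_mem hg (Submodule.smul_mem _ _
      (Submodule.subset_span ⟨d, rfl⟩)), ?_⟩
    rw [map_add, map_smul]
    convert h using 1
    abel

theorem exists_mem_polarParts (a : ℂ) (f : ℂ⸨X⸩) :
    ∃ g ∈ polarParts a, expandAt a g - f ∈ regular :=
  exists_principal_part (expandAt a) _ (fun n => expandAt_polar_self a (n + 1)) f

theorem exists_mem_polarPartsInfty (f : ℂ⸨X⸩) :
    ∃ g ∈ polarPartsInfty, expandInfty g - f ∈ regular :=
  exists_principal_part expandInfty _ (fun n => expandInfty_X_pow (n + 1)) f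

theorem regular_of_mem_span {φ : RatFunc ℂ →ₐ[ℂ] ℂ⸨X⸩} {s : Set (RatFunc ℂ)}
    (h : ∀ g ∈ s, φ g ∈ regular) {g : RatFunc ℂ} (hg : g ∈ Submodule.span ℂ s) :
    φ g ∈ regular := by
  have : Submodule.span ℂ s ≤ (Subalgebra.toSubmodule regular).comap φ.toLinearMap :=
    Submodule.span_le.2 h
  exact this hg

theorem expandAt_polarParts {a b : ℂ} (h : b ≠ a) {g : RatFunc ℂ} (hg : g ∈ polarParts a) :
    expandAt b g ∈ regular :=
  regular_of_mem_span (by rintro _ ⟨n, rfl⟩; exact expandAt_polar_of_ne h _) hg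

theorem expandInfty_polarParts {a : ℂ} {g : RatFunc ℂ} (hg : g ∈ polarParts a) :
    expandInfty g ∈ regular := by
  refine regular_of_mem_span ?_ hg
  rintro _ ⟨n, rfl⟩
  obtain ⟨u, hu, -, h⟩ := expandInfty_polar a (n + 1)
  simp only [h]
  exact mul_mem (single_mem_regular (by positivity) 1) hu

theorem expandAt_polarPartsInfty {b : ℂ} {g : RatFunc ℂ} (hg : g ∈ polarPartsInfty) :
    expandAt b g ∈ regular :=
  regular_of_mem_span (by rintro _ ⟨n, rfl⟩; exact expandAt_X_pow _ _) hg

/-- A rational function regular on the whole Riemann sphere is constant. -/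
theorem eq_const_of_regular {r : RatFunc ℂ} (h : ∀ a, expandAt a r ∈ regular)
    (hi : expandInfty r ∈ regular) : ∃ c : ℂ, r = algebraMap ℂ (RatFunc ℂ) c := by
  have hd : r.denom.natDegree = 0 := by
    by_contra hne
    obtain ⟨a, ha⟩ := Complex.exists_root (f := r.denom) (by
      rw [← Polynomial.natDegree_pos_iff_degree_pos]; omega)
    have h1 : algebraMap _ (RatFunc ℂ) r.num = r * algebraMap _ (RatFunc ℂ) r.denom := by
      have h2 : algebraMap (Polynomial ℂ) (RatFunc ℂ) r.denom ≠ 0 := by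
        simpa using RatFunc.denom_ne_zero r
      rw [← div_eq_iff h2, RatFunc.num_div_denom]
    have h2 := (expandAt_polynomial a r.num).2
    rw [h1, map_mul, coeff_zero_mul_of_regular (h a) (expandAt_polynomial a r.denom).1,
      (expandAt_polynomial a r.denom).2, ha.eq_zero, mul_zero] at h2
    obtain ⟨x, y, hxy⟩ := RatFunc.isCoprime_num_denom r
    have h3 := congrArg (Polynomial.eval a) hxy
    simp [← h2, ha.eq_zero] at h3
  have hd1 : r.denom = 1 := by
    rw [Polynomial.eq_one_of_monic_natDegree_zero (RatFunc.monic_denom r) hd]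
  have hr : r = algebraMap _ (RatFunc ℂ) r.num := by
    conv_lhs => rw [← RatFunc.num_div_denom r, hd1, map_one, div_one]
  have hcoeff : ∀ (p : Polynomial ℂ) (n : ℕ),
      (expandInfty (algebraMap _ _ p)).coeff (-n) = p.coeff n := by
    intro p n
    induction p using Polynomial.induction_on' with
    | add p q hp hq => rw [map_add, map_add, HahnSeries.coeff_add, hp, hq, Polynomial.coeff_add]
    | monomial m c =>
      rw [← Polynomial.smul_X_eq_monomial, Polynomial.coeff_smul, Polynomial.coeff_X_pow]
      have h1 : algebraMap (Polynomial ℂ) (RatFunc ℂ) (c • Polynomial.X ^ m) =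
          c • RatFunc.X ^ m := by
        rw [Algebra.smul_def, map_mul, map_pow, RatFunc.algebraMap_X, Algebra.smul_def]; rfl
      rw [h1, map_smul, HahnSeries.coeff_smul, expandInfty_X_pow]
      by_cases hm : n = m
      · subst hm; simp
      · rw [HahnSeries.coeff_single_of_ne (by omega), if_neg hm]
  have hnum : r.num = Polynomial.C (r.num.coeff 0) := by
    ext n
    rw [Polynomial.coeff_C]
    split_ifs with hn
    · rw [hn]
    · rw [← hcoeff, ← hr]
      exact mem_regular_iff.1 hi _ (by omega)
  exact ⟨r.num.coeff 0, hr.trans ((congrArg _ hnum).trans rfl)⟩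

/-- Partial fractions: a rational function minus its principal parts is constant. -/
theorem exists_partial_fractions (S : Finset ℂ) {r : RatFunc ℂ}
    (h : ∀ a ∉ S, expandAt a r ∈ regular) :
    ∃ (c : ℂ) (g : ℂ → RatFunc ℂ) (g' : RatFunc ℂ), (∀ a, g a ∈ polarParts a) ∧
      g' ∈ polarPartsInfty ∧ r = algebraMap ℂ (RatFunc ℂ) c + ∑ a ∈ S, g a + g' := by
  choose g hg hgr using fun a => exists_mem_polarParts a (expandAt a r)
  obtain ⟨g', hg', hgr'⟩ := exists_mem_polarPartsInfty (expandInfty r)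
  obtain ⟨c, hc⟩ := eq_const_of_regular (r := r - ∑ a ∈ S, g a - g') (by
      intro b
      rw [map_sub, map_sub, map_sum]
      refine sub_mem ?_ (expandAt_polarPartsInfty hg')
      by_cases hb : b ∈ S
      · rw [← Finset.add_sum_erase S _ hb, ← sub_sub]
        refine sub_mem ?_ (sum_mem fun a ha =>
          expandAt_polarParts (Finset.ne_of_mem_erase ha).symm (hg a))
        rw [← neg_sub]
        exact neg_mem (hgr b)
      · refine sub_mem (h b hb) (sum_mem fun a ha => expandAt_polarParts ?_ (hg a))
        rintro rfl
        exact hb ha) (by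
      rw [map_sub, map_sub, map_sum, sub_right_comm]
      refine sub_mem ?_ (sum_mem fun a _ => expandInfty_polarParts (hg a))
      rw [← neg_sub]
      exact neg_mem hgr')
  exact ⟨c, g, g', hg, hg', by rw [← hc]; ring⟩

/-- The residue theorem on the Riemann sphere. At infinity the residue of `r dt` is
`-[ξ¹] r(ξ⁻¹)`, since `dt = -ξ⁻² dξ`. -/
theorem sum_residue_eq (S : Finset ℂ) {r : RatFunc ℂ} (h : ∀ a ∉ S, expandAt a r ∈ regular) :
    ∑ a ∈ S, residue (expandAt a r) = (expandInfty r).coeff 1 := by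
  let coeffOne : ℂ⸨X⸩ →ₗ[ℂ] ℂ :=
    { toFun := fun f => f.coeff 1, map_add' := fun _ _ => rfl, map_smul' := fun _ _ => rfl }
  let D : RatFunc ℂ →ₗ[ℂ] ℂ := ∑ a ∈ S, residue ∘ₗ (expandAt a).toLinearMap -
    coeffOne ∘ₗ expandInfty.toLinearMap
  have hD : ∀ r, D r = ∑ a ∈ S, residue (expandAt a r) - (expandInfty r).coeff 1 := by
    intro r
    simp only [D, LinearMap.sub_apply, LinearMap.sum_apply]
    rfl
  suffices D r = 0 by rwa [hD, sub_eq_zero] at this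
  obtain ⟨c, g, g', hg, hg', rfl⟩ := exists_partial_fractions S h
  rw [map_add, map_add, map_sum]
  have h1 : D (algebraMap ℂ (RatFunc ℂ) c) = 0 := by
    rw [hD, AlgHom.commutes, algebraMap_coeff, if_neg one_ne_zero, sub_zero]
    refine Finset.sum_eq_zero fun a _ => ?_
    rw [AlgHom.commutes]
    exact residue_regular (algebraMap_mem_regular c)
  have h2 : D g' = 0 := by
    have hle : polarPartsInfty ≤ LinearMap.ker D := by
      refine Submodule.span_le.2 ?_
      rintro _ ⟨n, rfl⟩
      change D _ = 0
      rw [hD, expandInfty_X_pow, HahnSeries.coeff_single_of_ne (by push_cast; omega), sub_zero]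
      exact Finset.sum_eq_zero fun a _ => residue_regular (expandAt_X_pow a _)
    exact hle hg'
  have h3 : ∀ a ∈ S, D (g a) = 0 := by
    intro a ha
    have hle : polarParts a ≤ LinearMap.ker D := by
      refine Submodule.span_le.2 ?_
      rintro _ ⟨n, rfl⟩
      change D _ = 0
      obtain ⟨u, hu, hu0, h⟩ := expandInfty_polar a (n + 1)
      rw [hD, h, coeff_single_mul, Finset.sum_eq_single a
        (fun b _ hb => residue_regular (expandAt_polar_of_ne hb _)) (fun h => absurd ha h),
        expandAt_polar_self]
      change (HahnSeries.single _ (1 : ℂ)).coeff (-1) - _ = _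
      by_cases hn : n = 0
      · subst hn
        simp [hu0]
      · rw [HahnSeries.coeff_single_of_ne (by push_cast; omega),
          mem_regular_iff.1 hu _ (by push_cast; omega), sub_zero]
    exact hle (hg a)
  rw [h1, h2, Finset.sum_eq_zero h3]
  simp

theorem derivative_algebraMap (c : ℂ) :
    LaurentSeries.derivative ℂ (algebraMap ℂ ℂ⸨X⸩ c) = 0 := by
  ext n
  rw [LaurentSeries.derivative_apply, LaurentSeries.hasseDeriv_coeff, algebraMap_coeff]
  simp only [Nat.cast_one, Ring.choose_one_right, HahnSeries.coeff_zero]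
  split_ifs with h <;> simp [h]

theorem derivative_single (n : ℤ) :
    LaurentSeries.derivative ℂ (HahnSeries.single n (1 : ℂ)) =
      HahnSeries.single (n - 1) (n : ℂ) := by
  ext m
  rw [LaurentSeries.derivative_apply, LaurentSeries.hasseDeriv_coeff]
  simp only [Nat.cast_one, Ring.choose_one_right]
  by_cases h : m = n - 1
  · subst h; simp
  · rw [HahnSeries.coeff_single_of_ne h, HahnSeries.coeff_single_of_ne (by omega), smul_zero]

theorem derivative_inv {f : ℂ⸨X⸩} (hf : f ≠ 0) :
    LaurentSeries.derivative ℂ f⁻¹ = -(LaurentSeries.derivative ℂ f * f⁻¹ ^ 2) := by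
  have h := derivative_mul f f⁻¹
  have h1 := derivative_algebraMap 1
  rw [map_one] at h1
  rw [mul_inv_cancel₀ hf, h1] at h
  have h2 : f * LaurentSeries.derivative ℂ f⁻¹ = -(LaurentSeries.derivative ℂ f * f⁻¹) := by
    linear_combination -h
  calc LaurentSeries.derivative ℂ f⁻¹ = f⁻¹ * (f * LaurentSeries.derivative ℂ f⁻¹) := by
        rw [← mul_assoc, inv_mul_cancel₀ hf, one_mul]
    _ = _ := by rw [h2]; ring

/-- The predicate that `g` is the derivative of `f` with respect to `t`, in terms of expansions: at
`∞`, where `t = ξ⁻¹`, the derivative with respect to `ξ` is `-ξ⁻² d/dt`. -/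
def IsDerivOf (g f : RatFunc ℂ) : Prop :=
  (∀ a, LaurentSeries.derivative ℂ (expandAt a f) = expandAt a g) ∧
    LaurentSeries.derivative ℂ (expandInfty f) =
      -(HahnSeries.single (-2 : ℤ) (1 : ℂ) * expandInfty g)

theorem exists_isDerivOf (f : RatFunc ℂ) : ∃ g, IsDerivOf g f := by
  have hC : ∀ c : ℂ, IsDerivOf 0 (algebraMap ℂ (RatFunc ℂ) c) := fun c =>
    ⟨fun a => by rw [AlgHom.commutes, derivative_algebraMap, map_zero], by
      rw [AlgHom.commutes, derivative_algebraMap, map_zero, mul_zero, neg_zero]⟩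
  have hX : IsDerivOf 1 RatFunc.X := by
    refine ⟨fun a => ?_, ?_⟩
    · rw [expandAt_X, map_add, derivative_algebraMap, derivative_single, map_one]; simp
    · rw [expandInfty_X, derivative_single, map_one expandInfty, mul_one]
      ext n
      by_cases h : n = -2
      · subst h; simp
      · rw [HahnSeries.coeff_neg, HahnSeries.coeff_single_of_ne h,
          HahnSeries.coeff_single_of_ne (by omega), neg_zero]
  have hadd : ∀ {f g f' g'}, IsDerivOf f' f → IsDerivOf g' g → IsDerivOf (f' + g') (f + g) :=
    fun hf hg => ⟨fun a => by rw [map_add, map_add, hf.1, hg.1, map_add], by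
      rw [map_add, map_add, hf.2, hg.2, map_add]; ring⟩
  have hmul : ∀ {f g f' g'}, IsDerivOf f' f → IsDerivOf g' g →
      IsDerivOf (f' * g + f * g') (f * g) :=
    fun hf hg => ⟨fun a => by
        rw [map_mul, derivative_mul, hf.1, hg.1]; simp only [map_add, map_mul],
      by rw [map_mul, derivative_mul, hf.2, hg.2]; simp only [map_add, map_mul]; ring⟩
  have hpoly : ∀ p : Polynomial ℂ, ∃ g, IsDerivOf g (algebraMap _ (RatFunc ℂ) p) := by
    intro p
    induction p using Polynomial.induction_on with
    | C c => exact ⟨0, hC c⟩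
    | add p q hp hq =>
      obtain ⟨p', hp⟩ := hp
      obtain ⟨q', hq⟩ := hq
      exact ⟨_, by rw [map_add]; exact hadd hp hq⟩
    | monomial n c h =>
      obtain ⟨p', hp⟩ := h
      exact ⟨_, by rw [pow_succ, ← mul_assoc, map_mul, RatFunc.algebraMap_X]; exact hmul hp hX⟩
  induction f using RatFunc.induction_on with
  | f p q hq =>
    obtain ⟨p', hp⟩ := hpoly p
    obtain ⟨q', hq'⟩ := hpoly q
    have hne : algebraMap (Polynomial ℂ) (RatFunc ℂ) q ≠ 0 := by simpa using hq
    have hinv : IsDerivOf (-(q' * (algebraMap (Polynomial ℂ) (RatFunc ℂ) q)⁻¹ ^ 2))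
        (algebraMap (Polynomial ℂ) (RatFunc ℂ) q)⁻¹ := by
      refine ⟨fun a => ?_, ?_⟩
      · rw [map_inv₀, derivative_inv (by simpa using hne), hq'.1, map_neg, map_mul, map_pow,
          map_inv₀]
      · rw [map_inv₀, derivative_inv (by simpa using hne), hq'.2, map_neg, map_mul, map_pow,
          map_inv₀]
        ring
    rw [div_eq_mul_inv]
    exact ⟨_, hmul hp hinv⟩

theorem residue_neg_single_mul (f : ℂ⸨X⸩) :
    residue (-(HahnSeries.single (-2 : ℤ) (1 : ℂ) * f)) = -f.coeff 1 := by
  rw [map_neg]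
  change -(HahnSeries.single (-2 : ℤ) (1 : ℂ) * f).coeff (-1) = _
  rw [coeff_single_mul]
  norm_num

end Expansions

/-! ### Rotations and averaging -/

section Rotations

theorem scale_expandAt (ω : ℂˣ) (a : ℂ) (f : RatFunc ℂ) :
    scale ω (expandAt (ω * a) f) = expandAt a (rotate ω f) := by
  refine ratFunc_hom_ext (φ := (scale ω).comp (expandAt (ω * a)))
    (ψ := (expandAt a).comp (rotate ω)) ?_ f
  simp only [AlgHom.comp_apply, expandAt, rotate, substitute_X, map_mul, AlgHom.commutes, map_add,
    mul_add]
  congr 1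
  ext n
  rw [HahnSeries.algebraMap_apply, HahnSeries.C_mul_eq_smul]
  by_cases h : n = 1
  · subst h; simp
  · simp [HahnSeries.coeff_single_of_ne h]

theorem rotate_one (f : RatFunc ℂ) : rotate 1 f = f :=
  ratFunc_hom_ext (φ := rotate 1) (ψ := AlgHom.id ℂ _) (by simp [rotate, substitute_X]) f

theorem rotate_rotate (ω ω' : ℂˣ) (f : RatFunc ℂ) : rotate ω (rotate ω' f) = rotate (ω * ω') f :=
  ratFunc_hom_ext (φ := (rotate ω).comp (rotate ω')) (ψ := rotate (ω * ω'))
    (by simp only [AlgHom.comp_apply, rotate, substitute_X, map_mul, AlgHom.commutes,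
          Units.val_mul]; ring) f

theorem scale_one (f : ℂ⸨X⸩) : scale 1 f = f := by ext n; simp

theorem scale_scale (ω ω' : ℂˣ) (f : ℂ⸨X⸩) : scale ω (scale ω' f) = scale (ω * ω') f := by
  ext n
  simp [mul_zpow, mul_assoc]

theorem expandAt_rotate_regular {ω : ℂˣ} {a : ℂ} {f : RatFunc ℂ}
    (h : expandAt (ω * a) f ∈ regular) : expandAt a (rotate ω f) ∈ regular := by
  rw [← scale_expandAt]
  exact scale_mem_regular ω h

theorem scale_pow_of_scale {ω c : ℂˣ} {f : ℂ⸨X⸩} (h : scale ω f = (c : ℂ) • f) (j : ℕ) :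
    scale (ω ^ j) f = ((c ^ j : ℂˣ) : ℂ) • f := by
  induction j with
  | zero => simp [scale_one]
  | succ j ih =>
    rw [pow_succ, ← scale_scale, h, map_smul, ih, smul_smul, pow_succ, Units.val_mul, mul_comm]

theorem eps_isPrimitiveRoot (N : ℕ) [NeZero N] : IsPrimitiveRoot (eps N) N := by
  have h : ((eps N : ℂˣ) : ℂ) = Complex.exp (2 * Real.pi * Complex.I / N) := rfl
  rw [← IsPrimitiveRoot.coe_units_iff, h]
  exact Complex.isPrimitiveRoot_exp N (NeZero.ne N)

/-- The sum `∑ⱼ c⁻ʲ g(εʲ t)` over the cyclic group, for a character value `c`. -/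
def average (N : ℕ) (c : ℂˣ) (g : RatFunc ℂ) : RatFunc ℂ :=
  ∑ j ∈ Finset.range N, ((c⁻¹ ^ j : ℂˣ) : ℂ) • rotate (eps N ^ j) g

theorem rotate_smul (ω : ℂˣ) (c : ℂ) (f : RatFunc ℂ) : rotate ω (c • f) = c • rotate ω f := by
  rw [RatFunc.smul_eq_C_mul, RatFunc.smul_eq_C_mul, map_mul]
  exact congrArg (· * rotate ω f) ((rotate ω).commutes c)

theorem smul_sub_smul_mem_regular (c : ℂ) {x y : ℂ⸨X⸩} (h : x - y ∈ regular) :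
    c • x - c • y ∈ regular := by
  have h1 := regular.smul_mem h c
  rwa [smul_sub] at h1

theorem rotate_average (N : ℕ) [NeZero N] (c : ℂˣ) (hc : c ^ N = 1) (g : RatFunc ℂ) :
    rotate (eps N) (average N c g) = (c : ℂ) • average N c g := by
  let u : ℕ → RatFunc ℂ := fun j => ((c⁻¹ ^ j : ℂˣ) : ℂ) • rotate (eps N ^ j) g
  have hu : ∀ j, rotate (eps N) (u j) = (c : ℂ) • u (j + 1) := by
    intro j
    simp only [u]
    rw [rotate_smul, rotate_rotate, smul_smul, ← pow_succ' (eps N)]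
    congr 1
    rw [← Units.val_mul, pow_succ']
    simp
  have hN : u N = u 0 := by
    simp only [u, (eps_isPrimitiveRoot N).pow_eq_one, inv_pow, hc, pow_zero]
  have h := (Finset.sum_range_succ u N).symm.trans (Finset.sum_range_succ' u N)
  rw [hN] at h
  rw [average, map_sum, Finset.sum_congr rfl fun j _ => hu j, ← Finset.smul_sum]
  exact congrArg _ (add_right_cancel h).symm

/-- Mittag-Leffler for the cyclic group: there is a rational function `h` with `h(εt) = c h(t)` and
prescribed principal parts at the marked points, at `0` and at `∞`. -/
theorem exists_equivariant_ratFunc (N : ℕ) [NeZero N] {L : ℕ} (t : Fin L → ℂ) (ht0 : ∀ i, t i ≠ 0)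
    (ht : ∀ i j, i ≠ j → ∀ a : ℤ, t i ≠ (eps N ^ a : ℂˣ) * t j) (c : ℂˣ) (hc : c ^ N = 1)
    (f₀ f₁ : ℂ⸨X⸩) (f : Fin L → ℂ⸨X⸩) (hf₀ : scale (eps N) f₀ = (c : ℂ) • f₀)
    (hf₁ : scale (eps N)⁻¹ f₁ = (c : ℂ) • f₁) :
    ∃ h : RatFunc ℂ, rotate (eps N) h = (c : ℂ) • h ∧ expandAt 0 h - f₀ ∈ regular ∧
      expandInfty h - f₁ ∈ regular ∧ (∀ i, expandAt (t i) h - f i ∈ regular) ∧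
      ∀ a, a ≠ 0 → ¬ IsMarked N t a → expandAt a h ∈ regular := by
  have hNC : (N : ℂ) ≠ 0 := Nat.cast_ne_zero.2 (NeZero.ne N)
  choose g hg hgr using fun i => exists_mem_polarParts (t i) (f i)
  obtain ⟨g₀, hg₀, hgr₀⟩ := exists_mem_polarParts 0 ((N : ℂ)⁻¹ • f₀)
  obtain ⟨g₁, hg₁, hgr₁⟩ := exists_mem_polarPartsInfty ((N : ℂ)⁻¹ • f₁)
  let G := ∑ i, g i + g₀ + g₁
  have hG : ∀ a, a ≠ 0 → (∀ i, a ≠ t i) → expandAt a G ∈ regular := by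
    intro a ha hai
    simp only [G, map_add, map_sum]
    exact add_mem (add_mem (sum_mem fun i _ => expandAt_polarParts (hai i) (hg i))
      (expandAt_polarParts ha hg₀)) (expandAt_polarPartsInfty hg₁)
  have hGi : ∀ i, expandAt (t i) G - f i ∈ regular := by
    intro i
    simp only [G, map_add, map_sum]
    rw [← Finset.add_sum_erase _ _ (Finset.mem_univ i)]
    have h1 : ∑ j ∈ Finset.univ.erase i, expandAt (t i) (g j) ∈ regular := by
      refine sum_mem fun j hj => expandAt_polarParts ?_ (hg j)
      have h := ht i j (Finset.ne_of_mem_erase hj).symm 0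
      simpa using h
    have h2 := add_mem (add_mem (add_mem (hgr i) h1) (expandAt_polarParts (ht0 i) hg₀))
      (expandAt_polarPartsInfty (b := t i) hg₁)
    convert h2 using 1
    ring
  have hG₀ : expandAt 0 G - (N : ℂ)⁻¹ • f₀ ∈ regular := by
    simp only [G, map_add, map_sum]
    have h1 : ∑ j, expandAt 0 (g j) ∈ regular :=
      sum_mem fun j _ => expandAt_polarParts (ht0 j).symm (hg j)
    have h2 := add_mem (add_mem h1 hgr₀) (expandAt_polarPartsInfty (b := 0) hg₁)
    convert h2 using 1
    ring
  have hG₁ : expandInfty G - (N : ℂ)⁻¹ • f₁ ∈ regular := by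
    simp only [G, map_add, map_sum]
    have h1 : ∑ j, expandInfty (g j) ∈ regular := sum_mem fun j _ => expandInfty_polarParts (hg j)
    have h2 := add_mem (add_mem h1 (expandInfty_polarParts hg₀)) hgr₁
    convert h2 using 1
    ring
  -- a series with the right transformation law is the average of its rotations
  have havg : ∀ (ω : ℂˣ) (F : ℂ⸨X⸩), scale ω F = (c : ℂ) • F →
      F = ∑ j ∈ Finset.range N, ((c⁻¹ ^ j : ℂˣ) : ℂ) • scale (ω ^ j) ((N : ℂ)⁻¹ • F) := by
    intro ω F hF
    have h : ∀ j ∈ Finset.range N,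
        ((c⁻¹ ^ j : ℂˣ) : ℂ) • scale (ω ^ j) ((N : ℂ)⁻¹ • F) = (N : ℂ)⁻¹ • F := by
      intro j _
      rw [map_smul, scale_pow_of_scale hF, smul_comm, smul_smul (_ : ℂ) (_ : ℂ) F, ← Units.val_mul,
        ← mul_pow, inv_mul_cancel, one_pow, Units.val_one, one_smul]
    rw [Finset.sum_congr rfl h, Finset.sum_const, Finset.card_range, ← Nat.cast_smul_eq_nsmul ℂ,
      smul_smul, mul_inv_cancel₀ hNC, one_smul]
  refine ⟨average N c G, rotate_average N c hc G, ?_, ?_, fun i => ?_, fun a ha hm => ?_⟩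
  · rw [havg _ f₀ hf₀, average, map_sum, ← Finset.sum_sub_distrib]
    refine sum_mem fun j _ => ?_
    rw [map_smul]
    refine smul_sub_smul_mem_regular _ ?_
    rw [← scale_expandAt, mul_zero, ← map_sub]
    exact scale_mem_regular _ hG₀
  · rw [havg _ f₁ hf₁, average, map_sum, ← Finset.sum_sub_distrib]
    refine sum_mem fun j _ => ?_
    rw [map_smul]
    refine smul_sub_smul_mem_regular _ ?_
    rw [← scale_expandInfty, ← inv_pow, ← map_sub]
    exact scale_mem_regular _ hG₁
  · rw [average, map_sum, ← Finset.add_sum_erase _ _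
      (Finset.mem_range.2 (Nat.pos_of_ne_zero (NeZero.ne N))), add_sub_right_comm]
    refine add_mem ?_ (sum_mem fun j hj => ?_)
    · simpa [rotate_one] using hGi i
    · rw [map_smul]
      refine regular.smul_mem (expandAt_rotate_regular (hG _ ?_ fun i' h => ?_)) _
      · exact mul_ne_zero (Units.ne_zero _) (ht0 i)
      · by_cases hi : i' = i
        · subst hi
          have h1 : ((eps N ^ j : ℂˣ) : ℂ) = 1 := mul_right_cancel₀ (ht0 i') (by rw [h, one_mul])
          exact (eps_isPrimitiveRoot N).pow_ne_one_of_pos_of_lt (Finset.ne_of_mem_erase hj)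
            (Finset.mem_range.1 (Finset.mem_of_mem_erase hj)) (Units.ext h1)
        · refine ht i' i hi j ?_
          rw [← h, zpow_natCast]
  · rw [average, map_sum]
    refine sum_mem fun j _ => ?_
    rw [map_smul]
    refine regular.smul_mem (expandAt_rotate_regular (hG _ ?_ fun i h => hm ⟨i, -j, ?_⟩)) _
    · exact mul_ne_zero (Units.ne_zero _) ha
    · rw [← h, ← mul_assoc, ← Units.val_mul, zpow_neg, zpow_natCast, inv_mul_cancel, Units.val_one,
        one_mul]

end Rotations

/-! ### Sections of the twisted bundle -/

section Sections

variable {N : ℕ}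

/-- The factor `ε^{b-a}` by which `Ad γ` multiplies the matrix entry `(a, b)`. -/
def entryChar (N : ℕ) (a b : Fin N) : ℂˣ := (eps N)⁻¹ ^ (a : ℕ) * eps N ^ (b : ℕ)

theorem inv_gammaMat (N : ℕ) :
    (gammaMat N)⁻¹ = Matrix.diagonal fun i : Fin N => ((eps N ^ (i : ℕ) : ℂˣ) : ℂ) := by
  refine Matrix.inv_eq_right_inv ?_
  rw [gammaMat, Matrix.diagonal_mul_diagonal, ← Matrix.diagonal_one]
  congr 1
  funext i
  rw [← Units.val_mul, ← mul_pow, inv_mul_cancel, one_pow, Units.val_one]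

theorem mem_twisted_iff {K : Type} [Field K] [Algebra ℂ K] {σ : K →ₐ[ℂ] K}
    {A : Matrix (Fin N) (Fin N) K} : A ∈ twisted N σ ↔ A.trace = 0 ∧
      ∀ a b, σ (A a b) = algebraMap ℂ K (entryChar N a b : ℂˣ) * A a b := by
  have h : constMat K (gammaMat N) * A * constMat K ((gammaMat N)⁻¹) =
      Matrix.of fun a b => algebraMap ℂ K (entryChar N a b : ℂˣ) * A a b := by
    ext a b
    rw [inv_gammaMat, gammaMat, constMat, constMat, Matrix.diagonal_map (map_zero _),
      Matrix.diagonal_map (map_zero _), Matrix.mul_diagonal, Matrix.diagonal_mul, Matrix.of_apply,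
      entryChar, Units.val_mul, map_mul]
    ring
  change A.trace = 0 ∧ A.map σ = _ ↔ _
  rw [h, ← Matrix.ext_iff]
  rfl

theorem entryChar_pow [NeZero N] (a b : Fin N) : entryChar N a b ^ N = 1 := by
  rw [entryChar, mul_pow, ← pow_mul, ← pow_mul, mul_comm _ N, mul_comm _ N, pow_mul, pow_mul,
    inv_pow, (eps_isPrimitiveRoot N).pow_eq_one]
  simp

theorem entryChar_mul (a b : Fin N) : entryChar N a b * entryChar N b a = 1 := by
  rw [entryChar, entryChar, inv_pow, inv_pow, mul_mul_mul_comm, mul_comm _ (eps N ^ (b : ℕ))⁻¹]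
  group

theorem entryChar_self (a : Fin N) : entryChar N a a = 1 := by
  rw [entryChar, inv_pow, inv_mul_cancel]

theorem entryChar_ne_one [NeZero N] {a b : Fin N} (h : a ≠ b) : (entryChar N a b : ℂ) ≠ 1 := by
  intro h1
  rw [Units.val_eq_one, entryChar, inv_pow, inv_mul_eq_one] at h1
  exact h (Fin.ext ((eps_isPrimitiveRoot N).pow_inj a.2 b.2 h1))

theorem algebraMap_mul_eq_smul (c : ℂ) (f : ℂ⸨X⸩) : algebraMap ℂ ℂ⸨X⸩ c * f = c • f := by
  rw [HahnSeries.algebraMap_apply, HahnSeries.C_mul_eq_smul]; rfl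

theorem scale_entry {ω : ℂˣ} {A : Matrix (Fin N) (Fin N) ℂ⸨X⸩} (hA : A ∈ twisted N (scale ω))
    (a b : Fin N) : scale ω (A a b) = ((entryChar N a b : ℂˣ) : ℂ) • A a b := by
  rw [(mem_twisted_iff.1 hA).2, algebraMap_mul_eq_smul]

theorem rotate_entry (f : orbSections N) (a b : Fin N) :
    rotate (eps N) (f.1 a b) = algebraMap ℂ (RatFunc ℂ) (entryChar N a b : ℂˣ) * f.1 a b :=
  (mem_twisted_iff.1 f.2).2 a b

theorem IsRegular.add {A B : Matrix (Fin N) (Fin N) ℂ⸨X⸩} (hA : IsRegular A) (hB : IsRegular B) :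
    IsRegular (A + B) := fun i j => add_mem (hA i j) (hB i j)

theorem isRegular_constMat (B : Matrix (Fin N) (Fin N) ℂ) : IsRegular (constMat ℂ⸨X⸩ B) :=
  fun _ _ => algebraMap_mem_regular _

theorem constTerm_constMat (B : Matrix (Fin N) (Fin N) ℂ) : constTerm (constMat ℂ⸨X⸩ B) = B := by
  ext i j
  change (algebraMap ℂ ℂ⸨X⸩ (B i j)).coeff 0 = B i j
  rw [algebraMap_coeff, if_pos rfl]

/-- There are sections of the twisted bundle with prescribed principal parts at the marked points,
at `0` and at `∞`. -/
theorem exists_section [NeZero N] {L : ℕ} (t : Fin L → ℂ) (ht0 : ∀ i, t i ≠ 0)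
    (ht : ∀ i j, i ≠ j → ∀ a : ℤ, t i ≠ (eps N ^ a : ℂˣ) * t j) (A₀ : loopZero N)
    (A₁ : loopInfty N) (A : Fin L → loop N) :
    ∃ f ∈ gOrb N t, IsRegular ((germZero f).1 - A₀.1) ∧ IsRegular ((germInfty f).1 - A₁.1) ∧
      ∀ i, IsRegular ((germAt (t i) f).1 - (A i).1) := by
  have hNR : (N : RatFunc ℂ) ≠ 0 := Nat.cast_ne_zero.2 (NeZero.ne N)
  choose h hrot h0 h1 hi hm using fun a b => exists_equivariant_ratFunc N t ht0 ht
    (entryChar N a b) (entryChar_pow a b) (A₀.1 a b) (A₁.1 a b) (fun i => (A i).1 a b)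
    (scale_entry A₀.2 a b) (scale_entry A₁.2 a b)
  let T : RatFunc ℂ := algebraMap ℂ (RatFunc ℂ) (N : ℂ)⁻¹ * ∑ a, h a a
  -- removing the trace part does not affect the principal parts
  let f : Matrix (Fin N) (Fin N) (RatFunc ℂ) :=
    Matrix.of fun a b => h a b - if a = b then T else 0
  have hf : f ∈ twisted N (rotate (eps N)) := by
    rw [mem_twisted_iff]
    constructor
    · have h2 : f.trace = ∑ a, h a a - N • T := by
        simp [Matrix.trace, f, Finset.sum_sub_distrib]
      rw [h2, nsmul_eq_mul]
      simp only [T]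
      rw [map_inv₀, map_natCast, ← mul_assoc, mul_inv_cancel₀ hNR, one_mul, sub_self]
    · intro a b
      have hsm : ∀ a b, rotate (eps N) (h a b) =
          algebraMap ℂ (RatFunc ℂ) (entryChar N a b : ℂˣ) * h a b := by
        intro a b
        rw [hrot, RatFunc.smul_eq_C_mul]; rfl
      change rotate (eps N) (h a b - if a = b then T else 0) = _ * (h a b - if a = b then T else 0)
      rw [map_sub, hsm, mul_sub]
      congr 1
      split_ifs with hab
      · subst hab
        rw [entryChar_self, Units.val_one, map_one, one_mul]
        simp only [T, map_mul, map_sum, AlgHom.commutes, hsm, entryChar_self, Units.val_one,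
          map_one, one_mul]
      · rw [map_zero, mul_zero]
  have hT : ∀ (φ : RatFunc ℂ →ₐ[ℂ] ℂ⸨X⸩) (B : Matrix (Fin N) (Fin N) ℂ⸨X⸩), B.trace = 0 →
      (∀ a b, φ (h a b) - B a b ∈ regular) → IsRegular (f.map φ - B) := by
    intro φ B hB hφ a b
    have hφT : φ T ∈ regular := by
      simp only [T, map_mul, map_sum, AlgHom.commutes]
      refine mul_mem (algebraMap_mem_regular _) ?_
      have h2 : ∑ a, φ (h a a) = ∑ a, (φ (h a a) - B a a) := by
        rw [Finset.sum_sub_distrib, show ∑ a, B a a = 0 from hB, sub_zero]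
      rw [h2]
      exact sum_mem fun a _ => hφ a a
    change φ (h a b - if a = b then T else 0) - B a b ∈ regular
    rw [map_sub, sub_right_comm]
    refine sub_mem (hφ a b) ?_
    split_ifs
    · exact hφT
    · rw [map_zero]; exact zero_mem _
  refine ⟨⟨f, hf⟩, fun a ha hma => ?_, hT _ _ A₀.2.1 h0, hT _ _ A₁.2.1 h1,
    fun i => hT _ _ (A i).2 fun a b => hi a b i⟩
  have h2 := hT (expandAt a) 0 (Matrix.trace_zero _ _) fun b c => by
    rw [Matrix.zero_apply, sub_zero]
    exact hm b c a ha hma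
  rwa [sub_zero] at h2

/-- The diagonal part of the constant term of an equivariant Laurent series. For a regular series
it is the whole constant term, by `constTerm_eq_constDiag`. -/
def constDiag {ω : ℂˣ} : twisted N (scale ω) →ₗ[ℂ] cartan N where
  toFun A := ⟨⟨Matrix.diagonal fun a => (A.1 a a).coeff 0, by
      have h := congrArg (fun f : ℂ⸨X⸩ => f.coeff 0) A.2.1
      simp only [Matrix.trace, Matrix.diag_apply, HahnSeries.coeff_sum] at h
      change (Matrix.diagonal fun a => (A.1 a a).coeff 0).trace = 0
      rw [Matrix.trace_diagonal]
      exact h⟩, Matrix.isDiag_diagonal _⟩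
  map_add' A B := cartanMat_injective (by
    change Matrix.diagonal (fun a => (A.1 a a + B.1 a a).coeff 0) =
      Matrix.diagonal (fun a => (A.1 a a).coeff 0) + Matrix.diagonal (fun a => (B.1 a a).coeff 0)
    rw [Matrix.diagonal_add]; rfl)
  map_smul' c A := cartanMat_injective (by
    change Matrix.diagonal (fun a => c • (A.1 a a).coeff 0) =
      c • Matrix.diagonal (fun a => (A.1 a a).coeff 0)
    rw [← Matrix.diagonal_smul]; rfl)

theorem constTerm_eq_constDiag [NeZero N] {ω : ℂˣ} (A : twisted N (scale ω)) :
    constTerm A.1 = cartanMat (constDiag A) := by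
  ext a b
  change (A.1 a b).coeff 0 = Matrix.diagonal (fun a => (A.1 a a).coeff 0) a b
  by_cases h : a = b
  · subst h; rw [Matrix.diagonal_apply_eq]
  · rw [Matrix.diagonal_apply_ne _ h]
    have h1 := congrArg (fun f : ℂ⸨X⸩ => f.coeff 0) (scale_entry A.2 a b)
    simp only [scale_coeff, zpow_zero, Units.val_one, one_mul] at h1
    have h2 : (A.1 a b).coeff 0 = (entryChar N a b : ℂ) * (A.1 a b).coeff 0 := h1
    by_contra h3
    exact entryChar_ne_one h (mul_right_cancel₀ h3 (by rw [← h2, one_mul]))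

theorem constDiag_constCartan {ω : ℂˣ} (H : cartan N) :
    constDiag (constCartan H : twisted N (scale ω)) = H := by
  refine cartanMat_injective ?_
  change Matrix.diagonal (fun a => (constMat ℂ⸨X⸩ (cartanMat H) a a).coeff 0) = cartanMat H
  have h : ∀ a, (constMat ℂ⸨X⸩ (cartanMat H) a a).coeff 0 = cartanMat H a a := fun a =>
    congrFun (congrFun (constTerm_constMat (cartanMat H)) a) a
  simp only [h]
  exact Matrix.IsDiag.diagonal_diag H.2

theorem constDiag_lie [NeZero N] {ω : ℂˣ} {A B : twisted N (scale ω)} (hA : IsRegular A.1)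
    (hB : IsRegular B.1) : constDiag ⁅A, B⁆ = 0 := by
  refine cartanMat_injective ?_
  rw [← constTerm_eq_constDiag]
  change constTerm ⁅A.1, B.1⁆ = 0
  rw [constTerm_lie hA hB, constTerm_eq_constDiag, constTerm_eq_constDiag]
  change ⁅Matrix.diagonal _, Matrix.diagonal _⁆ = 0
  rw [LieRing.of_associative_ring_bracket, Matrix.diagonal_mul_diagonal,
    Matrix.diagonal_mul_diagonal, sub_eq_zero]
  simp only [mul_comm]

theorem isPositive_sub_constDiag [NeZero N] {ω : ℂˣ} {A : twisted N (scale ω)}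
    (hA : IsRegular A.1) : IsPositive (A - constCartan (constDiag A)).1 := by
  intro a b n hn
  change (A.1 a b - constMat ℂ⸨X⸩ (cartanMat (constDiag A)) a b).coeff n = 0
  rw [HahnSeries.coeff_sub]
  obtain hn | rfl := hn.lt_or_eq
  · rw [mem_regular_iff.1 (hA a b) n hn,
      mem_regular_iff.1 (isRegular_constMat (cartanMat (constDiag A)) a b) n hn, sub_zero]
  · have h1 : (A.1 a b).coeff 0 = constTerm A.1 a b := rfl
    have h2 : (constMat ℂ⸨X⸩ (cartanMat (constDiag A)) a b).coeff 0 =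
      constTerm (constMat ℂ⸨X⸩ (cartanMat (constDiag A))) a b := rfl
    rw [h1, h2, constTerm_constMat, constTerm_eq_constDiag, sub_self]

theorem isRegular_of_isPositive {A : Matrix (Fin N) (Fin N) ℂ⸨X⸩} (hA : IsPositive A) :
    IsRegular A := fun i j => mem_regular_iff.2 fun n hn => hA i j n hn.le

/-- A traceless diagonal matrix as a constant section. -/
def constSection (H : cartan N) : orbSections N :=
  ⟨constMat (RatFunc ℂ) (cartanMat H), const_mem_twisted _ H⟩

theorem constMat_map {K K' : Type} [Field K] [Field K'] [Algebra ℂ K] [Algebra ℂ K']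
    (φ : K →ₐ[ℂ] K') (B : Matrix (Fin N) (Fin N) ℂ) : (constMat K B).map φ = constMat K' B := by
  ext i j
  simp [constMat]

theorem germZero_constSection (H : cartan N) : germZero (constSection H) = constCartan H :=
  Subtype.ext (constMat_map _ _)

theorem germInfty_constSection (H : cartan N) : germInfty (constSection H) = constCartan H :=
  Subtype.ext (constMat_map _ _)

theorem germAt_constSection (a : ℂ) (H : cartan N) :
    (germAt a (constSection H)).1 = constMat ℂ⸨X⸩ (cartanMat H) := constMat_map _ _

theorem constSection_mem_gOrb {L : ℕ} (t : Fin L → ℂ) (H : cartan N) :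
    constSection H ∈ gOrb N t := fun a _ _ => by
  rw [germAt_constSection]
  exact isRegular_constMat _

theorem isRegular_germAt_eps_mul {a : ℂ} {f : orbSections N} (h : IsRegular (germAt a f).1) :
    IsRegular (germAt (eps N * a) f).1 := by
  intro i j
  have h1 : scale (eps N) (expandAt (eps N * a) (f.1 i j)) ∈ regular := by
    rw [scale_expandAt, rotate_entry, map_mul, expandAt_algebraMap]
    exact mul_mem (algebraMap_mem_regular _) (h i j)
  have h2 := scale_mem_regular (eps N)⁻¹ h1
  rwa [scale_scale, inv_mul_cancel, scale_one] at h2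

theorem eps_zpow_eq_pow [NeZero N] (j : ℤ) : ∃ n < N, eps N ^ j = eps N ^ n := by
  have hN : (N : ℤ) ≠ 0 := Int.natCast_ne_zero.2 (NeZero.ne N)
  have h1 := Int.emod_nonneg j hN
  have h2 := Int.emod_lt_of_pos j (show (0 : ℤ) < N by have := NeZero.pos N; omega)
  refine ⟨(j % N).toNat, by omega, ?_⟩
  rw [← zpow_natCast, Int.toNat_of_nonneg h1]
  conv_lhs => rw [← Int.emod_add_mul_ediv j N, zpow_add, zpow_mul, zpow_natCast,
    (eps_isPrimitiveRoot N).pow_eq_one, one_zpow, mul_one]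

/-- A section without poles is a constant in the Cartan subalgebra. -/
theorem exists_eq_constSection [NeZero N] {L : ℕ} {t : Fin L → ℂ} {f : orbSections N}
    (hf : f ∈ gOrb N t) (h0 : IsRegular (germZero f).1) (h1 : IsRegular (germInfty f).1)
    (hi : ∀ i, IsRegular (germAt (t i) f).1) : ∃ H, f = constSection H := by
  have hall : ∀ a, IsRegular (germAt a f).1 := by
    intro a
    by_cases ha : a = 0
    · subst ha; exact h0
    by_cases hm : IsMarked N t a
    · obtain ⟨i, j, rfl⟩ := hm
      obtain ⟨n, -, hn⟩ := eps_zpow_eq_pow (N := N) j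
      rw [hn]
      clear hn ha
      induction n with
      | zero => simpa using hi i
      | succ n ih =>
        rw [pow_succ', Units.val_mul, mul_assoc]
        exact isRegular_germAt_eps_mul ih
    · exact hf a ha hm
  have hreg : ∀ a b c, expandAt c (f.1 a b) ∈ regular := fun a b c => hall c a b
  choose c hc using fun a b => eq_const_of_regular (hreg a b) (h1 a b)
  refine ⟨constDiag (germZero f), Subtype.ext (Matrix.ext fun a b => ?_)⟩
  change f.1 a b = algebraMap ℂ (RatFunc ℂ) (cartanMat (constDiag (germZero f)) a b)
  rw [← constTerm_eq_constDiag]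
  change f.1 a b = algebraMap ℂ (RatFunc ℂ) ((expandAt 0 (f.1 a b)).coeff 0)
  rw [hc, expandAt_algebraMap, algebraMap_coeff, if_pos rfl]

/-- Sections of the bundle on the degenerate curve with prescribed principal parts at the marked
points. The gluing condition `f(∞) = Ad β (f(0))` is achieved by adding a constant of the Cartan
subalgebra, since `1 - Ad β` is invertible there. -/
theorem exists_trig_section [NeZero N] {L : ℕ} (t : Fin L → ℂ) (ht0 : ∀ i, t i ≠ 0)
    (ht : ∀ i j, i ≠ j → ∀ a : ℤ, t i ≠ (eps N ^ a : ℂˣ) * t j) (A : Fin L → loop N) :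
    ∃ f ∈ gTrig N t, ∀ i, IsRegular ((germAt (t i) f).1 - (A i).1) := by
  obtain ⟨f, hf, h0, h1, hi⟩ := exists_section t ht0 ht 0 0 A
  change IsRegular ((germZero f).1 - 0) at h0
  change IsRegular ((germInfty f).1 - 0) at h1
  rw [sub_zero] at h0 h1
  let H := (oneSubAdBeta N).symm (adBeta N (constDiag (germZero f)) - constDiag (germInfty f))
  have hH : H - adBeta N H = adBeta N (constDiag (germZero f)) - constDiag (germInfty f) :=
    (oneSubAdBeta N).apply_symm_apply _
  have e0 : germZero (f + constSection H) = germZero f + constCartan H := by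
    rw [← germZero_constSection]
    exact Subtype.ext (Matrix.map_add _ (map_add _) _ _)
  have e1 : germInfty (f + constSection H) = germInfty f + constCartan H := by
    rw [← germInfty_constSection]
    exact Subtype.ext (Matrix.map_add _ (map_add _) _ _)
  have ei : ∀ a, (germAt a (f + constSection H)).1 =
      (germAt a f).1 + constMat ℂ⸨X⸩ (cartanMat H) := by
    intro a
    rw [← germAt_constSection a]
    exact Matrix.map_add _ (map_add _) _ _
  refine ⟨f + constSection H, ⟨add_mem hf (constSection_mem_gOrb t H), ?_, ?_, ?_⟩, fun i => ?_⟩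
  · rw [e0]; exact h0.add (isRegular_constMat _)
  · rw [e1]; exact h1.add (isRegular_constMat _)
  · rw [constTerm_eq_constDiag, constTerm_eq_constDiag, e0, e1, map_add, map_add,
      constDiag_constCartan, constDiag_constCartan]
    change _ = cartanMat (adBeta N (constDiag (germZero f) + H))
    rw [map_add]
    congr 1
    rw [← sub_eq_zero, ← sub_eq_zero.2 hH]
    abel
  · rw [ei, add_sub_right_comm]
    exact (hi i).add (isRegular_constMat _)

end Sections

/-! ### The residue theorem for sections -/

section Residues

variable {N : ℕ}

theorem resPairing_eq_sum (A B : Matrix (Fin N) (Fin N) ℂ⸨X⸩) :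
    resPairing A B = ∑ a, ∑ b, residue (LaurentSeries.derivative ℂ (A a b) * B b a) := by
  simp only [resPairing, Matrix.trace, Matrix.diag_apply, Matrix.mul_apply, map_sum]
  rfl

theorem derivative_scale (ω : ℂˣ) (f : ℂ⸨X⸩) :
    LaurentSeries.derivative ℂ (scale ω f) = (ω : ℂ) • scale ω (LaurentSeries.derivative ℂ f) := by
  ext n
  simp only [LaurentSeries.derivative_apply, LaurentSeries.hasseDeriv_coeff, scale_coeff,
    HahnSeries.coeff_smul, Nat.cast_one, zpow_add, zpow_one, Units.val_mul, Ring.choose_one_right]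
  simp only [zsmul_eq_mul, smul_eq_mul]
  ring

theorem residue_scale (ω : ℂˣ) (f : ℂ⸨X⸩) : (ω : ℂ) * residue (scale ω f) = residue f := by
  change (ω : ℂ) * (((ω ^ (-1 : ℤ) : ℂˣ) : ℂ) * f.coeff (-1)) = f.coeff (-1)
  rw [← mul_assoc, ← Units.val_mul, zpow_neg_one, mul_inv_cancel, Units.val_one, one_mul]

/-- The residue pairing of two sections takes the same value at all points of an orbit. -/
theorem resPairing_germAt_eps_mul (a : ℂ) (f g : orbSections N) :
    resPairing (germAt (eps N * a) f).1 (germAt (eps N * a) g).1 =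
      resPairing (germAt a f).1 (germAt a g).1 := by
  rw [resPairing_eq_sum, resPairing_eq_sum]
  refine Finset.sum_congr rfl fun i _ => Finset.sum_congr rfl fun j _ => ?_
  change residue (LaurentSeries.derivative ℂ (expandAt (eps N * a) (f.1 i j)) *
      expandAt (eps N * a) (g.1 j i)) =
    residue (LaurentSeries.derivative ℂ (expandAt a (f.1 i j)) * expandAt a (g.1 j i))
  have h : ∀ (f : orbSections N) i j, scale (eps N) (expandAt (eps N * a) (f.1 i j)) =
      (entryChar N i j : ℂ) • expandAt a (f.1 i j) := by
    intro f i j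
    rw [scale_expandAt, rotate_entry, map_mul, expandAt_algebraMap, algebraMap_mul_eq_smul]
  have hd : (eps N : ℂ) • scale (eps N) (LaurentSeries.derivative ℂ
      (expandAt (eps N * a) (f.1 i j))) =
      (entryChar N i j : ℂ) • LaurentSeries.derivative ℂ (expandAt a (f.1 i j)) := by
    rw [← derivative_scale, h]
    exact map_smul (LaurentSeries.derivative ℂ) _ _
  rw [← residue_scale (eps N), map_mul, h, ← smul_eq_mul, ← map_smul, ← smul_mul_assoc]
  have hu : (entryChar N i j : ℂ) * (entryChar N j i : ℂ) = 1 := by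
    rw [← Units.val_mul, entryChar_mul, Units.val_one]
  refine congrArg residue ?_
  refine (congrArg (· * _) hd).trans ?_
  rw [← algebraMap_mul_eq_smul, ← algebraMap_mul_eq_smul, mul_mul_mul_comm, ← map_mul, hu, map_one,
    one_mul]

/-- The residue theorem for a pair of sections of the twisted bundle, on the quotient of the
Riemann sphere by the cyclic group. -/
theorem sum_resPairing_eq_zero [NeZero N] {L : ℕ} {t : Fin L → ℂ} (ht0 : ∀ i, t i ≠ 0)
    (ht : ∀ i j, i ≠ j → ∀ a : ℤ, t i ≠ (eps N ^ a : ℂˣ) * t j) {f g : orbSections N}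
    (hf : f ∈ gOrb N t) (hg : g ∈ gOrb N t) :
    ∑ i, resPairing (germAt (t i) f).1 (germAt (t i) g).1 +
      (1 / N * resPairing (germZero f).1 (germZero g).1 +
        1 / N * resPairing (germInfty f).1 (germInfty g).1) = 0 := by
  have hNC : (N : ℂ) ≠ 0 := Nat.cast_ne_zero.2 (NeZero.ne N)
  choose f' hf' using fun a b => exists_isDerivOf (f.1 a b)
  -- `r dt` is the differential `(df | g)`; each of its residues at marked points occurs `N` times
  let r : RatFunc ℂ := ∑ a, ∑ b, f' a b * g.1 b a
  have hr : ∀ a, expandAt a r = ∑ i, ∑ j,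
      LaurentSeries.derivative ℂ ((germAt a f).1 i j) * (germAt a g).1 j i := by
    intro a
    simp only [r, map_sum, map_mul]
    refine Finset.sum_congr rfl fun i _ => Finset.sum_congr rfl fun j _ => ?_
    rw [← (hf' i j).1]; rfl
  have hres : ∀ a, resPairing (germAt a f).1 (germAt a g).1 = residue (expandAt a r) := by
    intro a
    rw [resPairing_eq_sum, hr]
    simp only [map_sum]
  have hinf : resPairing (germInfty f).1 (germInfty g).1 = -(expandInfty r).coeff 1 := by
    rw [resPairing_eq_sum, ← residue_neg_single_mul]
    simp only [r, map_sum, Finset.mul_sum, ← Finset.sum_neg_distrib]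
    refine Finset.sum_congr rfl fun i _ => Finset.sum_congr rfl fun j _ => ?_
    change residue (LaurentSeries.derivative ℂ (expandInfty (f.1 i j)) * expandInfty (g.1 j i)) = _
    rw [(hf' i j).2, map_mul expandInfty]
    refine congrArg residue ?_
    ring
  have horb : ∀ i (n : ℕ), residue (expandAt ((eps N ^ n : ℂˣ) * t i) r) =
      residue (expandAt (t i) r) := by
    intro i n
    induction n with
    | zero => simp
    | succ n ih =>
      rw [pow_succ', Units.val_mul, mul_assoc, ← hres, resPairing_germAt_eps_mul, hres, ih]
  classical
  let pt : Fin L × Fin N → ℂ := fun x => (eps N ^ (x.2 : ℕ) : ℂˣ) * t x.1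
  have hpt : Function.Injective pt := by
    rintro ⟨i, n⟩ ⟨j, m⟩ h
    have h' : ((eps N ^ (n : ℕ) : ℂˣ) : ℂ) * t i = (eps N ^ (m : ℕ) : ℂˣ) * t j := h
    by_cases hij : i = j
    · subst hij
      have h1 := Units.ext (mul_right_cancel₀ (ht0 i) h')
      rw [Fin.ext ((eps_isPrimitiveRoot N).pow_inj n.2 m.2 h1)]
    · refine absurd ?_ (ht i j hij ((m : ℤ) - n))
      rw [zpow_sub, zpow_natCast, zpow_natCast, mul_comm (eps N ^ (m : ℕ)), Units.val_mul,
        mul_assoc, ← h', ← mul_assoc, ← Units.val_mul, inv_mul_cancel, Units.val_one, one_mul]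
  let S : Finset ℂ := insert 0 (Finset.univ.image pt)
  have h0S : (0 : ℂ) ∉ Finset.univ.image pt := by
    intro h
    obtain ⟨x, -, hx⟩ := Finset.mem_image.1 h
    exact mul_ne_zero (Units.ne_zero _) (ht0 x.1) hx
  have hS : ∀ a ∉ S, expandAt a r ∈ regular := by
    intro a ha
    have ha0 : a ≠ 0 := fun h => ha (by rw [h]; exact Finset.mem_insert_self _ _)
    have ham : ¬ IsMarked N t a := by
      rintro ⟨i, j, rfl⟩
      obtain ⟨n, hn, h⟩ := eps_zpow_eq_pow (N := N) j
      refine ha (Finset.mem_insert_of_mem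
        (Finset.mem_image.2 ⟨(i, ⟨n, hn⟩), Finset.mem_univ _, ?_⟩))
      simp only [pt, h]
    rw [hr]
    exact sum_mem fun i _ => sum_mem fun j _ =>
      mul_mem (derivative_regular (hf a ha0 ham i j)) (hg a ha0 ham j i)
  have hsum := sum_residue_eq S hS
  rw [Finset.sum_insert h0S, Finset.sum_image fun x _ y _ h => hpt h, Fintype.sum_prod_type] at hsum
  simp only [pt, horb, Finset.sum_const, Finset.card_univ, Fintype.card_fin, nsmul_eq_mul] at hsum
  rw [← Finset.mul_sum] at hsum
  have hzero : resPairing (germZero f).1 (germZero g).1 = residue (expandAt 0 r) := hres 0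
  rw [hinf, hzero]
  simp only [hres]
  rw [← hsum]
  field_simp
  ring

end Residues

/-! ### Semisimplicity of the Cartan subalgebra on finite-dimensional modules -/

section SlTwo

open Module.End Polynomial

variable {W : Type*} [AddCommGroup W] [Module ℂ W] {h e f : Module.End ℂ W}

theorem isSemisimple_of_iSup_eigenspace_eq_top [FiniteDimensional ℂ W]
    (hh : ⨆ μ, h.eigenspace μ = ⊤) : h.IsSemisimple := by
  have hfin : {μ | h.HasEigenvalue μ}.Finite := Module.End.finite_hasEigenvalue h
  refine isSemisimple_of_squarefree_aeval_eq_zero (p := ∏ μ ∈ hfin.toFinset, (X - C μ))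
    (separable_prod_X_sub_C_iff'.2 fun _ _ _ _ h => h).squarefree ?_
  rw [← LinearMap.ker_eq_top, eq_top_iff, ← hh]
  refine iSup_le fun μ v hv => ?_
  by_cases h0 : v = 0
  · rw [h0]; exact zero_mem _
  · have hev : h.HasEigenvector μ v := ⟨hv, h0⟩
    rw [LinearMap.mem_ker, aeval_apply_of_hasEigenvector hev, eval_prod,
      Finset.prod_eq_zero (hfin.mem_toFinset.2 (hasEigenvalue_of_hasEigenvector hev)) (by simp),
      zero_smul]

/-- An eigenvector of `ad h` with nonzero eigenvalue is nilpotent: its powers are eigenvectors with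
distinct eigenvalues. -/
theorem exists_pow_eq_zero_of_mul_eq [FiniteDimensional ℂ W] {c : ℂ} (hc : c ≠ 0)
    (hf : h * f = f * h + c • f) : ∃ n : ℕ, f ^ n = 0 := by
  by_contra! hne
  let A : Module.End ℂ (Module.End ℂ W) := LinearMap.mulLeft ℂ h - LinearMap.mulRight ℂ h
  have hpow : ∀ n : ℕ, h * f ^ n = f ^ n * h + ((n : ℂ) * c) • f ^ n := by
    intro n
    induction n with
    | zero => simp
    | succ n ih =>
      rw [pow_succ, ← mul_assoc, ih, add_mul, mul_assoc, hf, mul_add, ← mul_assoc, smul_mul_assoc,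
        mul_smul_comm, add_assoc, ← add_smul]
      congr 2
      push_cast
      ring
  have hev : ∀ n : ℕ, A.HasEigenvector ((n : ℂ) * c) (f ^ n) := by
    intro n
    refine ⟨mem_eigenspace_iff.2 ?_, hne n⟩
    change h * f ^ n - f ^ n * h = _
    rw [hpow, add_sub_cancel_left]
  have hli := eigenvectors_linearIndependent' A (fun n : ℕ => (n : ℂ) * c)
    (fun n m hnm => by simpa [hc] using hnm) _ hev
  exact not_finite_iff_infinite.2 inferInstance hli.finite

theorem mul_pow_succ (hf : h * f = f * h + (-2 : ℂ) • f)
    (hef : e * f = f * e + h) (n : ℕ) : e * f ^ (n + 1) =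
      f ^ (n + 1) * e + ((n : ℂ) + 1) • (f ^ n * (h - (n : ℂ) • 1)) := by
  induction n with
  | zero => simp [hef]
  | succ n ih =>
    have h1 : (h - (n : ℂ) • 1) * f = f * (h - ((n : ℂ) + 2) • 1) := by
      rw [sub_mul, hf, mul_sub, smul_mul_assoc, one_mul, mul_smul_comm, mul_one, add_smul, neg_smul]
      abel
    rw [pow_succ f (n + 1), ← mul_assoc, ih, add_mul, mul_assoc, hef, smul_mul_assoc, mul_assoc, h1,
      mul_add, ← mul_assoc, ← mul_assoc, ← pow_succ, ← pow_succ, add_assoc]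
    congr 1
    simp only [mul_sub, mul_smul_comm, mul_one, smul_sub, smul_smul]
    push_cast
    module

/-- On a vector killed by `e`, the operator `eⁿ fⁿ` is `n! h (h - 1) ⋯ (h - n + 1)`. Since `f` is
nilpotent, this makes `h` semisimple on the kernel of `e`. -/
theorem pow_pow_apply (he : h * e = e * h + (2 : ℂ) • e) (hf : h * f = f * h + (-2 : ℂ) • f)
    (hef : e * f = f * e + h) (n : ℕ) : ∀ v, e v = 0 →
      (e ^ n * f ^ n) v =
        (n.factorial : ℂ) • aeval h (∏ j ∈ Finset.range n, (X - C (j : ℂ))) v := by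
  induction n with
  | zero => intro v _; simp
  | succ n ih =>
    intro v hv
    have h1 : (h - (n : ℂ) • 1) v ∈ LinearMap.ker e := by
      have h2 := LinearMap.congr_fun he v
      simp only [Module.End.mul_apply, LinearMap.add_apply, LinearMap.smul_apply, hv, map_zero,
        smul_zero, add_zero] at h2
      simp [hv, ← h2]
    have h3 : (e * f ^ (n + 1)) v = ((n : ℂ) + 1) • (f ^ n) ((h - (n : ℂ) • 1) v) := by
      rw [mul_pow_succ hf hef]
      simp [hv]
    rw [pow_succ e, mul_assoc, Module.End.mul_apply, h3, map_smul, ← Module.End.mul_apply, ih _ h1,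
      Finset.prod_range_succ, map_mul, Module.End.mul_apply, Nat.factorial_succ, smul_smul]
    have h4 : aeval h (X - C (n : ℂ)) = h - (n : ℂ) • 1 := by
      rw [map_sub, aeval_X, aeval_C, Algebra.algebraMap_eq_smul_one]
    rw [h4]
    push_cast
    rfl

/-- A generalized weight vector of weight `μ` killed by `e` is a weight vector, and `μ` is a natural
number. -/
theorem weight_of_mem_ker [FiniteDimensional ℂ W] (he : h * e = e * h + (2 : ℂ) • e)
    (hf : h * f = f * h + (-2 : ℂ) • f) (hef : e * f = f * e + h) {v : W} (hv : e v = 0)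
    (hv0 : v ≠ 0) {μ : ℂ} (hμ : v ∈ h.maxGenEigenspace μ) : h v = μ • v ∧ ∃ d : ℕ, μ = d := by
  obtain ⟨n, hn⟩ := exists_pow_eq_zero_of_mul_eq (by norm_num) hf
  let K := LinearMap.ker e
  have hK : ∀ x ∈ K, h x ∈ K := by
    intro x hx
    have hx' : e x = 0 := hx
    have h2 := LinearMap.congr_fun he x
    simp only [Module.End.mul_apply, LinearMap.add_apply, LinearMap.smul_apply, hx', map_zero,
      smul_zero, add_zero] at h2
    exact h2.symm
  let p : ℂ[X] := ∏ j ∈ Finset.range n, (X - C (j : ℂ))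
  have hp : ∀ x ∈ K, aeval h p x = 0 := by
    intro x hx
    have h1 := pow_pow_apply he hf hef n x hx
    rw [hn, mul_zero, LinearMap.zero_apply] at h1
    exact (smul_eq_zero.1 h1.symm).resolve_left (Nat.cast_ne_zero.2 n.factorial_ne_zero)
  let g : Module.End ℂ K := h.restrict hK
  have hg : aeval g p = 0 := by
    ext x
    have h1 : ∀ q : ℂ[X], ∀ x : K, ((aeval g q x : K) : W) = aeval h q x := by
      intro q
      induction q using Polynomial.induction_on with
      | C c => intro x; simp [Module.algebraMap_end_apply]
      | add q r hq hr => intro x; simp [hq, hr]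
      | monomial n c hn =>
        intro x
        rw [pow_succ, ← mul_assoc, map_mul (aeval g) (C c * X ^ n), map_mul (aeval h) (C c * X ^ n),
          Module.End.mul_apply, Module.End.mul_apply, hn, aeval_X, aeval_X]
        rfl
    rw [h1, hp x x.2]; rfl
  have hss : g.IsSemisimple := isSemisimple_of_squarefree_aeval_eq_zero
    (separable_prod_X_sub_C_iff'.2 fun i _ j _ h => by exact_mod_cast h).squarefree hg
  have hmem : (⟨v, hv⟩ : K) ∈ g.maxGenEigenspace μ := by
    rw [maxGenEigenspace, genEigenspace_restrict]
    exact hμ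
  rw [hss.isFinitelySemisimple.maxGenEigenspace_eq_eigenspace, mem_eigenspace_iff] at hmem
  have hv1 : h v = μ • v := congrArg Subtype.val hmem
  refine ⟨hv1, ?_⟩
  have hev : h.HasEigenvector μ v := ⟨mem_eigenspace_iff.2 hv1, hv0⟩
  have h1 := hp v hv
  rw [aeval_apply_of_hasEigenvector hev, smul_eq_zero, or_iff_left hv0, eval_prod,
    Finset.prod_eq_zero_iff] at h1
  obtain ⟨d, -, hd⟩ := h1
  refine ⟨d, ?_⟩
  simpa [sub_eq_zero] using hd

/-- In a finite-dimensional representation of `sl₂` the element `h` acts semisimply. On a joint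
generalized eigenspace of `h` and the Casimir operator, the vectors killed by `e` are weight vectors
of a single weight determined by the Casimir eigenvalue, and `e` is injective on the other weight
spaces. -/
theorem isSemisimple_of_slTwo [FiniteDimensional ℂ W] (he : h * e = e * h + (2 : ℂ) • e)
    (hf : h * f = f * h + (-2 : ℂ) • f) (hef : e * f = f * e + h) : h.IsSemisimple := by
  -- the Casimir operator, normalised to act by `(μ + 1)²` on vectors of weight `μ` killed by `e`
  let Ω : Module.End ℂ W := (h + 1) * (h + 1) + (4 : ℂ) • (f * e)
  have hfe : h * (f * e) = f * e * h := by
    rw [← mul_assoc, hf, add_mul, mul_assoc, he, mul_add, smul_mul_assoc, mul_smul_comm, mul_assoc,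
      add_assoc, ← add_smul]
    norm_num
  have hΩh : Commute Ω h := by
    change Ω * h = h * Ω
    simp only [Ω, add_mul, mul_add, smul_mul_assoc, mul_smul_comm, hfe, one_mul, mul_one, mul_assoc]
  have hΩe : Commute Ω e := by
    have h1 : (h + 1) * e = e * (h + (3 : ℂ) • 1) := by
      rw [add_mul, he, mul_add, one_mul, mul_smul_comm, mul_one]
      module
    have h2 : (h + 1) * (h + 1) * e = e * ((h + (3 : ℂ) • 1) * (h + (3 : ℂ) • 1)) := by
      rw [mul_assoc, h1, ← mul_assoc, h1, mul_assoc]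
    have h3 : e * (f * e) = f * e * e + e * h + (2 : ℂ) • e := by
      rw [← mul_assoc, hef, add_mul, he, add_assoc]
    change ((h + 1) * (h + 1) + (4 : ℂ) • (f * e)) * e =
      e * ((h + 1) * (h + 1) + (4 : ℂ) • (f * e))
    rw [add_mul, h2, smul_mul_assoc, mul_add e, mul_smul_comm, h3]
    simp only [mul_add, add_mul, mul_one, one_mul, smul_mul_assoc, mul_smul_comm, smul_add,
      smul_smul]
    module
  have hΩv : ∀ (v : W) (μ : ℂ), e v = 0 → h v = μ • v → Ω v = ((μ + 1) ^ 2) • v := by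
    intro v μ h1 h2
    simp only [Ω, LinearMap.add_apply, Module.End.mul_apply, LinearMap.smul_apply, h1, map_zero, h2,
      Module.End.one_apply, map_add, map_smul]
    module
  have heh : ∀ (v : W) (μ : ℂ), v ∈ h.maxGenEigenspace μ → e v ∈ h.maxGenEigenspace (μ + 2) := by
    intro v μ hv
    rw [mem_maxGenEigenspace] at hv ⊢
    obtain ⟨k, hk⟩ := hv
    have h1 : (h - (μ + 2) • (1 : Module.End ℂ W)) * e = e * (h - μ • (1 : Module.End ℂ W)) := by
      rw [sub_mul, he, mul_sub, smul_mul_assoc, mul_smul_comm, one_mul, mul_one]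
      module
    have h2 : (h - (μ + 2) • (1 : Module.End ℂ W)) ^ k * e =
        e * (h - μ • (1 : Module.End ℂ W)) ^ k := by
      have h3 : SemiconjBy e (h - μ • (1 : Module.End ℂ W)) (h - (μ + 2) • (1 : Module.End ℂ W)) :=
        h1.symm
      exact (h3.pow_right k).symm
    refine ⟨k, ?_⟩
    rw [← Module.End.mul_apply, h2, Module.End.mul_apply, hk, map_zero]
  have heΩ : ∀ (v : W) (c : ℂ), v ∈ Ω.maxGenEigenspace c → e v ∈ Ω.maxGenEigenspace c :=
    fun v c hv => mapsTo_maxGenEigenspace_of_comm hΩe c hv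
  have hprim : ∀ (v : W) (c μ : ℂ), v ≠ 0 → e v = 0 → v ∈ Ω.maxGenEigenspace c →
      v ∈ h.maxGenEigenspace μ → h v = μ • v ∧ ∃ d : ℕ, μ = d ∧ c = ((d : ℂ) + 1) ^ 2 := by
    intro v c μ hv0 hv hc hμ
    obtain ⟨h1, d, rfl⟩ := weight_of_mem_ker he hf hef hv hv0 hμ
    refine ⟨h1, d, rfl, ?_⟩
    by_contra hne
    have h2 : v ∈ Ω.maxGenEigenspace (((d : ℂ) + 1) ^ 2) :=
      eigenspace_le_genEigenspace (k := 1) one_pos |>.trans (genEigenspace_le_maximal _ _ _)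
        (mem_eigenspace_iff.2 (hΩv v d hv h1))
    exact hv0 (Submodule.disjoint_def.1 (disjoint_genEigenspace Ω hne ⊤ ⊤) v hc h2)
  have main : ∀ k : ℕ, ∀ (v : W) (c μ : ℂ), v ∈ Ω.maxGenEigenspace c → v ∈ h.maxGenEigenspace μ →
      (e ^ k) v = 0 → h v = μ • v := by
    intro k
    induction k with
    | zero => intro v c μ _ _ hv; simp_all
    | succ k ih =>
      intro v c μ hc hμ hk
      have h1 : h (e v) = (μ + 2) • e v :=
        ih (e v) c (μ + 2) (heΩ v c hc) (heh v μ hμ) (by rwa [pow_succ] at hk)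
      by_cases hev : e v = 0
      · by_cases hv0 : v = 0
        · simp [hv0]
        · exact (hprim v c μ hv0 hev hc hμ).1
      by_contra hne
      -- the defect `(h - μ) v` would be a primitive vector of weight `μ`
      let z := h v - μ • v
      have hz0 : z ≠ 0 := sub_ne_zero.2 hne
      have hez : e z = 0 := by
        have h2 := LinearMap.congr_fun he v
        simp only [Module.End.mul_apply, LinearMap.add_apply, LinearMap.smul_apply, h1] at h2
        have h3 : e (h v) = μ • e v := by
          rw [add_smul] at h2
          exact (add_right_cancel h2).symm
        simp only [z, map_sub, map_smul, h3, sub_self]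
      have hzc : z ∈ Ω.maxGenEigenspace c :=
        sub_mem (mapsTo_maxGenEigenspace_of_comm hΩh c hc) (Submodule.smul_mem _ _ hc)
      have hzμ : z ∈ h.maxGenEigenspace μ :=
        sub_mem (mapsTo_maxGenEigenspace_of_comm (Commute.refl h) μ hμ)
          (Submodule.smul_mem _ _ hμ)
      obtain ⟨-, d, hd, hcd⟩ := hprim z c μ hz0 hez hzc hzμ
      -- and the last nonzero `eʲ v` one of larger weight, with the same Casimir eigenvalue
      have hind : ∀ j : ℕ, (e ^ j) v ∈ Ω.maxGenEigenspace c ∧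
          (e ^ j) v ∈ h.maxGenEigenspace (μ + 2 * j) := by
        intro j
        induction j with
        | zero =>
          rw [pow_zero, Module.End.one_apply, Nat.cast_zero, mul_zero, add_zero]
          exact ⟨hc, hμ⟩
        | succ j ihj =>
          rw [pow_succ', Module.End.mul_apply]
          refine ⟨heΩ _ _ ihj.1, ?_⟩
          have h2 := heh _ _ ihj.2
          convert h2 using 2
          push_cast
          ring
      classical
      have hex : ∃ j : ℕ, (e ^ j) v = 0 := ⟨_, hk⟩
      have hmin := fun j => Nat.find_min hex (m := j)
      have hspec := Nat.find_spec hex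
      obtain ⟨j, hj⟩ : ∃ j, Nat.find hex = j + 2 := by
        have h0 : Nat.find hex ≠ 0 := by
          intro h0
          rw [h0] at hspec
          have : v = 0 := by simpa using hspec
          exact hev (by rw [this, map_zero])
        have h1 : Nat.find hex ≠ 1 := by
          intro h0
          rw [h0] at hspec
          exact hev (by simpa using hspec)
        exact ⟨Nat.find hex - 2, by omega⟩
      rw [hj, pow_succ', Module.End.mul_apply] at hspec
      obtain ⟨-, d', hd', hcd'⟩ := hprim _ c _ (hmin (j + 1) (by omega)) hspec (hind (j + 1)).1
        (hind (j + 1)).2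
      rw [hd] at hd'
      rw [hcd'] at hcd
      have e1 : d' = d + 2 * (j + 1) := by exact_mod_cast hd'.symm
      have e2 : (d' + 1) ^ 2 = (d + 1) ^ 2 := by exact_mod_cast hcd
      have e3 : d' + 1 = d + 1 := Nat.pow_left_injective two_ne_zero e2
      omega
  obtain ⟨n, hn⟩ := exists_pow_eq_zero_of_mul_eq (by norm_num) he
  refine isSemisimple_of_iSup_eigenspace_eq_top ?_
  have htop := iSup_iInf_maxGenEigenspace_eq_top_of_iSup_maxGenEigenspace_eq_top_of_commute
    ![Ω, h] (by
      intro i j hij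
      fin_cases i <;> fin_cases j
      · exact absurd rfl hij
      · exact hΩh
      · exact hΩh.symm
      · exact absurd rfl hij)
    (fun i => iSup_maxGenEigenspace_eq_top _)
  rw [eq_top_iff, ← htop]
  refine iSup_le fun χ => le_trans (fun v hv => ?_) (le_iSup _ (χ 1))
  rw [Submodule.mem_iInf] at hv
  exact mem_eigenspace_iff.2 (main n v (χ 0) (χ 1) (hv 0) (hv 1) (by rw [hn]; rfl))

end SlTwo

/-! ### The weight decomposition -/

section Weights

open Module.End LieAlgebra.SpecialLinear

variable {N : ℕ} {W : Type*} [AddCommGroup W] [Module ℂ W] (r : sl (Fin N) ℂ →ₗ⁅ℂ⁆ Module.End ℂ W)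
  {L : ℕ} (V : Fin L → Type u) [∀ i, AddCommGroup (V i)] [∀ i, Module ℂ (V i)]
  [∀ i, LieRingModule (sl (Fin N) ℂ) (V i)] [∀ i, LieModule ℂ (sl (Fin N) ℂ) (V i)]

theorem cartan_lie (H H' : cartan N) : ⁅H.1, H'.1⁆ = 0 := by
  apply Subtype.ext
  rw [sl_bracket]
  have h1 : Matrix.diagonal (cartanMat H).diag = H.1.1 := Matrix.IsDiag.diagonal_diag H.2
  have h2 : Matrix.diagonal (cartanMat H').diag = H'.1.1 := Matrix.IsDiag.diagonal_diag H'.2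
  rw [← h1, ← h2, Matrix.diagonal_mul_diagonal, Matrix.diagonal_mul_diagonal]
  simp only [mul_comm, sub_self]
  rfl

theorem mul_eq_of_lie {x y z : sl (Fin N) ℂ} (h : ⁅x, y⁆ = z) : r x * r y = r y * r x + r z := by
  rw [← h, LieHom.map_lie, LieRing.of_associative_ring_bracket, add_sub_cancel]

theorem commute_cartan (H H' : cartan N) : Commute (r H.1) (r H'.1) := by
  have h := mul_eq_of_lie r (cartan_lie H H')
  rwa [map_zero, add_zero] at h

theorem iSupIndep_weight :
    iSupIndep fun l : Module.Dual ℂ (cartan N) => ⨅ H : cartan N, (r H.1).eigenspace (l H) := by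
  have h := independent_iInf_maxGenEigenspace_of_forall_mapsTo (fun H : cartan N => r H.1)
    (fun H H' φ => mapsTo_maxGenEigenspace_of_comm (commute_cartan r H' H) φ)
  have h' := h.comp (f := fun l : Module.Dual ℂ (cartan N) => (l : cartan N → ℂ))
    DFunLike.coe_injective
  exact h'.mono fun l => iInf_mono fun H => genEigenspace_le_maximal _ _ _

theorem weightSpace_eq_iInf (l : Module.Dual ℂ (cartan N)) : weightSpace V l =
    ⨅ H : cartan N, (piTensorRep (fun i => LieModule.toEnd ℂ (sl (Fin N) ℂ) (V i)) H.1).eigenspace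
      (l H) := by
  ext v
  simp only [Submodule.mem_iInf, mem_eigenspace_iff]
  rfl

variable [NeZero N]

/-- The element `E_ii - E_00` of the Cartan subalgebra. -/
def coroot (i : Fin N) : cartan N :=
  ⟨singleSubSingle i 0 1, by
    intro a b hab
    simp only [val_singleSubSingle, Matrix.sub_apply, Matrix.single_apply]
    rw [if_neg (by rintro ⟨rfl, rfl⟩; exact hab rfl), if_neg (by rintro ⟨rfl, rfl⟩; exact hab rfl),
      sub_zero]⟩

theorem eq_sum_coroot (H : cartan N) : H = ∑ i, cartanMat H i i • coroot i := by
  have htr : ∑ i, cartanMat H i i = 0 := H.1.2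
  apply cartanMat_injective
  have hmap : cartanMat (∑ i, cartanMat H i i • coroot i) =
      ∑ i, cartanMat H i i • (Matrix.single i i (1 : ℂ) - Matrix.single 0 0 1) :=
    map_sum ((sl (Fin N) ℂ).toSubmodule.subtype ∘ₗ (cartan N).subtype) _ _
  rw [hmap]
  simp only [smul_sub, Finset.sum_sub_distrib]
  rw [← Finset.sum_smul, htr, zero_smul, sub_zero]
  have hd : Matrix.diagonal (cartanMat H).diag = cartanMat H := Matrix.IsDiag.diagonal_diag H.2
  ext a b
  rw [Matrix.sum_apply]
  simp only [Matrix.smul_apply, Matrix.single_apply, smul_eq_mul, mul_ite, mul_one, mul_zero]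
  by_cases hab : a = b
  · subst hab
    simp
  · rw [Finset.sum_eq_zero fun i _ => if_neg (by rintro ⟨rfl, rfl⟩; exact hab rfl)]
    exact H.2 hab

/-- `E_ii - E_00` is part of an `sl₂`-triple with `E_i0` and `E_0i`. -/
theorem isSemisimple_coroot [FiniteDimensional ℂ W] (i : Fin N) :
    (r (coroot i).1).IsSemisimple := by
  by_cases hi : i = 0
  · subst hi
    have h : coroot (0 : Fin N) = 0 := by
      apply cartanMat_injective
      exact sub_self _
    rw [h, Submodule.coe_zero, map_zero]
    exact isSemisimple_zero
  · have key : ∀ x y z : sl (Fin N) ℂ, x.1 * y.1 - y.1 * x.1 = z.1 → ⁅x, y⁆ = z :=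
      fun x y z h => Subtype.ext h
    have h0 : (0 : Fin N) ≠ i := fun h => hi h.symm
    have hc : (coroot i).1.1 = Matrix.single i i (1 : ℂ) - Matrix.single 0 0 1 := rfl
    have h1 := mul_eq_of_lie r (key (coroot i).1 (single i 0 hi 1) ((2 : ℂ) • single i 0 hi 1) (by
      change _ = (2 : ℂ) • (single i 0 hi (1 : ℂ)).1
      simp only [hc, val_single, sub_mul, mul_sub, Matrix.single_mul_single_same, mul_one,
        Matrix.single_mul_single_of_ne _ _ _ _ h0]
      module))
    have h2 := mul_eq_of_lie r (key (coroot i).1 (single 0 i h0 1) ((-2 : ℂ) • single 0 i h0 1) (by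
      change _ = (-2 : ℂ) • (single 0 i h0 (1 : ℂ)).1
      simp only [hc, val_single, sub_mul, mul_sub, Matrix.single_mul_single_same, mul_one,
        Matrix.single_mul_single_of_ne _ _ _ _ hi]
      module))
    have h3 := mul_eq_of_lie r (key (single i 0 hi 1) (single 0 i h0 1) (coroot i).1 (by
      simp only [hc, val_single, Matrix.single_mul_single_same, mul_one]))
    rw [map_smul] at h1 h2
    exact isSemisimple_of_slTwo h1 h2 h3

/-- A finite-dimensional representation is the sum of its weight spaces. -/
theorem iSup_weight_eq_top [FiniteDimensional ℂ W] :
    ⨆ l : Module.Dual ℂ (cartan N), ⨅ H : cartan N, (r H.1).eigenspace (l H) = ⊤ := by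
  have htop := iSup_iInf_maxGenEigenspace_eq_top_of_iSup_maxGenEigenspace_eq_top_of_commute
    (fun i : Fin N => r (coroot i).1) (fun i j _ => commute_cartan r _ _)
    (fun i => iSup_maxGenEigenspace_eq_top _)
  rw [eq_top_iff, ← htop]
  refine iSup_le fun χ => ?_
  let l : Module.Dual ℂ (cartan N) :=
    { toFun := fun H => ∑ i, cartanMat H i i * χ i
      map_add' := fun A B => by
        rw [← Finset.sum_add_distrib]
        exact Finset.sum_congr rfl fun i _ => add_mul (cartanMat A i i) (cartanMat B i i) (χ i)
      map_smul' := fun c A => by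
        rw [smul_eq_mul, Finset.mul_sum]
        exact Finset.sum_congr rfl fun i _ => mul_assoc c (cartanMat A i i) (χ i) }
  refine le_trans (fun v hv => ?_) (le_iSup _ l)
  rw [Submodule.mem_iInf] at hv ⊢
  have hv' : ∀ i, r (coroot i).1 v = χ i • v := by
    intro i
    have h := hv i
    rw [(isSemisimple_coroot r i).isFinitelySemisimple.maxGenEigenspace_eq_eigenspace] at h
    exact mem_eigenspace_iff.1 h
  intro H
  rw [mem_eigenspace_iff]
  have hH : (r H.1) v = ∑ i, cartanMat H i i • r (coroot i).1 v := by
    have hs : H.1 = ∑ i, cartanMat H i i • (coroot i).1 := by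
      conv_lhs => rw [eq_sum_coroot H]
      exact map_sum (cartan N).subtype _ _
    conv_lhs => rw [hs]
    simp only [map_sum, map_smul, LinearMap.sum_apply, LinearMap.smul_apply]
  rw [hH]
  simp only [hv', smul_smul, ← Finset.sum_smul]
  rfl

theorem isInternal_weightSpace [∀ i, FiniteDimensional ℂ (V i)]
    [DecidableEq (Module.Dual ℂ (cartan N))] :
    DirectSum.IsInternal fun l : Module.Dual ℂ (cartan N) => weightSpace V l := by
  rw [DirectSum.isInternal_submodule_iff_iSupIndep_and_iSup_eq_top]
  simp only [weightSpace_eq_iInf]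
  exact ⟨iSupIndep_weight _, iSup_weight_eq_top _⟩

theorem weightSum_bijective [∀ i, FiniteDimensional ℂ (V i)] :
    Function.Bijective (weightSum (N := N) V) := by
  classical
  have h := DirectSum.isInternal_ne_bot_iff.2 (isInternal_weightSpace (N := N) V)
  unfold weightSum
  convert h
  rfl

/-- The projection of `V` to the weight space `V_l` along the other weight spaces. -/
theorem exists_weight_projection [∀ i, FiniteDimensional ℂ (V i)]
    (l : Module.Dual ℂ (cartan N)) : ∃ π : (⨂[ℂ] i, V i) →ₗ[ℂ] ⨂[ℂ] i, V i,
      (∀ v ∈ weightSpace V l, π v = v) ∧ ∀ (H : cartan N) (v : ⨂[ℂ] i, V i),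
        π (tensorSum (fun i => LieModule.toEnd ℂ (sl (Fin N) ℂ) (V i) H.1) v) = l H • π v := by
  classical
  have hint := isInternal_weightSpace (N := N) V
  let e : (⨁ l : Module.Dual ℂ (cartan N), weightSpace V l) ≃ₗ[ℂ] ⨂[ℂ] i, V i :=
    LinearEquiv.ofBijective (DirectSum.coeLinearMap fun l => weightSpace V l) hint
  let π := (weightSpace V l).subtype ∘ₗ DirectSum.component ℂ _ _ l ∘ₗ e.symm.toLinearMap
  have he : ∀ m (v : weightSpace V m), e.symm v = DirectSum.lof ℂ _ _ m v := by
    intro m v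
    rw [LinearEquiv.symm_apply_eq]
    exact (DirectSum.coeLinearMap_lof _ m v).symm
  have hπ : ∀ v ∈ weightSpace V l, π v = v := by
    intro v hv
    change ((DirectSum.component ℂ _ _ l (e.symm (⟨v, hv⟩ : weightSpace V l)) : weightSpace V l) :
      ⨂[ℂ] i, V i) = v
    rw [he, DirectSum.component.lof_self]
  refine ⟨π, hπ, fun H v => ?_⟩
  have hv : v ∈ ⨆ m, weightSpace V m := hint.submodule_iSup_eq_top ▸ Submodule.mem_top
  induction hv using Submodule.iSup_induction' with
  | mem m v hv =>
    rw [hv H, map_smul]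
    by_cases hm : m = l
    · rw [hm]
    · have h0 : π v = 0 := by
        change ((DirectSum.component ℂ _ _ l (e.symm (⟨v, hv⟩ : weightSpace V m)) :
          weightSpace V l) : ⨂[ℂ] i, V i) = 0
        rw [he, DirectSum.component.of, dif_neg hm]
        rfl
      rw [h0, smul_zero, smul_zero]
  | zero => simp only [map_zero, smul_zero]
  | add x y _ _ hx hy => simp only [map_add, smul_add, hx, hy]

end Weights

/-! ### The affine Lie algebra of all insertion points -/

section GlobalAffine

variable {N L : ℕ}

section Affine

variable {𝔏 : LieSubalgebra ℂ (Matrix (Fin N) (Fin N) ℂ⸨X⸩)} {c : ℂ}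

theorem Affine.ext {x y : Affine 𝔏 c} (h : x.toLoop = y.toLoop) (h' : x.level = y.level) :
    x = y :=
  congrArg (LieAlgebra.ofProd _) (Prod.ext h h' : x.carrier = y.carrier)

theorem Affine.toLoop_lie (x y : Affine 𝔏 c) : ⁅x, y⁆.toLoop = ⁅x.toLoop, y.toLoop⁆ :=
  congrArg Affine.toLoop (Affine.mk_lie_mk x.toLoop y.toLoop x.level y.level)

theorem Affine.level_lie (x y : Affine 𝔏 c) :
    ⁅x, y⁆.level = c * resPairing x.toLoop.1 y.toLoop.1 :=
  congrArg Affine.level (Affine.mk_lie_mk x.toLoop y.toLoop x.level y.level)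

end Affine

section Pi

variable {ι : Type*} {𝔤 : ι → Type*} [∀ i, LieRing (𝔤 i)]

/-- The product of a family of Lie rings, with the componentwise bracket. -/
instance piLieRing : LieRing (∀ i, 𝔤 i) where
  bracket x y i := ⁅x i, y i⁆
  add_lie x y z := funext fun i => add_lie (x i) (y i) (z i)
  lie_add x y z := funext fun i => lie_add (x i) (y i) (z i)
  lie_self x := funext fun i => lie_self (x i)
  leibniz_lie x y z := funext fun i => leibniz_lie (x i) (y i) (z i)

/-- The product of a family of Lie algebras. -/
instance piLieAlgebra [∀ i, LieAlgebra ℂ (𝔤 i)] : LieAlgebra ℂ (∀ i, 𝔤 i) where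
  lie_smul c x y := funext fun i => lie_smul c (x i) (y i)

end Pi

section Sum

variable {𝔭 𝔮 𝔯 : Type*} [LieRing 𝔭] [LieAlgebra ℂ 𝔭] [LieRing 𝔮] [LieAlgebra ℂ 𝔮] [LieRing 𝔯]
  [LieAlgebra ℂ 𝔯] {L : ℕ}

/-- The inclusion of a Lie algebra as the `i`-th factor of a power of it. -/
def piSingle (i : Fin L) : 𝔮 →ₗ⁅ℂ⁆ (Fin L → 𝔮) where
  __ := LinearMap.single ℂ (fun _ => 𝔮) i
  map_lie' {x y} := by
    funext j
    change (Pi.single i ⁅x, y⁆ : Fin L → 𝔮) j =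
      ⁅(Pi.single i x : Fin L → 𝔮) j, (Pi.single i y : Fin L → 𝔮) j⁆
    by_cases h : j = i
    · subst h; simp only [Pi.single_eq_same]
    · simp only [Pi.single_eq_of_ne h, lie_zero]

/-- The inclusion of the first summand, here the affine Lie algebra at `0`. -/
def embZero : 𝔭 →ₗ⁅ℂ⁆ 𝔭 × (Fin L → 𝔮) × 𝔯 := LieHom.inl ℂ _ _

/-- The inclusion of the affine Lie algebra at the `i`-th marked point. -/
def embAt (i : Fin L) : 𝔮 →ₗ⁅ℂ⁆ 𝔭 × (Fin L → 𝔮) × 𝔯 :=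
  (LieHom.inr ℂ 𝔭 ((Fin L → 𝔮) × 𝔯)).comp ((LieHom.inl ℂ (Fin L → 𝔮) 𝔯).comp (piSingle i))

/-- The inclusion of the last summand, here the affine Lie algebra at `∞`. -/
def embInfty : 𝔯 →ₗ⁅ℂ⁆ 𝔭 × (Fin L → 𝔮) × 𝔯 :=
  (LieHom.inr ℂ 𝔭 ((Fin L → 𝔮) × 𝔯)).comp (LieHom.inr ℂ (Fin L → 𝔮) 𝔯)

theorem eq_sum_emb (x : 𝔭 × (Fin L → 𝔮) × 𝔯) :
    x = embZero x.1 + ∑ i, embAt i (x.2.1 i) + embInfty x.2.2 := by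
  have h : ∑ i, (embAt i (x.2.1 i) : 𝔭 × (Fin L → 𝔮) × 𝔯) = (0, x.2.1, 0) := by
    have h1 : ∑ i, (embAt i (x.2.1 i) : 𝔭 × (Fin L → 𝔮) × 𝔯) =
        (LinearMap.inr ℂ 𝔭 ((Fin L → 𝔮) × 𝔯) ∘ₗ LinearMap.inl ℂ (Fin L → 𝔮) 𝔯)
          (∑ i, Pi.single i (x.2.1 i)) :=
      (map_sum (LinearMap.inr ℂ 𝔭 ((Fin L → 𝔮) × 𝔯) ∘ₗ LinearMap.inl ℂ (Fin L → 𝔮) 𝔯)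
        (fun i => Pi.single i (x.2.1 i)) Finset.univ).symm
    rw [h1, Finset.univ_sum_single]
    rfl
  rw [h]
  refine Prod.ext ?_ (Prod.ext ?_ ?_)
  · change x.1 = x.1 + 0 + 0
    rw [add_zero, add_zero]
  · change x.2.1 = 0 + x.2.1 + 0
    rw [zero_add, add_zero]
  · change x.2.2 = 0 + 0 + x.2.2
    rw [zero_add, zero_add]

theorem apply_eq_sum_emb {X : Type*} [AddCommGroup X] [Module ℂ X]
    (R : 𝔭 × (Fin L → 𝔮) × 𝔯 →ₗ⁅ℂ⁆ Module.End ℂ X) (x : 𝔭 × (Fin L → 𝔮) × 𝔯) (F : X) :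
    R x F = R (embZero x.1) F + ∑ i, R (embAt i (x.2.1 i)) F + R (embInfty x.2.2) F := by
  conv_lhs => rw [eq_sum_emb x]
  simp only [map_add, map_sum, LinearMap.add_apply, LinearMap.sum_apply]

theorem embAt_lie_embAt {i j : Fin L} (h : i ≠ j) (x y : 𝔮) :
    ⁅(embAt i x : 𝔭 × (Fin L → 𝔮) × 𝔯), (embAt j y : 𝔭 × (Fin L → 𝔮) × 𝔯)⁆ = 0 := by
  refine Prod.ext (lie_zero (0 : 𝔭)) (Prod.ext (funext fun a => ?_) (lie_zero (0 : 𝔯)))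
  change ⁅(Pi.single i x : Fin L → 𝔮) a, (Pi.single j y : Fin L → 𝔮) a⁆ = 0
  by_cases ha : a = i
  · subst ha; rw [Pi.single_eq_of_ne h, lie_zero]
  · rw [Pi.single_eq_of_ne ha, zero_lie]

theorem embZero_lie_embAt (i : Fin L) (x : 𝔭) (y : 𝔮) :
    ⁅(embZero x : 𝔭 × (Fin L → 𝔮) × 𝔯), (embAt i y : 𝔭 × (Fin L → 𝔮) × 𝔯)⁆ = 0 :=
  Prod.ext (lie_zero x) (zero_lie ((piSingle i y, 0) : (Fin L → 𝔮) × 𝔯))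

theorem embInfty_lie_embAt (i : Fin L) (x : 𝔯) (y : 𝔮) :
    ⁅(embInfty x : 𝔭 × (Fin L → 𝔮) × 𝔯), (embAt i y : 𝔭 × (Fin L → 𝔮) × 𝔯)⁆ = 0 :=
  Prod.ext (lie_zero (0 : 𝔭)) (Prod.ext (zero_lie (piSingle i y)) (lie_zero x))

theorem embZero_lie_embInfty (x : 𝔭) (y : 𝔯) :
    ⁅(embZero x : 𝔭 × (Fin L → 𝔮) × 𝔯), (embInfty y : 𝔭 × (Fin L → 𝔮) × 𝔯)⁆ = 0 :=
  Prod.ext (lie_zero x) (zero_lie ((0, y) : (Fin L → 𝔮) × 𝔯))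

end Sum

/-- The sum of the affine Lie algebras at `0`, at the marked points and at `∞`, each with its own
central element. -/
def GlobalAffine (N L : ℕ) : Type := AffineZero N × (Fin L → AffineAt N) × AffineInfty N

instance : LieRing (GlobalAffine N L) :=
  inferInstanceAs (LieRing (AffineZero N × (Fin L → AffineAt N) × AffineInfty N))

instance : LieAlgebra ℂ (GlobalAffine N L) :=
  inferInstanceAs (LieAlgebra ℂ (AffineZero N × (Fin L → AffineAt N) × AffineInfty N))

/-- The elements of the global affine Lie algebra without polar parts. -/
def regularPart (N L : ℕ) : LieSubalgebra ℂ (GlobalAffine N L) where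
  carrier := {x | IsRegular x.1.toLoop.1 ∧ (∀ i, IsRegular (x.2.1 i).toLoop.1) ∧
    IsRegular x.2.2.toLoop.1}
  add_mem' hx hy := ⟨hx.1.add hy.1, fun i => (hx.2.1 i).add (hy.2.1 i), hx.2.2.add hy.2.2⟩
  zero_mem' := ⟨fun _ _ => zero_mem _, fun _ _ _ => zero_mem _, fun _ _ => zero_mem _⟩
  smul_mem' c _ hx := ⟨fun i j => Subalgebra.smul_mem _ (hx.1 i j) c,
    fun a i j => Subalgebra.smul_mem _ (hx.2.1 a i j) c,
    fun i j => Subalgebra.smul_mem _ (hx.2.2 i j) c⟩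
  lie_mem' hx hy := ⟨hx.1.lie hy.1, fun i => (hx.2.1 i).lie (hy.2.1 i), hx.2.2.lie hy.2.2⟩

/-- The germs of a section at all insertion points, with zero central components. -/
def sectionElt (t : Fin L → ℂ) (f : orbSections N) : GlobalAffine N L :=
  (Affine.mk (germZero f) 0, fun i => Affine.mk (germAt (t i) f) 0, Affine.mk (germInfty f) 0)

/-- The families of germs of a section of the twisted bundle, with central parts adding up to
zero. They are closed under the bracket by the residue theorem. -/
def globalSections [NeZero N] {t : Fin L → ℂ} (ht0 : ∀ i, t i ≠ 0)
    (ht : ∀ i j, i ≠ j → ∀ a : ℤ, t i ≠ (eps N ^ a : ℂˣ) * t j) :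
    LieSubalgebra ℂ (GlobalAffine N L) where
  carrier := {x | (∃ f ∈ gOrb N t, x.1.toLoop = germZero f ∧
      (∀ i, (x.2.1 i).toLoop = germAt (t i) f) ∧ x.2.2.toLoop = germInfty f) ∧
    ∑ i, (x.2.1 i).level + (x.1.level + x.2.2.level) = 0}
  add_mem' := by
    rintro x y ⟨⟨f, hf, h0, hi, h1⟩, hx⟩ ⟨⟨g, hg, k0, ki, k1⟩, hy⟩
    refine ⟨⟨f + g, add_mem hf hg, ?_, fun i => ?_, ?_⟩, ?_⟩
    · change x.1.toLoop + y.1.toLoop = _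
      rw [h0, k0]
      exact Subtype.ext (Matrix.map_add _ (map_add _) _ _).symm
    · change (x.2.1 i).toLoop + (y.2.1 i).toLoop = _
      rw [hi, ki]
      exact Subtype.ext (Matrix.map_add _ (map_add _) _ _).symm
    · change x.2.2.toLoop + y.2.2.toLoop = _
      rw [h1, k1]
      exact Subtype.ext (Matrix.map_add _ (map_add _) _ _).symm
    · change ∑ i, ((x.2.1 i).level + (y.2.1 i).level) +
        ((x.1.level + y.1.level) + (x.2.2.level + y.2.2.level)) = 0
      rw [Finset.sum_add_distrib]
      linear_combination hx + hy
  zero_mem' := by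
    refine ⟨⟨0, zero_mem _, ?_, fun i => ?_, ?_⟩, ?_⟩
    · exact Subtype.ext (Matrix.map_zero _ (map_zero _)).symm
    · exact Subtype.ext (Matrix.map_zero _ (map_zero _)).symm
    · exact Subtype.ext (Matrix.map_zero _ (map_zero _)).symm
    · change ∑ _ : Fin L, (0 : ℂ) + (0 + 0) = 0
      simp
  smul_mem' := by
    rintro c x ⟨⟨f, hf, h0, hi, h1⟩, hx⟩
    refine ⟨⟨c • f, (gOrb N t).smul_mem c hf, ?_, fun i => ?_, ?_⟩, ?_⟩
    · change c • x.1.toLoop = _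
      rw [h0]
      exact Subtype.ext (Matrix.map_smul _ _ (fun a => map_smul _ c a) _).symm
    · change c • (x.2.1 i).toLoop = _
      rw [hi]
      exact Subtype.ext (Matrix.map_smul _ _ (fun a => map_smul _ c a) _).symm
    · change c • x.2.2.toLoop = _
      rw [h1]
      exact Subtype.ext (Matrix.map_smul _ _ (fun a => map_smul _ c a) _).symm
    · change ∑ i, c * (x.2.1 i).level + (c * x.1.level + c * x.2.2.level) = 0
      rw [← Finset.mul_sum]
      linear_combination c * hx
  lie_mem' := by
    rintro x y ⟨⟨f, hf, h0, hi, h1⟩, -⟩ ⟨⟨g, hg, k0, ki, k1⟩, -⟩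
    refine ⟨⟨⁅f, g⁆, (gOrb N t).lie_mem hf hg, ?_, fun i => ?_, ?_⟩, ?_⟩
    · refine (Affine.toLoop_lie x.1 y.1).trans ?_
      rw [h0, k0]
      exact Subtype.ext (map_lie _ _ _).symm
    · refine (Affine.toLoop_lie (x.2.1 i) (y.2.1 i)).trans ?_
      rw [hi, ki]
      exact Subtype.ext (map_lie _ _ _).symm
    · refine (Affine.toLoop_lie x.2.2 y.2.2).trans ?_
      rw [h1, k1]
      exact Subtype.ext (map_lie _ _ _).symm
    · change ∑ i, ⁅x.2.1 i, y.2.1 i⁆.level + (⁅x.1, y.1⁆.level + ⁅x.2.2, y.2.2⁆.level) = 0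
      simp only [Affine.level_lie, h0, k0, h1, k1, hi, ki, one_mul]
      exact sum_resPairing_eq_zero ht0 ht hf hg

theorem sectionElt_mem [NeZero N] {t : Fin L → ℂ} (ht0 : ∀ i, t i ≠ 0)
    (ht : ∀ i j, i ≠ j → ∀ a : ℤ, t i ≠ (eps N ^ a : ℂˣ) * t j) {f : orbSections N}
    (hf : f ∈ gOrb N t) : sectionElt t f ∈ globalSections ht0 ht := by
  refine ⟨⟨f, hf, rfl, fun _ => rfl, rfl⟩, ?_⟩
  change ∑ _ : Fin L, (0 : ℂ) + (0 + 0) = 0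
  simp

theorem exists_sub_sectionElt_mem [NeZero N] {t : Fin L → ℂ} (ht0 : ∀ i, t i ≠ 0)
    (ht : ∀ i j, i ≠ j → ∀ a : ℤ, t i ≠ (eps N ^ a : ℂˣ) * t j) (x : GlobalAffine N L) :
    ∃ f ∈ gOrb N t, x - sectionElt t f ∈ regularPart N L := by
  obtain ⟨f, hf, h0, h1, hi⟩ :=
    exists_section t ht0 ht x.1.toLoop x.2.2.toLoop fun i => (x.2.1 i).toLoop
  refine ⟨f, hf, ?_⟩
  rw [← neg_sub]
  exact neg_mem (show sectionElt t f - x ∈ regularPart N L from ⟨h0, hi, h1⟩)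

/-- If a subspace `𝔠` surjects onto the quotient by `𝔟`, there is a projection to `𝔟` along a
subspace of `𝔠`. -/
theorem exists_projection {E : Type*} [AddCommGroup E] [Module ℂ E] (𝔟 𝔠 : Submodule ℂ E)
    (h : ∀ x, ∃ c ∈ 𝔠, x - c ∈ 𝔟) :
    ∃ p : E →ₗ[ℂ] 𝔟, (∀ b : 𝔟, p b = b) ∧ ∀ x, x - p x ∈ 𝔠 := by
  have hsurj : LinearMap.range (𝔟.mkQ ∘ₗ 𝔠.subtype) = ⊤ := by
    rw [LinearMap.range_eq_top]
    intro q
    obtain ⟨x, rfl⟩ := 𝔟.mkQ_surjective q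
    obtain ⟨c, hc, hx⟩ := h x
    exact ⟨⟨c, hc⟩, ((Submodule.Quotient.eq 𝔟).2 hx).symm⟩
  obtain ⟨s, hs⟩ := (𝔟.mkQ ∘ₗ 𝔠.subtype).exists_rightInverse_of_surjective hsurj
  have hmem : ∀ x, x - (s (𝔟.mkQ x) : E) ∈ 𝔟 := by
    intro x
    rw [← Submodule.Quotient.eq]
    exact (LinearMap.congr_fun hs (𝔟.mkQ x)).symm
  refine ⟨(LinearMap.id - 𝔠.subtype ∘ₗ s ∘ₗ 𝔟.mkQ).codRestrict 𝔟 hmem, fun b => ?_, fun x => ?_⟩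
  · refine Subtype.ext ?_
    change (b : E) - (s (𝔟.mkQ b) : E) = b
    rw [Submodule.mkQ_apply, (Submodule.Quotient.mk_eq_zero 𝔟).2 b.2, map_zero,
      Submodule.coe_zero, sub_zero]
  · change x - (x - (s (𝔟.mkQ x) : E)) ∈ 𝔠
    rw [sub_sub_cancel]
    exact (s (𝔟.mkQ x)).2

theorem apply_comm_of_lie_eq_zero {𝔞 X : Type*} [LieRing 𝔞] [LieAlgebra ℂ 𝔞] [AddCommGroup X]
    [Module ℂ X] (R : 𝔞 →ₗ⁅ℂ⁆ Module.End ℂ X) {x y : 𝔞} (h : ⁅x, y⁆ = 0) (F : X) :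
    R x (R y F) = R y (R x F) := by
  have h1 := LinearMap.congr_fun (R.map_lie x y) F
  rw [h, map_zero, LieRing.of_associative_ring_bracket] at h1
  exact sub_eq_zero.1 h1.symm

end GlobalAffine

/-! ### Highest weight vectors -/

section HighestWeight

variable {N L : ℕ} {ω : ℂˣ} {c : ℂ} (k : ℂ) (l : Module.Dual ℂ (cartan N))

/-- The linear form by which the regular part of the twisted affine algebra acts on the highest
weight vector of a Verma module. -/
def vermaChar : Affine (twisted N (scale ω)) c →ₗ[ℂ] ℂ where
  toFun x := l (constDiag x.toLoop) + k * x.level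
  map_add' x y := by
    have h1 : (x + y).toLoop = x.toLoop + y.toLoop := rfl
    have h2 : (x + y).level = x.level + y.level := rfl
    rw [h1, h2, map_add, map_add]
    ring
  map_smul' a x := by
    have h1 : (a • x).toLoop = a • x.toLoop := rfl
    have h2 : (a • x).level = a * x.level := rfl
    rw [h1, h2, map_smul, map_smul, RingHom.id_apply, smul_eq_mul, smul_eq_mul]
    ring

theorem vermaChar_mk (A : twisted N (scale ω)) (s : ℂ) :
    vermaChar k l (Affine.mk A s : Affine (twisted N (scale ω)) c) = l (constDiag A) + k * s := rfl

theorem vermaChar_lie [NeZero N] {x y : Affine (twisted N (scale ω)) c}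
    (hx : IsRegular x.toLoop.1) (hy : IsRegular y.toLoop.1) : vermaChar k l ⁅x, y⁆ = 0 := by
  change l (constDiag ⁅x, y⁆.toLoop) + k * ⁅x, y⁆.level = 0
  rw [Affine.toLoop_lie, Affine.level_lie, constDiag_lie hx hy, resPairing_regular hx hy, map_zero,
    mul_zero, mul_zero, add_zero]

/-- The generators of the left ideal defining the Verma module. -/
def vermaGenerators (ω : ℂˣ) (c k : ℂ) (l : Module.Dual ℂ (cartan N)) :
    Set (UniversalEnvelopingAlgebra ℂ (Affine (twisted N (scale ω)) c)) :=
  {y | ∃ A : twisted N (scale ω), IsPositive A.1 ∧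
      y = UniversalEnvelopingAlgebra.ι ℂ (Affine.mk A 0)} ∪
    {y | ∃ H : cartan N, y = UniversalEnvelopingAlgebra.ι ℂ (Affine.mk (constCartan H) 0) -
      algebraMap ℂ _ (l H)} ∪
    {UniversalEnvelopingAlgebra.ι ℂ (Affine.mk 0 1) - algebraMap ℂ _ k}

/-- A vector on which the regular part acts by the character `vermaChar` satisfies the defining
relations of the Verma module. -/
theorem mem_killedBy_vermaGenerators {X : Type*} [AddCommGroup X] [Module ℂ X]
    {r : Affine (twisted N (scale ω)) c →ₗ⁅ℂ⁆ Module.End ℂ X} {F : X}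
    (h : ∀ x, IsRegular x.toLoop.1 → r x F = vermaChar k l x • F) :
    F ∈ killedBy r (vermaGenerators ω c k l) := by
  rintro y ((⟨A, hA, rfl⟩ | ⟨H, rfl⟩) | rfl)
  · rw [UniversalEnvelopingAlgebra.lift_ι_apply, h (Affine.mk A 0) (isRegular_of_isPositive hA),
      vermaChar_mk]
    have h0 : constDiag A = 0 := by
      refine cartanMat_injective (Matrix.ext fun a b => ?_)
      change Matrix.diagonal (fun a => (A.1 a a).coeff 0) a b = 0
      by_cases hab : a = b
      · subst hab; rw [Matrix.diagonal_apply_eq, hA a a 0 le_rfl]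
      · rw [Matrix.diagonal_apply_ne _ hab]
    rw [h0, map_zero, mul_zero, add_zero, zero_smul]
  · rw [map_sub, UniversalEnvelopingAlgebra.lift_ι_apply, AlgHom.commutes, LinearMap.sub_apply,
      h (Affine.mk (constCartan H) 0) (isRegular_constMat _), vermaChar_mk, constDiag_constCartan,
      mul_zero, add_zero, Module.algebraMap_end_apply, sub_self]
  · rw [map_sub, UniversalEnvelopingAlgebra.lift_ι_apply, AlgHom.commutes, LinearMap.sub_apply,
      h (Affine.mk 0 1) (fun _ _ => zero_mem _), vermaChar_mk, map_zero, map_zero, zero_add,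
      mul_one, Module.algebraMap_end_apply, sub_self]

theorem lie_vac [NeZero N] {x : Affine (twisted N (scale ω)) c} (hx : IsRegular x.toLoop.1) :
    ⁅x, Cyclic.vac (vermaIdeal ω c k l)⁆ = vermaChar k l x • Cyclic.vac (vermaIdeal ω c k l) := by
  have key : ∀ u ∈ vermaGenerators ω c k l, u • Cyclic.vac (vermaIdeal ω c k l) = 0 :=
    fun u hu => Cyclic.smul_vac_eq_zero _ (Submodule.subset_span hu)
  have h1 := key _ (Or.inl (Or.inl ⟨_, isPositive_sub_constDiag hx, rfl⟩))
  have h2 := key _ (Or.inl (Or.inr ⟨constDiag x.toLoop, rfl⟩))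
  have h3 := key _ (Or.inr rfl)
  rw [sub_smul, sub_eq_zero, algebraMap_smul] at h2 h3
  have hdec : x = Affine.mk (x.toLoop - constCartan (constDiag x.toLoop)) 0 +
      Affine.mk (constCartan (constDiag x.toLoop)) 0 + x.level • Affine.mk 0 1 := by
    refine Affine.ext ?_ ?_
    · change x.toLoop = x.toLoop - constCartan (constDiag x.toLoop) +
        constCartan (constDiag x.toLoop) + x.level • (0 : twisted N (scale ω))
      rw [smul_zero, add_zero, sub_add_cancel]
    · change x.level = 0 + 0 + x.level * 1
      rw [mul_one, zero_add, zero_add]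
  change UniversalEnvelopingAlgebra.ι ℂ x • _ = _
  rw [hdec, map_add, map_add, map_smul, add_smul, add_smul, h1, h2, smul_assoc, h3, zero_add,
    smul_smul, ← add_smul, ← hdec]
  congr 1
  change _ = l (constDiag x.toLoop) + k * x.level
  ring

end HighestWeight

/-! ### Extension of equivariant maps to the product of Verma and Weyl modules -/

section Extension

/-- An intertwining operator `e` commuting with the action maps extensions to extensions. -/
theorem Cyclic.lift_comm {𝔞 : Type*} [LieRing 𝔞] [LieAlgebra ℂ 𝔞] {X : Type*} [AddCommGroup X]
    [Module ℂ X] (r : 𝔞 →ₗ⁅ℂ⁆ Module.End ℂ X) {e : Module.End ℂ X}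
    (he : ∀ x y, r x (e y) = e (r x y)) (G : Set (UniversalEnvelopingAlgebra ℂ 𝔞))
    {y z : killedBy r G} (hz : (z : X) = e y)
    (m : Cyclic (Submodule.span (UniversalEnvelopingAlgebra ℂ 𝔞) G)) :
    Cyclic.lift r G z m = e (Cyclic.lift r G y m) := by
  obtain ⟨u, rfl⟩ := Submodule.Quotient.mk_surjective _ m
  change UniversalEnvelopingAlgebra.lift ℂ r u z.1 = e (UniversalEnvelopingAlgebra.lift ℂ r u y.1)
  rw [hz, lift_apply_comm r he]

theorem lift_flip_map {P M Q X : Type*} [AddCommGroup P] [Module ℂ P] [AddCommGroup M] [Module ℂ M]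
    [AddCommGroup Q] [Module ℂ Q] [AddCommGroup X] [Module ℂ X] (D : M ⊗[ℂ] Q →ₗ[ℂ] P →ₗ[ℂ] X)
    (a : Module.End ℂ P) (b : Module.End ℂ M) (c : Module.End ℂ Q) (q : P) (m : M) (u : Q) :
    TensorProduct.lift D.flip ((TensorProduct.map a LinearMap.id +
      TensorProduct.map LinearMap.id (TensorProduct.map b LinearMap.id) +
      TensorProduct.map LinearMap.id (TensorProduct.map LinearMap.id c) :
        Module.End ℂ (P ⊗[ℂ] (M ⊗[ℂ] Q))) (q ⊗ₜ (m ⊗ₜ u))) =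
    D (m ⊗ₜ u) (a q) + D (b m ⊗ₜ u) q + D (m ⊗ₜ c u) q := by
  simp only [LinearMap.add_apply, TensorProduct.map_tmul, map_add, TensorProduct.lift.tmul,
    LinearMap.flip_apply, LinearMap.id_apply]

variable {N L : ℕ} (t : Fin L → ℂ) (k : ℂ) (V : Fin L → Type u)
  [∀ i, AddCommGroup (V i)] [∀ i, Module ℂ (V i)]
  [∀ i, LieRingModule (LieAlgebra.SpecialLinear.sl (Fin N) ℂ) (V i)]
  [∀ i, LieModule ℂ (LieAlgebra.SpecialLinear.sl (Fin N) ℂ) (V i)]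
  (l₀ l₁ : Module.Dual ℂ (cartan N))

/-- The component at the `i`-th marked point of the regular part. -/
def regularAt (i : Fin L) : regularPart N L →ₗ⁅ℂ⁆ affinePlus N where
  toFun x := ⟨x.1.2.1 i, x.2.2.1 i⟩
  map_add' _ _ := rfl
  map_smul' _ _ := rfl
  map_lie' := rfl

theorem embZero_mem_regularPart {x : AffineZero N} (hx : IsRegular x.toLoop.1) :
    (embZero x : GlobalAffine N L) ∈ regularPart N L :=
  ⟨hx, fun _ _ _ => zero_mem _, fun _ _ => zero_mem _⟩

theorem embInfty_mem_regularPart {x : AffineInfty N} (hx : IsRegular x.toLoop.1) :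
    (embInfty x : GlobalAffine N L) ∈ regularPart N L :=
  ⟨fun _ _ => zero_mem _, fun _ _ _ => zero_mem _, hx⟩

theorem embAt_mem_regularPart (i : Fin L) (b : affinePlus N) :
    (embAt i b.1 : GlobalAffine N L) ∈ regularPart N L := by
  refine ⟨fun _ _ => zero_mem _, fun j => ?_, fun _ _ => zero_mem _⟩
  change IsRegular ((Pi.single i b.1 : Fin L → AffineAt N) j).toLoop.1
  by_cases h : j = i
  · subst h; rw [Pi.single_eq_same]; exact b.2
  · rw [Pi.single_eq_of_ne h]; exact fun _ _ => zero_mem _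

variable [NeZero N]

/-- The action of the regular part on `V`, twisted by the characters of the highest weight vectors
at `0` and `∞`. -/
def regularRep : regularPart N L →ₗ⁅ℂ⁆ Module.End ℂ (⨂[ℂ] i, V i) where
  toFun x := piTensorRep (fun i => (evalRep (N := N) k (V i)).comp (regularAt i)) x +
    (vermaChar k l₀ x.1.1 + vermaChar k l₁ x.1.2.2) • LinearMap.id
  map_add' x y := by
    have h0 : vermaChar k l₀ (x + y).1.1 = vermaChar k l₀ x.1.1 + vermaChar k l₀ y.1.1 :=
      map_add (vermaChar k l₀) x.1.1 y.1.1
    have h1 : vermaChar k l₁ (x + y).1.2.2 = vermaChar k l₁ x.1.2.2 + vermaChar k l₁ y.1.2.2 :=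
      map_add (vermaChar k l₁) x.1.2.2 y.1.2.2
    rw [map_add, h0, h1]
    module
  map_smul' c x := by
    have h0 : vermaChar k l₀ (c • x).1.1 = c * vermaChar k l₀ x.1.1 :=
      map_smul (vermaChar k l₀) c x.1.1
    have h1 : vermaChar k l₁ (c • x).1.2.2 = c * vermaChar k l₁ x.1.2.2 :=
      map_smul (vermaChar k l₁) c x.1.2.2
    rw [map_smul, h0, h1, RingHom.id_apply]
    module
  map_lie' {x y} := by
    have h0 : vermaChar k l₀ (⁅x, y⁆ : regularPart N L).1.1 = 0 := vermaChar_lie k l₀ x.2.1 y.2.1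
    have h1 : vermaChar k l₁ (⁅x, y⁆ : regularPart N L).1.2.2 = 0 :=
      vermaChar_lie k l₁ x.2.2.2 y.2.2.2
    rw [h0, h1, LieHom.map_lie, LieRing.of_associative_ring_bracket,
      LieRing.of_associative_ring_bracket]
    ext v
    simp only [LinearMap.compMultilinearMap_apply, LinearMap.sub_apply, Module.End.mul_apply,
      LinearMap.add_apply, LinearMap.smul_apply, LinearMap.id_apply, map_add, map_smul, smul_add,
      smul_smul, add_zero, zero_smul]
    rw [mul_comm]
    abel

theorem regularRep_apply (x : regularPart N L) : regularRep k V l₀ l₁ x =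
    tensorSum (fun i => evalRep (N := N) k (V i) ⟨x.1.2.1 i, x.2.2.1 i⟩) +
      (vermaChar k l₀ x.1.1 + vermaChar k l₁ x.1.2.2) • LinearMap.id := rfl

theorem regularRep_embZero {x : AffineZero N} (hx : IsRegular x.toLoop.1) :
    regularRep k V l₀ l₁ ⟨embZero x, embZero_mem_regularPart hx⟩ =
      vermaChar k l₀ x • LinearMap.id := by
  have h : ∀ i, evalRep (N := N) k (V i) 0 = 0 := fun i => map_zero _
  have h1 : tensorSum (fun i => evalRep (N := N) k (V i) 0) = 0 := by
    simp only [tensorSum_eq, h, slot_zero, Finset.sum_const_zero]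
  have h2 : vermaChar k l₁ (0 : AffineInfty N) = 0 := map_zero _
  change tensorSum (fun i => evalRep (N := N) k (V i) 0) +
    (vermaChar k l₀ x + vermaChar k l₁ (0 : AffineInfty N)) • LinearMap.id = _
  rw [h1, h2, zero_add, add_zero]

theorem regularRep_embInfty {x : AffineInfty N} (hx : IsRegular x.toLoop.1) :
    regularRep k V l₀ l₁ ⟨embInfty x, embInfty_mem_regularPart hx⟩ =
      vermaChar k l₁ x • LinearMap.id := by
  have h : ∀ i, evalRep (N := N) k (V i) 0 = 0 := fun i => map_zero _
  have h1 : tensorSum (fun i => evalRep (N := N) k (V i) 0) = 0 := by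
    simp only [tensorSum_eq, h, slot_zero, Finset.sum_const_zero]
  have h2 : vermaChar k l₀ (0 : AffineZero N) = 0 := map_zero _
  change tensorSum (fun i => evalRep (N := N) k (V i) 0) +
    (vermaChar k l₀ (0 : AffineZero N) + vermaChar k l₁ x) • LinearMap.id = _
  rw [h1, h2, zero_add, zero_add]

theorem regularRep_embAt (i : Fin L) (b : affinePlus N) :
    regularRep k V l₀ l₁ ⟨embAt i b.1, embAt_mem_regularPart i b⟩ =
      slot i (evalRep (N := N) k (V i) b) := by
  have h0 : vermaChar k l₀ (0 : AffineZero N) = 0 := map_zero _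
  have h1 : vermaChar k l₁ (0 : AffineInfty N) = 0 := map_zero _
  have h : regularRep k V l₀ l₁ ⟨embAt i b.1, embAt_mem_regularPart i b⟩ =
      ∑ j, slot j (evalRep (N := N) k (V j)
        (regularAt j ⟨embAt i b.1, embAt_mem_regularPart i b⟩)) +
        (vermaChar k l₀ (0 : AffineZero N) + vermaChar k l₁ (0 : AffineInfty N)) •
          LinearMap.id := rfl
  rw [h, h0, h1, add_zero, zero_smul, add_zero, Finset.sum_eq_single i]
  · have hb : regularAt i ⟨embAt i b.1, embAt_mem_regularPart i b⟩ = b :=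
      Subtype.ext (Pi.single_eq_same (M := fun _ => AffineAt N) i b.1)
    rw [hb]
  · intro j _ hj
    have hb : regularAt j ⟨embAt i b.1, embAt_mem_regularPart i b⟩ = 0 :=
      Subtype.ext (Pi.single_eq_of_ne (M := fun _ => AffineAt N) hj b.1)
    rw [hb, map_zero, slot_zero]
  · exact fun hi => absurd (Finset.mem_univ i) hi

variable {k V l₀ l₁}

/-- Frobenius reciprocity for the tensor product of the Verma and Weyl modules. The map is extended
first to the Weyl modules, with values in the vectors satisfying the relations of both highest
weight vectors, then to the Verma module at `∞` and last to the one at `0`. -/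
theorem exists_equivariant_extension {X : Type u} [AddCommGroup X] [Module ℂ X]
    (R : GlobalAffine N L →ₗ⁅ℂ⁆ Module.End ℂ X) (φ : (⨂[ℂ] i, V i) →ₗ[ℂ] X)
    (hφ : ∀ (x : regularPart N L) v, φ (regularRep k V l₀ l₁ x v) = R x (φ v)) :
    ∃ Ψ : (VermaZero k l₀ ⊗[ℂ] ((⨂[ℂ] i, Weyl (N := N) k (V i)) ⊗[ℂ] VermaInfty k l₁)) →ₗ[ℂ] X,
      (∀ v, Ψ (Cyclic.vac _ ⊗ₜ (weylIncl k V v ⊗ₜ Cyclic.vac _)) = φ v) ∧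
      ∀ f m, Ψ (actOrb t (VermaZero k l₀) (fun i => Weyl (N := N) k (V i)) (VermaInfty k l₁) f m) =
        R (sectionElt t f) (Ψ m) := by
  let r₀ : AffineZero N →ₗ⁅ℂ⁆ Module.End ℂ X := R.comp embZero
  let r₁ : AffineInfty N →ₗ⁅ℂ⁆ Module.End ℂ X := R.comp embInfty
  let r : Fin L → AffineAt N →ₗ⁅ℂ⁆ Module.End ℂ X := fun i => R.comp (embAt i)
  have hc0 : ∀ i x y F, r₀ x (r i y F) = r i y (r₀ x F) := fun i x y F =>
    apply_comm_of_lie_eq_zero R (embZero_lie_embAt i x y) F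
  have hc1 : ∀ i x y F, r₁ x (r i y F) = r i y (r₁ x F) := fun i x y F =>
    apply_comm_of_lie_eq_zero R (embInfty_lie_embAt i x y) F
  have hc01 : ∀ x y F, r₀ x (r₁ y F) = r₁ y (r₀ x F) := fun x y F =>
    apply_comm_of_lie_eq_zero R (embZero_lie_embInfty x y) F
  let G₀ := vermaGenerators (eps N) (1 / N) k l₀
  let G₁ := vermaGenerators (eps N)⁻¹ (1 / N) k l₁
  let Z : Submodule ℂ X := killedBy r₀ G₀ ⊓ killedBy r₁ G₁
  have hZ : ∀ i x, ∀ F ∈ Z, r i x F ∈ Z := fun i x F hF =>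
    ⟨killedBy_stable r₀ (fun y F => hc0 i y x F) G₀ hF.1,
      killedBy_stable r₁ (fun y F => hc1 i y x F) G₁ hF.2⟩
  have hφZ : ∀ v, φ v ∈ Z := by
    intro v
    refine ⟨mem_killedBy_vermaGenerators k l₀ fun x hx => ?_,
      mem_killedBy_vermaGenerators k l₁ fun x hx => ?_⟩
    · have h := hφ ⟨embZero x, embZero_mem_regularPart hx⟩ v
      rw [regularRep_embZero k V l₀ l₁ hx, LinearMap.smul_apply, LinearMap.id_apply, map_smul] at h
      exact h.symm
    · have h := hφ ⟨embInfty x, embInfty_mem_regularPart hx⟩ v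
      rw [regularRep_embInfty k V l₀ l₁ hx, LinearMap.smul_apply, LinearMap.id_apply, map_smul] at h
      exact h.symm
  obtain ⟨Φ, hΦ1, hΦ2⟩ := exists_multilinear_extension (affinePlus N) L V
    (fun i => evalRep (N := N) k (V i)) Z (fun i => restrictRep (r i) Z (hZ i))
    (fun i j hij x y F => Subtype.ext
      (apply_comm_of_lie_eq_zero R (embAt_lie_embAt hij x y) F.1))
    ((φ.codRestrict Z hφZ).compMultilinearMap (PiTensorProduct.tprod ℂ))
    (by
      intro i b v
      refine Subtype.ext ?_
      have h := hφ ⟨embAt i b.1, embAt_mem_regularPart i b⟩ (PiTensorProduct.tprod ℂ v)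
      rw [regularRep_embAt, slot_tprod] at h
      exact h)
  let Φ' : (⨂[ℂ] i, Weyl (N := N) k (V i)) →ₗ[ℂ] Z := PiTensorProduct.lift Φ
  have hΦ1' : ∀ v, (Φ' (weylIncl k V v) : X) = φ v := by
    have h : Z.subtype ∘ₗ Φ' ∘ₗ weylIncl k V = φ := by
      refine PiTensorProduct.ext (MultilinearMap.ext fun v => ?_)
      change ((Φ' (weylIncl k V (PiTensorProduct.tprod ℂ v)) : Z) : X) = _
      rw [weylIncl, PiTensorProduct.map_tprod, PiTensorProduct.lift.tprod]
      exact congrArg Subtype.val (hΦ1 v)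
    exact LinearMap.congr_fun h
  have hΦ2' : ∀ i (x : AffineAt N) m, (Φ' (slot i (LieModule.toEnd ℂ (AffineAt N)
      (Weyl (N := N) k (V i)) x) m) : X) = r i x (Φ' m) := by
    intro i x
    have h : Z.subtype ∘ₗ Φ' ∘ₗ slot i (LieModule.toEnd ℂ (AffineAt N)
        (Weyl (N := N) k (V i)) x) = r i x ∘ₗ Z.subtype ∘ₗ Φ' := by
      refine PiTensorProduct.ext (MultilinearMap.ext fun m => ?_)
      change ((Φ' (slot i _ (PiTensorProduct.tprod ℂ m)) : Z) : X) =
        r i x (Φ' (PiTensorProduct.tprod ℂ m) : Z)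
      rw [slot_tprod, PiTensorProduct.lift.tprod, PiTensorProduct.lift.tprod]
      exact congrArg Subtype.val (hΦ2 i x m)
    exact LinearMap.congr_fun h
  let B : (⨂[ℂ] i, Weyl (N := N) k (V i)) →ₗ[ℂ] VermaInfty k l₁ →ₗ[ℂ] X :=
    Cyclic.lift r₁ G₁ ∘ₗ Submodule.inclusion inf_le_right ∘ₗ Φ'
  have hBvac : ∀ m, B m (Cyclic.vac _) = Φ' m := fun m => Cyclic.lift_vac r₁ G₁ _
  have hBlie : ∀ m (x : AffineInfty N) u, B m ⁅x, u⁆ = r₁ x (B m u) := fun m x u =>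
    Cyclic.lift_lie r₁ G₁ _ x u
  have hBslot : ∀ i (x : AffineAt N) m u, B (slot i (LieModule.toEnd ℂ (AffineAt N)
      (Weyl (N := N) k (V i)) x) m) u = r i x (B m u) := fun i x m u =>
    Cyclic.lift_comm r₁ (fun y F => hc1 i y x F) G₁ (hΦ2' i x m) u
  have hB0 : ∀ m u, B m u ∈ killedBy r₀ G₀ := by
    intro m u
    have h : (killedBy r₀ G₀).comap (B m) = ⊤ := by
      refine Cyclic.eq_top _ _ ?_ fun x u hu => ?_
      · rw [Submodule.mem_comap, hBvac]
        exact (Φ' m).2.1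
      · rw [Submodule.mem_comap, hBlie]
        exact killedBy_stable r₀ (fun y F => hc01 y x F) G₀ hu
    exact (h ▸ Submodule.mem_top : u ∈ (killedBy r₀ G₀).comap (B m))
  have hBl0 : ∀ z, TensorProduct.lift B z ∈ killedBy r₀ G₀ := by
    intro z
    induction z with
    | zero => rw [map_zero]; exact zero_mem _
    | add y z hy hz => rw [map_add]; exact add_mem hy hz
    | tmul m u => exact hB0 m u
  let D : ((⨂[ℂ] i, Weyl (N := N) k (V i)) ⊗[ℂ] VermaInfty k l₁) →ₗ[ℂ]
      VermaZero k l₀ →ₗ[ℂ] X :=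
    Cyclic.lift r₀ G₀ ∘ₗ (TensorProduct.lift B).codRestrict (killedBy r₀ G₀) hBl0
  have hDvac : ∀ z, D z (Cyclic.vac _) = TensorProduct.lift B z := fun z =>
    Cyclic.lift_vac r₀ G₀ _
  have hDlie : ∀ z (x : AffineZero N) u, D z ⁅x, u⁆ = r₀ x (D z u) := fun z x u =>
    Cyclic.lift_lie r₀ G₀ _ x u
  have hDslot : ∀ i (x : AffineAt N) m u q, D (slot i (LieModule.toEnd ℂ (AffineAt N)
      (Weyl (N := N) k (V i)) x) m ⊗ₜ u) q = r i x (D (m ⊗ₜ u) q) := fun i x m u q =>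
    Cyclic.lift_comm r₀ (fun y F => hc0 i y x F) G₀ (hBslot i x m u) q
  have hDinf : ∀ m (x : AffineInfty N) u q, D (m ⊗ₜ ⁅x, u⁆) q = r₁ x (D (m ⊗ₜ u) q) :=
    fun m x u q => Cyclic.lift_comm r₀ (fun y F => hc01 y x F) G₀ (hBlie m x u) q
  refine ⟨TensorProduct.lift D.flip, fun v => ?_, fun f m => ?_⟩
  · rw [TensorProduct.lift.tmul, LinearMap.flip_apply, hDvac, TensorProduct.lift.tmul, hBvac, hΦ1']
  · induction m with
    | zero => simp only [map_zero]
    | add y z hy hz => simp only [map_add, hy, hz]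
    | tmul q z =>
      induction z with
      | zero => simp only [TensorProduct.tmul_zero, map_zero]
      | add y z hy hz => simp only [TensorProduct.tmul_add, map_add, hy, hz]
      | tmul m u =>
        let T : (⨂[ℂ] i, Weyl (N := N) k (V i)) →ₗ[ℂ] X :=
          D.flip q ∘ₗ (TensorProduct.mk ℂ _ (VermaInfty k l₁)).flip u
        have e2 : T (actMarked t (fun i => Weyl (N := N) k (V i)) f m) =
            ∑ i, r i (Affine.mk (germAt (t i) f) 0) (T m) := by
          rw [actMarked, tensorSum_eq, LinearMap.sum_apply, map_sum]
          exact Finset.sum_congr rfl fun i _ => hDslot i _ m u q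
        have h1 := lift_flip_map D
          (LieModule.toEnd ℂ (AffineZero N) (VermaZero k l₀) (Affine.mk (germZero f) 0))
          (actMarked t (fun i => Weyl (N := N) k (V i)) f)
          (LieModule.toEnd ℂ (AffineInfty N) (VermaInfty k l₁) (Affine.mk (germInfty f) 0)) q m u
        have h2 : D (m ⊗ₜ u) (LieModule.toEnd ℂ (AffineZero N) (VermaZero k l₀)
            (Affine.mk (germZero f) 0) q) = r₀ (Affine.mk (germZero f) 0) (T m) :=
          hDlie (m ⊗ₜ u) (Affine.mk (germZero f) 0) q
        have h3 : D (m ⊗ₜ LieModule.toEnd ℂ (AffineInfty N) (VermaInfty k l₁)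
            (Affine.mk (germInfty f) 0) u) q = r₁ (Affine.mk (germInfty f) 0) (T m) :=
          hDinf m (Affine.mk (germInfty f) 0) u q
        have h4 := apply_eq_sum_emb R (sectionElt t f) (T m)
        exact h1.trans ((congrArg₂ (· + ·) (congrArg₂ (· + ·) h2 e2) h3).trans h4.symm)

end Extension

/-! ### Coinvariants on the orbifold -/

section Orbifold

variable {N L : ℕ}

/-- The projection of the global affine Lie algebra to its summand at `0`. -/
def projZero : GlobalAffine N L →ₗ⁅ℂ⁆ AffineZero N := LieHom.fst ℂ _ _

/-- The projection of a power of a Lie algebra to its `i`-th factor. -/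
def piProj {𝔮 : Type*} [LieRing 𝔮] [LieAlgebra ℂ 𝔮] (i : Fin L) : (Fin L → 𝔮) →ₗ⁅ℂ⁆ 𝔮 where
  __ := LinearMap.proj i
  map_lie' := rfl

/-- The projection of the global affine Lie algebra to its summand at the `i`-th marked point. -/
def projAt (i : Fin L) : GlobalAffine N L →ₗ⁅ℂ⁆ AffineAt N :=
  (piProj i).comp ((LieHom.fst ℂ (Fin L → AffineAt N) (AffineInfty N)).comp
    (LieHom.snd ℂ (AffineZero N) ((Fin L → AffineAt N) × AffineInfty N)))

/-- The projection of the global affine Lie algebra to its summand at `∞`. -/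
def projInfty : GlobalAffine N L →ₗ⁅ℂ⁆ AffineInfty N :=
  (LieHom.snd ℂ (Fin L → AffineAt N) (AffineInfty N)).comp
    (LieHom.snd ℂ (AffineZero N) ((Fin L → AffineAt N) × AffineInfty N))

theorem tensorRep_tensorRep_apply {𝔞 P M Q : Type*} [LieRing 𝔞] [LieAlgebra ℂ 𝔞] [AddCommGroup P]
    [Module ℂ P] [AddCommGroup M] [Module ℂ M] [AddCommGroup Q] [Module ℂ Q]
    (a : 𝔞 →ₗ⁅ℂ⁆ Module.End ℂ P) (b : 𝔞 →ₗ⁅ℂ⁆ Module.End ℂ M) (c : 𝔞 →ₗ⁅ℂ⁆ Module.End ℂ Q) (x : 𝔞) :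
    tensorRep a (tensorRep b c) x = TensorProduct.map (a x) LinearMap.id +
      TensorProduct.map LinearMap.id (TensorProduct.map (b x) LinearMap.id) +
      TensorProduct.map LinearMap.id (TensorProduct.map LinearMap.id (c x)) := by
  rw [add_assoc, ← TensorProduct.map_add_right]
  rfl

theorem tmul_add_tmul_of_smul {P M Q : Type*} [AddCommGroup P] [Module ℂ P] [AddCommGroup M]
    [Module ℂ M] [AddCommGroup Q] [Module ℂ Q] {q q' : P} {u u' : Q} {c d : ℂ} (hq : q' = c • q)
    (hu : u' = d • u) (m m' : M) :
    q' ⊗ₜ[ℂ] (m ⊗ₜ[ℂ] u) + q ⊗ₜ[ℂ] (m' ⊗ₜ[ℂ] u + m ⊗ₜ[ℂ] u') =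
      q ⊗ₜ[ℂ] ((m' + (c + d) • m) ⊗ₜ[ℂ] u) := by
  rw [hq, hu]
  simp only [TensorProduct.add_tmul, add_smul, TensorProduct.tmul_add,
    ← TensorProduct.smul_tmul', TensorProduct.tmul_smul]
  abel

theorem exists_lie_projection {𝔞 : Type*} [LieRing 𝔞] [LieAlgebra ℂ 𝔞] (𝔟 𝔠 : LieSubalgebra ℂ 𝔞)
    (h : ∀ x, ∃ c ∈ 𝔠, x - c ∈ 𝔟) :
    ∃ p : 𝔞 →ₗ[ℂ] 𝔟, (∀ b : 𝔟, p b = b) ∧ ∀ x, x - p x ∈ 𝔠 :=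
  exists_projection 𝔟.toSubmodule 𝔠.toSubmodule h

variable (t : Fin L → ℂ) (k : ℂ) (V : Fin L → Type u)
  [∀ i, AddCommGroup (V i)] [∀ i, Module ℂ (V i)]
  [∀ i, LieRingModule (LieAlgebra.SpecialLinear.sl (Fin N) ℂ) (V i)]
  [∀ i, LieModule ℂ (LieAlgebra.SpecialLinear.sl (Fin N) ℂ) (V i)]
  (l : Module.Dual ℂ (cartan N))

/-- The action of the global affine Lie algebra on the product of Verma and Weyl modules. -/
def globalRep (l₀ l₁ : Module.Dual ℂ (cartan N)) : GlobalAffine N L →ₗ⁅ℂ⁆ Module.End ℂ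
    (VermaZero k l₀ ⊗[ℂ] ((⨂[ℂ] i, Weyl (N := N) k (V i)) ⊗[ℂ] VermaInfty k l₁)) :=
  tensorRep ((LieModule.toEnd ℂ (AffineZero N) (VermaZero k l₀)).comp projZero)
    (tensorRep
      (piTensorRep fun i =>
        (LieModule.toEnd ℂ (AffineAt N) (Weyl (N := N) k (V i))).comp (projAt i))
      ((LieModule.toEnd ℂ (AffineInfty N) (VermaInfty k l₁)).comp projInfty))

theorem globalRep_tmul (l₀ l₁ : Module.Dual ℂ (cartan N)) (x : GlobalAffine N L)
    (q : VermaZero k l₀) (m : ⨂[ℂ] i, Weyl (N := N) k (V i)) (u : VermaInfty k l₁) :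
    globalRep k V l₀ l₁ x (q ⊗ₜ (m ⊗ₜ u)) = ⁅x.1, q⁆ ⊗ₜ (m ⊗ₜ u) +
      q ⊗ₜ (tensorSum (fun i => LieModule.toEnd ℂ (AffineAt N) (Weyl (N := N) k (V i)) (x.2.1 i)) m
        ⊗ₜ u + m ⊗ₜ ⁅x.2.2, u⁆) := rfl

theorem globalRep_sectionElt (l₀ l₁ : Module.Dual ℂ (cartan N)) (f : orbSections N) :
    globalRep k V l₀ l₁ (sectionElt t f) =
      actOrb t (VermaZero k l₀) (fun i => Weyl (N := N) k (V i)) (VermaInfty k l₁) f :=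
  tensorRep_tensorRep_apply ((LieModule.toEnd ℂ (AffineZero N) (VermaZero k l₀)).comp projZero)
    (piTensorRep fun i =>
      (LieModule.toEnd ℂ (AffineAt N) (Weyl (N := N) k (V i))).comp (projAt i))
    ((LieModule.toEnd ℂ (AffineInfty N) (VermaInfty k l₁)).comp projInfty) (sectionElt t f)

variable [NeZero N]

theorem weightAtZero_add_weightAtInfty (l : Module.Dual ℂ (cartan N)) (H : cartan N) :
    weightAtZero l H + weightAtInfty l H = -l H := by
  have h : (oneSubAdBeta N).symm (H - adBeta N H) = H := (oneSubAdBeta N).symm_apply_apply H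
  change l ((oneSubAdBeta N).symm (adBeta N H)) + -l ((oneSubAdBeta N).symm H) = -l H
  conv_rhs => rw [← h]
  rw [map_sub, map_sub]
  ring

theorem weightAtInfty_adBeta (l : Module.Dual ℂ (cartan N)) (H : cartan N) :
    weightAtInfty l (adBeta N H) = -weightAtZero l H := rfl

/-- The regular part meets the global sections in the constants, which act on `V` by the difference
of the action of the Cartan subalgebra and the weight `l`. -/
theorem regularRep_of_const (b : regularPart N L) (H : cartan N)
    (h0 : b.1.1.toLoop = germZero (constSection H))
    (hi : ∀ i, (b.1.2.1 i).toLoop = germAt (t i) (constSection H))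
    (h1 : b.1.2.2.toLoop = germInfty (constSection H))
    (hlev : ∑ i, (b.1.2.1 i).level + (b.1.1.level + b.1.2.2.level) = 0) (v : ⨂[ℂ] i, V i) :
    regularRep k V (weightAtZero l) (weightAtInfty l) b v =
      tensorSum (fun i => LieModule.toEnd ℂ (LieAlgebra.SpecialLinear.sl (Fin N) ℂ) (V i) H.1) v -
        l H • v := by
  have he : ∀ i, evalRep (N := N) k (V i) ⟨b.1.2.1 i, b.2.2.1 i⟩ =
      LieModule.toEnd ℂ (LieAlgebra.SpecialLinear.sl (Fin N) ℂ) (V i) H.1 +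
        (k * (b.1.2.1 i).level) • LinearMap.id := by
    intro i
    have hp : evalAtPoint ⟨b.1.2.1 i, b.2.2.1 i⟩ = H.1 := by
      refine Subtype.ext ?_
      change constTerm (b.1.2.1 i).toLoop.1 = cartanMat H
      rw [hi, germAt_constSection, constTerm_constMat]
    rw [← hp]
    rfl
  have hs : k * ∑ i, (b.1.2.1 i).level + k * b.1.1.level + k * b.1.2.2.level = 0 := by
    linear_combination k * hlev
  have hl := weightAtZero_add_weightAtInfty l H
  rw [regularRep_apply]
  simp only [he]
  rw [tensorSum_add, tensorSum_scalar, ← Finset.mul_sum]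
  change _ + ((weightAtZero l (constDiag b.1.1.toLoop) + k * b.1.1.level) +
    (weightAtInfty l (constDiag b.1.2.2.toLoop) + k * b.1.2.2.level)) • v = _
  rw [h0, h1, germZero_constSection, germInfty_constSection, constDiag_constCartan,
    constDiag_constCartan, LinearMap.add_apply, LinearMap.smul_apply, LinearMap.id_apply, add_assoc,
    ← add_smul, sub_eq_add_neg, ← neg_smul]
  congr 2
  linear_combination hl + hs

theorem exists_regularRep_of_mem_globalSections {t : Fin L → ℂ} (ht0 : ∀ i, t i ≠ 0)
    (ht : ∀ i j, i ≠ j → ∀ a : ℤ, t i ≠ (eps N ^ a : ℂˣ) * t j) (b : regularPart N L)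
    (hb : (b : GlobalAffine N L) ∈ globalSections ht0 ht) :
    ∃ H : cartan N, ∀ v : ⨂[ℂ] i, V i,
      regularRep k V (weightAtZero l) (weightAtInfty l) b v =
        tensorSum (fun i => LieModule.toEnd ℂ (LieAlgebra.SpecialLinear.sl (Fin N) ℂ) (V i) H.1) v -
          l H • v := by
  obtain ⟨⟨f, hf, h0, hi, h1⟩, hlev⟩ := hb
  have hz : IsRegular (germZero f).1 := h0 ▸ b.2.1
  have hinf : IsRegular (germInfty f).1 := h1 ▸ b.2.2.2
  have hm : ∀ i, IsRegular (germAt (t i) f).1 := fun i => hi i ▸ b.2.2.1 i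
  obtain ⟨H, rfl⟩ := exists_eq_constSection hf hz hinf hm
  exact ⟨H, regularRep_of_const t k V l b H h0 hi h1 hlev⟩

/-- The coinduced module: it receives a map from `V` which is equivariant under the regular part,
and has an invariant functional whose restriction to `V` is the projection to `V_l`. -/
theorem exists_global_module [∀ i, FiniteDimensional ℂ (V i)] {t : Fin L → ℂ}
    (ht0 : ∀ i, t i ≠ 0) (ht : ∀ i j, i ≠ j → ∀ a : ℤ, t i ≠ (eps N ^ a : ℂˣ) * t j) :
    ∃ (X : Type u) (_ : AddCommGroup X) (_ : Module ℂ X)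
      (R : GlobalAffine N L →ₗ⁅ℂ⁆ Module.End ℂ X) (φ : (⨂[ℂ] i, V i) →ₗ[ℂ] X)
      (ev : X →ₗ[ℂ] ⨂[ℂ] i, V i),
      (∀ (x : regularPart N L) v,
        φ (regularRep k V (weightAtZero l) (weightAtInfty l) x v) = R x (φ v)) ∧
      (∀ f ∈ gOrb N t, ∀ F, ev (R (sectionElt t f) F) = 0) ∧
      ∀ v ∈ weightSpace V l, ev (φ v) = v := by
  have hproj : ∃ p : GlobalAffine N L →ₗ[ℂ] regularPart N L, (∀ b : regularPart N L, p b = b) ∧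
      ∀ x, x - p x ∈ globalSections ht0 ht :=
    exists_lie_projection (regularPart N L) (globalSections ht0 ht) fun x => by
      obtain ⟨f, hf, hx⟩ := exists_sub_sectionElt_mem ht0 ht x
      exact ⟨_, sectionElt_mem ht0 ht hf, hx⟩
  obtain ⟨p, hp, hc⟩ := hproj
  obtain ⟨π, hπ1, hπ2⟩ := exists_weight_projection V l
  have hinter : ∀ b : regularPart N L, (b : GlobalAffine N L) ∈ globalSections ht0 ht → ∀ v,
      π (regularRep k V (weightAtZero l) (weightAtInfty l) b v) = 0 := by
    intro b hb v
    obtain ⟨H, hH⟩ := exists_regularRep_of_mem_globalSections k V l ht0 ht b hb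
    rw [hH, map_sub, hπ2, map_smul, sub_self]
  obtain ⟨φ, ev, h1, h2, h3⟩ := exists_coinduced hp hc
    (regularRep k V (weightAtZero l) (weightAtInfty l)) π hinter
  exact ⟨_, _, _, coindRep hp hc _, φ, ev, h1, fun f hf F => h2 _ (sectionElt_mem ht0 ht hf) F,
    fun v hv => (h3 v).trans (hπ1 v hv)⟩

/-- The linear functional separating the weight space `V_l` from the relations. -/
theorem exists_orb_functional [∀ i, FiniteDimensional ℂ (V i)] {t : Fin L → ℂ}
    (ht0 : ∀ i, t i ≠ 0) (ht : ∀ i j, i ≠ j → ∀ a : ℤ, t i ≠ (eps N ^ a : ℂˣ) * t j) :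
    ∃ F : (VermaZero k (weightAtZero l) ⊗[ℂ] ((⨂[ℂ] i, Weyl (N := N) k (V i)) ⊗[ℂ]
        VermaInfty k (weightAtInfty l))) →ₗ[ℂ] ⨂[ℂ] i, V i,
      (∀ f ∈ gOrb N t, ∀ m, F (actOrb t (VermaZero k (weightAtZero l))
        (fun i => Weyl (N := N) k (V i)) (VermaInfty k (weightAtInfty l)) f m) = 0) ∧
      ∀ v ∈ weightSpace V l, F (Cyclic.vac _ ⊗ₜ (weylIncl k V v ⊗ₜ Cyclic.vac _)) = v := by
  obtain ⟨X, _, _, R, φ, ev, h1, h2, h3⟩ := exists_global_module k V l ht0 ht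
  obtain ⟨Ψ, hΨ1, hΨ2⟩ := exists_equivariant_extension t R φ h1
  exact ⟨ev ∘ₗ Ψ, fun f hf m => (congrArg ev (hΨ2 f m)).trans (h2 f hf _),
    fun v hv => (congrArg ev (hΨ1 v)).trans (h3 v hv)⟩

theorem orbMap_injective [∀ i, FiniteDimensional ℂ (V i)] {t : Fin L → ℂ}
    (ht0 : ∀ i, t i ≠ 0) (ht : ∀ i j, i ≠ j → ∀ a : ℤ, t i ≠ (eps N ^ a : ℂˣ) * t j) :
    Function.Injective (orbMap t k V l) := by
  obtain ⟨F, hF1, hF2⟩ := exists_orb_functional k V l ht0 ht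
  rw [injective_iff_map_eq_zero]
  intro v hv
  have hmem : Cyclic.vac _ ⊗ₜ (weylIncl k V v ⊗ₜ Cyclic.vac _) ∈
      orbRelations (N := N) t (VermaZero k (weightAtZero l)) (fun i => Weyl (N := N) k (V i))
        (VermaInfty k (weightAtInfty l)) := (Submodule.Quotient.mk_eq_zero _).1 hv
  have hle : orbRelations (N := N) t (VermaZero k (weightAtZero l))
      (fun i => Weyl (N := N) k (V i)) (VermaInfty k (weightAtInfty l)) ≤ LinearMap.ker F := by
    refine Submodule.span_le.2 ?_
    rintro _ ⟨f, hf, m, rfl⟩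
    exact hF1 f hf m
  have h := hle hmem
  rw [LinearMap.mem_ker, hF2 v v.2] at h
  exact Subtype.ext h

/-- The vectors `1 ⊗ v ⊗ 1` of the product of Verma and Weyl modules. -/
def vacTensor (l₀ l₁ : Module.Dual ℂ (cartan N)) : (⨂[ℂ] i, Weyl (N := N) k (V i)) →ₗ[ℂ]
    VermaZero k l₀ ⊗[ℂ] ((⨂[ℂ] i, Weyl (N := N) k (V i)) ⊗[ℂ] VermaInfty k l₁) :=
  TensorProduct.mk ℂ _ _ (Cyclic.vac _) ∘ₗ
    (TensorProduct.mk ℂ (⨂[ℂ] i, Weyl (N := N) k (V i)) (VermaInfty k l₁)).flip (Cyclic.vac _)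

/-- A regular element acts on `1 ⊗ v ⊗ 1` through its action on `V`. -/
theorem globalRep_vacTensor (l₀ l₁ : Module.Dual ℂ (cartan N)) (b : regularPart N L)
    (v : ⨂[ℂ] i, V i) : globalRep k V l₀ l₁ b (vacTensor k V l₀ l₁ (weylIncl k V v)) =
      vacTensor k V l₀ l₁ (weylIncl k V (regularRep k V l₀ l₁ b v)) := by
  have h0 := lie_vac k l₀ (c := 1 / N) b.2.1
  have h1 := lie_vac k l₁ (c := 1 / N) b.2.2.2
  have hm := tensorSum_map (fun i => Weyl.incl (N := N) k (V i))
    (fun i => evalRep (N := N) k (V i) ⟨b.1.2.1 i, b.2.2.1 i⟩)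
    (fun i => LieModule.toEnd ℂ (AffineAt N) (Weyl (N := N) k (V i)) (b.1.2.1 i))
    (fun i m => Induced.lie_incl (affinePlus N) (evalRep (N := N) k (V i))
      ⟨b.1.2.1 i, b.2.2.1 i⟩ m) v
  refine (globalRep_tmul k V l₀ l₁ b.1 _ (weylIncl k V v) _).trans ?_
  refine (tmul_add_tmul_of_smul h0 h1 (weylIncl k V v) _).trans ?_
  refine congrArg (vacTensor k V l₀ l₁) ?_
  rw [regularRep_apply, LinearMap.add_apply, map_add, LinearMap.smul_apply, LinearMap.id_apply,
    map_smul]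
  exact congrArg (· + _) hm

end Orbifold

/-! ### Surjectivity: coinvariants are spanned by `V` -/

section Generation

section Tensors

variable {P M Q : Type*} [AddCommGroup P] [Module ℂ P] [AddCommGroup M] [Module ℂ M]
  [AddCommGroup Q] [Module ℂ Q]

theorem tmul_add_tmul_of_eq_zero {m' : M} {u' : Q} (hm : m' = 0) (hu : u' = 0) (q' q : P) (m : M)
    (u : Q) : q' ⊗ₜ[ℂ] (m ⊗ₜ[ℂ] u) + q ⊗ₜ[ℂ] (m' ⊗ₜ[ℂ] u + m ⊗ₜ[ℂ] u') =
      q' ⊗ₜ[ℂ] (m ⊗ₜ[ℂ] u) := by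
  rw [hm, hu, TensorProduct.zero_tmul, TensorProduct.tmul_zero, add_zero, TensorProduct.tmul_zero,
    add_zero]

theorem zero_tmul_add_tmul {q' : P} {m' : M} (hq : q' = 0) (hm : m' = 0) (q : P) (m : M)
    (u u' : Q) : q' ⊗ₜ[ℂ] (m ⊗ₜ[ℂ] u) + q ⊗ₜ[ℂ] (m' ⊗ₜ[ℂ] u + m ⊗ₜ[ℂ] u') =
      q ⊗ₜ[ℂ] (m ⊗ₜ[ℂ] u') := by
  rw [hq, hm, TensorProduct.zero_tmul, TensorProduct.zero_tmul, zero_add, zero_add]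

theorem tmul_add_tmul_of_zero_zero {q' : P} {u' : Q} {m' m'' : M} (hq : q' = 0) (hu : u' = 0)
    (hm : m' = m'') (q : P) (m : M) (u : Q) :
    q' ⊗ₜ[ℂ] (m ⊗ₜ[ℂ] u) + q ⊗ₜ[ℂ] (m' ⊗ₜ[ℂ] u + m ⊗ₜ[ℂ] u') = q ⊗ₜ[ℂ] (m'' ⊗ₜ[ℂ] u) := by
  rw [hq, hu, hm, TensorProduct.zero_tmul, TensorProduct.tmul_zero, zero_add, add_zero]

end Tensors

/-- A subspace of a tensor product with cyclic modules at both ends is everything as soon as it is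
stable under the actions at both ends and contains the vectors `1 ⊗ m ⊗ 1`. -/
theorem tensor_cyclic_eq_top {𝔞 𝔠 M : Type*} [LieRing 𝔞] [LieAlgebra ℂ 𝔞] [LieRing 𝔠]
    [LieAlgebra ℂ 𝔠] [AddCommGroup M] [Module ℂ M]
    (I : Submodule (UniversalEnvelopingAlgebra ℂ 𝔞) (UniversalEnvelopingAlgebra ℂ 𝔞))
    (J : Submodule (UniversalEnvelopingAlgebra ℂ 𝔠) (UniversalEnvelopingAlgebra ℂ 𝔠))
    (S : Submodule ℂ (Cyclic I ⊗[ℂ] (M ⊗[ℂ] Cyclic J)))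
    (hv : ∀ m, Cyclic.vac I ⊗ₜ (m ⊗ₜ Cyclic.vac J) ∈ S)
    (h0 : ∀ (x : 𝔞) q m u, q ⊗ₜ (m ⊗ₜ u) ∈ S → ⁅x, q⁆ ⊗ₜ (m ⊗ₜ u) ∈ S)
    (h1 : ∀ (x : 𝔠) q m u, q ⊗ₜ (m ⊗ₜ u) ∈ S → q ⊗ₜ (m ⊗ₜ ⁅x, u⁆) ∈ S) : S = ⊤ := by
  have e2 : ∀ m u, Cyclic.vac I ⊗ₜ (m ⊗ₜ u) ∈ S := by
    intro m u
    have h : S.comap (TensorProduct.mk ℂ (Cyclic I) _ (Cyclic.vac I) ∘ₗ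
        TensorProduct.mk ℂ M (Cyclic J) m) = ⊤ :=
      Cyclic.eq_top _ _ (hv m) fun x u hu => h1 x _ m u hu
    have hmem : u ∈ (⊤ : Submodule ℂ (Cyclic J)) := Submodule.mem_top
    rw [← h] at hmem
    exact hmem
  have e3 : ∀ q m u, (q : Cyclic I) ⊗ₜ (m ⊗ₜ u) ∈ S := by
    intro q m u
    have h : S.comap ((TensorProduct.mk ℂ (Cyclic I) (M ⊗[ℂ] Cyclic J)).flip (m ⊗ₜ u)) = ⊤ :=
      Cyclic.eq_top _ _ (e2 m u) fun x q hq => h0 x q m u hq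
    have hmem : q ∈ (⊤ : Submodule ℂ (Cyclic I)) := Submodule.mem_top
    rw [← h] at hmem
    exact hmem
  rw [eq_top_iff]
  rintro z -
  induction z with
  | zero => exact zero_mem _
  | add y z hy hz => exact add_mem hy hz
  | tmul q z =>
    induction z with
    | zero => rw [TensorProduct.tmul_zero]; exact zero_mem _
    | add y z hy hz => rw [TensorProduct.tmul_add]; exact add_mem hy hz
    | tmul m u => exact e3 q m u

variable {L : ℕ} {M : Fin L → Type u} [∀ i, AddCommGroup (M i)] [∀ i, Module ℂ (M i)]
  {𝔮 : Type*} [LieRing 𝔮] [LieAlgebra ℂ 𝔮] (r : ∀ i, 𝔮 →ₗ⁅ℂ⁆ Module.End ℂ (M i))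

theorem tensorSum_zero : tensorSum (fun i => r i 0) = 0 := by
  simp only [tensorSum_eq, map_zero, slot_zero, Finset.sum_const_zero]

theorem tensorSum_single (i : Fin L) (x : 𝔮) :
    tensorSum (fun j => r j ((Pi.single i x : Fin L → 𝔮) j)) = slot i (r i x) := by
  rw [tensorSum_eq, Finset.sum_eq_single i]
  · rw [Pi.single_eq_same]
  · intro j _ hj
    rw [Pi.single_eq_of_ne hj, map_zero, slot_zero]
  · exact fun hi => absurd (Finset.mem_univ i) hi

end Generation

section GlobalAction

variable {N L : ℕ} (k : ℂ) (V : Fin L → Type u)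
  [∀ i, AddCommGroup (V i)] [∀ i, Module ℂ (V i)]
  [∀ i, LieRingModule (LieAlgebra.SpecialLinear.sl (Fin N) ℂ) (V i)]
  [∀ i, LieModule ℂ (LieAlgebra.SpecialLinear.sl (Fin N) ℂ) (V i)]
  (l₀ l₁ : Module.Dual ℂ (cartan N))

theorem globalRep_embZero (x : AffineZero N) (q : VermaZero k l₀)
    (m : ⨂[ℂ] i, Weyl (N := N) k (V i)) (u : VermaInfty k l₁) :
    globalRep k V l₀ l₁ (embZero x : GlobalAffine N L) (q ⊗ₜ (m ⊗ₜ u)) = ⁅x, q⁆ ⊗ₜ (m ⊗ₜ u) := by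
  have hm := LinearMap.congr_fun (tensorSum_zero fun i =>
    LieModule.toEnd ℂ (AffineAt N) (Weyl (N := N) k (V i))) m
  have hu : ⁅(0 : AffineInfty N), u⁆ = 0 := zero_lie u
  refine (globalRep_tmul k V l₀ l₁ _ q m u).trans ?_
  exact tmul_add_tmul_of_eq_zero hm hu _ q m u

theorem globalRep_embInfty (x : AffineInfty N) (q : VermaZero k l₀)
    (m : ⨂[ℂ] i, Weyl (N := N) k (V i)) (u : VermaInfty k l₁) :
    globalRep k V l₀ l₁ (embInfty x : GlobalAffine N L) (q ⊗ₜ (m ⊗ₜ u)) = q ⊗ₜ (m ⊗ₜ ⁅x, u⁆) := by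
  have hm := LinearMap.congr_fun (tensorSum_zero fun i =>
    LieModule.toEnd ℂ (AffineAt N) (Weyl (N := N) k (V i))) m
  have hq : ⁅(0 : AffineZero N), q⁆ = 0 := zero_lie q
  refine (globalRep_tmul k V l₀ l₁ _ q m u).trans ?_
  exact zero_tmul_add_tmul hq hm q m u _

theorem globalRep_embAt (i : Fin L) (x : AffineAt N) (q : VermaZero k l₀)
    (m : ⨂[ℂ] i, Weyl (N := N) k (V i)) (u : VermaInfty k l₁) :
    globalRep k V l₀ l₁ (embAt i x : GlobalAffine N L) (q ⊗ₜ (m ⊗ₜ u)) =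
      q ⊗ₜ (slot i (LieModule.toEnd ℂ (AffineAt N) (Weyl (N := N) k (V i)) x) m ⊗ₜ u) := by
  have hm := LinearMap.congr_fun (tensorSum_single (fun i =>
    LieModule.toEnd ℂ (AffineAt N) (Weyl (N := N) k (V i))) i x) m
  have hq : ⁅(0 : AffineZero N), q⁆ = 0 := zero_lie q
  have hu : ⁅(0 : AffineInfty N), u⁆ = 0 := zero_lie u
  refine (globalRep_tmul k V l₀ l₁ _ q m u).trans ?_
  exact tmul_add_tmul_of_zero_zero hq hu hm q m u

theorem globalRep_generates
    (S : Submodule ℂ (VermaZero k l₀ ⊗[ℂ] ((⨂[ℂ] i, Weyl (N := N) k (V i)) ⊗[ℂ] VermaInfty k l₁)))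
    (h0 : ∀ v, vacTensor k V l₀ l₁ (weylIncl k V v) ∈ S)
    (h1 : ∀ x, ∀ m ∈ S, globalRep k V l₀ l₁ x m ∈ S) : S = ⊤ := by
  refine tensor_cyclic_eq_top _ _ S (fun m => ?_)
    (fun x q m u h => (congrArg (· ∈ S) (globalRep_embZero k V l₀ l₁ x q m u)).mp
      (h1 (embZero x) _ h))
    (fun x q m u h => (congrArg (· ∈ S) (globalRep_embInfty k V l₀ l₁ x q m u)).mp
      (h1 (embInfty x) _ h))
  have h : S.comap (vacTensor k V l₀ l₁) = ⊤ :=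
    tensor_induced_eq_top (affinePlus N) (fun i => evalRep (N := N) k (V i)) _ h0
      fun i x m hm => (congrArg (· ∈ S) (globalRep_embAt k V l₀ l₁ i x _ m _)).mp
        (h1 (embAt i x) _ hm)
  have hmem : m ∈ (⊤ : Submodule ℂ (⨂[ℂ] i, Weyl (N := N) k (V i))) := Submodule.mem_top
  rw [← h] at hmem
  exact hmem

end GlobalAction

section Surjectivity

variable {N L : ℕ} [NeZero N] {t : Fin L → ℂ} (k : ℂ) (V : Fin L → Type u)
  [∀ i, AddCommGroup (V i)] [∀ i, Module ℂ (V i)]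
  [∀ i, LieRingModule (LieAlgebra.SpecialLinear.sl (Fin N) ℂ) (V i)]
  [∀ i, LieModule ℂ (LieAlgebra.SpecialLinear.sl (Fin N) ℂ) (V i)]
  (l : Module.Dual ℂ (cartan N))

/-- Every element of the global affine Lie algebra is a regular one plus the germs of a section, so
the coinvariants are spanned by the classes of `1 ⊗ v ⊗ 1`. -/
theorem orbClass_weylIncl_surjective (ht0 : ∀ i, t i ≠ 0)
    (ht : ∀ i j, i ≠ j → ∀ a : ℤ, t i ≠ (eps N ^ a : ℂˣ) * t j)
    (z : CCOrbWeyl t k V l) : ∃ v, z = orbClass t k V l (weylIncl k V v) := by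
  let T := vacTensor k V (weightAtZero l) (weightAtInfty l) ∘ₗ weylIncl k V
  have h := sup_relations_eq_top (globalRep k V (weightAtZero l) (weightAtInfty l))
    (regularPart N L : Set (GlobalAffine N L)) {x | ∃ f ∈ gOrb N t, x = sectionElt t f}
    (fun x => by
      obtain ⟨f, hf, hx⟩ := exists_sub_sectionElt_mem ht0 ht x
      exact ⟨_, hx, _, ⟨f, hf, rfl⟩, (sub_add_cancel x _).symm⟩)
    (LinearMap.range T)
    (orbRelations (N := N) t (VermaZero k (weightAtZero l)) (fun i => Weyl (N := N) k (V i))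
      (VermaInfty k (weightAtInfty l)))
    (by
      rintro b hb _ ⟨v, rfl⟩
      exact ⟨_, (globalRep_vacTensor k V (weightAtZero l) (weightAtInfty l) ⟨b, hb⟩ v).symm⟩)
    (fun S hS h1 => globalRep_generates k V _ _ S (fun v => hS ⟨v, rfl⟩) h1)
    (by
      rintro _ ⟨f, hf, rfl⟩ m
      rw [globalRep_sectionElt]
      exact Submodule.subset_span ⟨f, hf, m, rfl⟩)
  obtain ⟨m, rfl⟩ := Submodule.Quotient.mk_surjective _ z
  have hm : m ∈ (⊤ : Submodule ℂ (VermaZero k (weightAtZero l) ⊗[ℂ]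
    ((⨂[ℂ] i, Weyl (N := N) k (V i)) ⊗[ℂ] VermaInfty k (weightAtInfty l)))) := Submodule.mem_top
  rw [← h] at hm
  obtain ⟨_, ⟨v, rfl⟩, r, hr, rfl⟩ := Submodule.mem_sup.1 hm
  exact ⟨v, (Submodule.Quotient.eq _).2 ((add_sub_cancel_left (T v) r).symm ▸ hr)⟩

/-- Trigonometric sections realise all principal parts at the marked points. -/
theorem trigMap_surjective (ht0 : ∀ i, t i ≠ 0)
    (ht : ∀ i j, i ≠ j → ∀ a : ℤ, t i ≠ (eps N ^ a : ℂˣ) * t j) :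
    Function.Surjective (trigMap (N := N) t k V) := by
  have h := sup_relations_eq_top (𝔞 := Fin L → AffineAt N)
    (piTensorRep fun i => (LieModule.toEnd ℂ (AffineAt N) (Weyl (N := N) k (V i))).comp (piProj i))
    {x | ∀ i, x i ∈ affinePlus N}
    {x | ∃ f ∈ gTrig N t, x = fun i => Affine.mk (germAt (t i) f) 0}
    (fun x => by
      obtain ⟨f, hf, hx⟩ := exists_trig_section t ht0 ht fun i => (x i).toLoop
      refine ⟨x - fun i => Affine.mk (germAt (t i) f) 0, fun i => ?_, _, ⟨f, hf, rfl⟩,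
        (sub_add_cancel x _).symm⟩
      intro a b
      have h := neg_mem (hx i a b)
      have h' : -((germAt (t i) f).1 - (x i).toLoop.1) a b =
        ((x i).toLoop.1 - (germAt (t i) f).1) a b := neg_sub _ _
      rw [h'] at h
      exact h)
    (LinearMap.range (weylIncl k V)) (trigRelations (N := N) t fun i => Weyl (N := N) k (V i))
    (by
      rintro b hb _ ⟨v, rfl⟩
      exact ⟨_, (tensorSum_map (fun i => Weyl.incl (N := N) k (V i))
        (fun i => evalRep (N := N) k (V i) ⟨b i, hb i⟩)
        (fun i => LieModule.toEnd ℂ (AffineAt N) (Weyl (N := N) k (V i)) (b i))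
        (fun i m => Induced.lie_incl (affinePlus N) (evalRep (N := N) k (V i)) ⟨b i, hb i⟩ m)
        v).symm⟩)
    (fun S hS h1 => tensor_induced_eq_top (affinePlus N) (fun i => evalRep (N := N) k (V i)) S
        (fun v => hS ⟨v, rfl⟩) fun i x m hm =>
          (congrArg (· ∈ S) (LinearMap.congr_fun (tensorSum_single (fun i =>
            LieModule.toEnd ℂ (AffineAt N) (Weyl (N := N) k (V i))) i x) m)).mp
              (h1 (Pi.single i x) m hm))
    (by
      rintro _ ⟨f, hf, rfl⟩ m
      exact Submodule.subset_span ⟨f, hf, m, rfl⟩)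
  intro z
  obtain ⟨m, rfl⟩ := Submodule.Quotient.mk_surjective _ z
  have hm : m ∈ (⊤ : Submodule ℂ (⨂[ℂ] i, Weyl (N := N) k (V i))) := Submodule.mem_top
  rw [← h] at hm
  obtain ⟨_, ⟨v, rfl⟩, r, hr, rfl⟩ := Submodule.mem_sup.1 hm
  refine ⟨v, ((Submodule.Quotient.eq _).2 ?_).symm⟩
  rw [add_sub_cancel_left]
  exact hr

end Surjectivity

/-! ### The classes of `1 ⊗ m ⊗ 1` and the factorisation -/

section Constants

variable {N L : ℕ} {t : Fin L → ℂ} (k : ℂ) (V : Fin L → Type u)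
  [∀ i, AddCommGroup (V i)] [∀ i, Module ℂ (V i)]
  [∀ i, LieRingModule (LieAlgebra.SpecialLinear.sl (Fin N) ℂ) (V i)]
  [∀ i, LieModule ℂ (LieAlgebra.SpecialLinear.sl (Fin N) ℂ) (V i)]

theorem actMarked_constSection_weylIncl (H : cartan N) (v : ⨂[ℂ] i, V i) :
    actMarked t (fun i => Weyl (N := N) k (V i)) (constSection H) (weylIncl k V v) =
      weylIncl k V (tensorSum (fun i =>
        LieModule.toEnd ℂ (LieAlgebra.SpecialLinear.sl (Fin N) ℂ) (V i) H.1) v) := by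
  have hr : ∀ i, IsRegular (germAt (t i) (constSection H)).1 := fun i => by
    rw [germAt_constSection]
    exact isRegular_constMat _
  have he : ∀ i, evalRep (N := N) k (V i) ⟨Affine.mk (germAt (t i) (constSection H)) 0, hr i⟩ =
      LieModule.toEnd ℂ (LieAlgebra.SpecialLinear.sl (Fin N) ℂ) (V i) H.1 := by
    intro i
    have hp : evalAtPoint ⟨Affine.mk (germAt (t i) (constSection H)) 0, hr i⟩ = H.1 := by
      refine Subtype.ext ?_
      change constTerm (germAt (t i) (constSection H)).1 = cartanMat H
      rw [germAt_constSection, constTerm_constMat]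
    have hl : (k * (0 : ℂ)) • (LinearMap.id : V i →ₗ[ℂ] V i) = 0 := by rw [mul_zero, zero_smul]
    rw [← hp]
    exact (congrArg (_ + ·) hl).trans (add_zero _)
  exact tensorSum_map (fun i => Weyl.incl (N := N) k (V i)) _
    (fun i => LieModule.toEnd ℂ (AffineAt N) (Weyl (N := N) k (V i))
      (Affine.mk (germAt (t i) (constSection H)) 0))
    (fun i m => (Induced.lie_incl (affinePlus N) (evalRep (N := N) k (V i))
      ⟨Affine.mk (germAt (t i) (constSection H)) 0, hr i⟩ m).trans
        (congrArg _ (LinearMap.congr_fun (he i) m))) v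

theorem weightSum_lof [DecidableEq (Weights (N := N) V)] (m : Weights (N := N) V)
    (v : weightSpace V m.1) : weightSum V (DirectSum.lof ℂ (Weights (N := N) V)
      (fun l : Weights (N := N) V => weightSpace V l.1) m v) = v := by
  unfold weightSum
  convert DirectSum.coeLinearMap_lof (fun l : Weights (N := N) V => weightSpace V l.1) m v

end Constants

section OrbClass

variable {N L : ℕ} [NeZero N] {t : Fin L → ℂ} (k : ℂ) (V : Fin L → Type u)
  [∀ i, AddCommGroup (V i)] [∀ i, Module ℂ (V i)]
  [∀ i, LieRingModule (LieAlgebra.SpecialLinear.sl (Fin N) ℂ) (V i)]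
  [∀ i, LieModule ℂ (LieAlgebra.SpecialLinear.sl (Fin N) ℂ) (V i)]
  (l : Module.Dual ℂ (cartan N))

theorem actOrb_vacTensor {f : orbSections N} (h0 : IsRegular (germZero f).1)
    (h1 : IsRegular (germInfty f).1) (l₀ l₁ : Module.Dual ℂ (cartan N))
    (m : ⨂[ℂ] i, Weyl (N := N) k (V i)) :
    actOrb t (VermaZero k l₀) (fun i => Weyl (N := N) k (V i)) (VermaInfty k l₁) f
      (vacTensor k V l₀ l₁ m) = vacTensor k V l₀ l₁
        (actMarked t (fun i => Weyl (N := N) k (V i)) f m +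
          (l₀ (constDiag (germZero f)) + l₁ (constDiag (germInfty f))) • m) := by
  have e0 := lie_vac k l₀ (c := 1 / N) (x := Affine.mk (germZero f) 0) h0
  have e1 := lie_vac k l₁ (c := 1 / N) (x := Affine.mk (germInfty f) 0) h1
  rw [vermaChar_mk, mul_zero, add_zero] at e0 e1
  refine (LinearMap.congr_fun (globalRep_sectionElt t k V l₀ l₁ f) _).symm.trans ?_
  refine (globalRep_tmul k V l₀ l₁ (sectionElt t f) _ m _).trans ?_
  exact tmul_add_tmul_of_smul e0 e1 m _

/-- Sections which are regular at `0` and `∞` act on the classes of `1 ⊗ m ⊗ 1` by scalars. -/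
theorem orbClass_actMarked {f : orbSections N} (hf : f ∈ gOrb N t)
    (h0 : IsRegular (germZero f).1) (h1 : IsRegular (germInfty f).1)
    (m : ⨂[ℂ] i, Weyl (N := N) k (V i)) :
    orbClass t k V l (actMarked t (fun i => Weyl (N := N) k (V i)) f m +
      (weightAtZero l (constDiag (germZero f)) + weightAtInfty l (constDiag (germInfty f))) • m) =
        0 := by
  have h := actOrb_vacTensor (t := t) k V h0 h1 (weightAtZero l) (weightAtInfty l) m
  refine (Submodule.Quotient.mk_eq_zero _).2 (Submodule.subset_span ⟨f, hf, _, h.symm⟩)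

/-- The highest weights at `0` and `∞` are chosen so that the actions of `f(0)` and `f(∞)` on the
highest weight vectors cancel for `f` in the trigonometric algebra. -/
theorem weightAtZero_add_weightAtInfty_of_mem_gTrig {f : orbSections N} (hf : f ∈ gTrig N t) :
    weightAtZero l (constDiag (germZero f)) + weightAtInfty l (constDiag (germInfty f)) = 0 := by
  have hD : constDiag (germInfty f) = adBeta N (constDiag (germZero f)) := by
    refine cartanMat_injective ?_
    rw [← constTerm_eq_constDiag, hf.2.2.2, constTerm_eq_constDiag]
    rfl
  rw [hD, weightAtInfty_adBeta, add_neg_cancel]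

theorem orbClass_eq_zero_of_mem_trigRelations {m : ⨂[ℂ] i, Weyl (N := N) k (V i)}
    (hm : m ∈ trigRelations (N := N) t fun i => Weyl (N := N) k (V i)) :
    orbClass t k V l m = 0 := by
  have hle : trigRelations (N := N) t (fun i => Weyl (N := N) k (V i)) ≤
      LinearMap.ker (orbClass t k V l) := by
    refine Submodule.span_le.2 ?_
    rintro _ ⟨f, hf, m, rfl⟩
    have h := orbClass_actMarked k V l hf.1 hf.2.1 hf.2.2.1 m
    rw [weightAtZero_add_weightAtInfty_of_mem_gTrig l hf, zero_smul, add_zero] at h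
    exact h
  exact hle hm

theorem orbClass_weylIncl_smul {μ : Module.Dual ℂ (cartan N)} {v : ⨂[ℂ] i, V i}
    (hv : v ∈ weightSpace V μ) (H : cartan N) :
    (μ H - l H) • orbClass t k V l (weylIncl k V v) = 0 := by
  have h := orbClass_actMarked (t := t) k V l (constSection_mem_gOrb t H)
    (by rw [germZero_constSection]; exact isRegular_constMat _)
    (by rw [germInfty_constSection]; exact isRegular_constMat _) (weylIncl k V v)
  rw [actMarked_constSection_weylIncl, hv H, germZero_constSection, germInfty_constSection,
    constDiag_constCartan, constDiag_constCartan, weightAtZero_add_weightAtInfty,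
    map_smul (weylIncl k V), ← add_smul, ← sub_eq_add_neg] at h
  exact (map_smul (orbClass t k V l) _ _).symm.trans h

/-- Weight vectors of another weight have zero class, by the action of the constant sections. -/
theorem orbClass_weylIncl_eq_zero {μ : Module.Dual ℂ (cartan N)} (hμ : μ ≠ l) {v : ⨂[ℂ] i, V i}
    (hv : v ∈ weightSpace V μ) : orbClass t k V l (weylIncl k V v) = 0 := by
  obtain ⟨H, hH⟩ : ∃ H, μ H ≠ l H := by
    by_contra! h
    exact hμ (LinearMap.ext h)
  exact (smul_eq_zero.1 (orbClass_weylIncl_smul k V l hv H)).resolve_left (sub_ne_zero.2 hH)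

theorem orbMap_surjective [∀ i, FiniteDimensional ℂ (V i)] (ht0 : ∀ i, t i ≠ 0)
    (ht : ∀ i j, i ≠ j → ∀ a : ℤ, t i ≠ (eps N ^ a : ℂˣ) * t j) :
    Function.Surjective (orbMap t k V l) := by
  classical
  intro z
  obtain ⟨v, rfl⟩ := orbClass_weylIncl_surjective k V l ht0 ht z
  have hv : v ∈ ⨆ m, weightSpace (N := N) V m :=
    (isInternal_weightSpace (N := N) V).submodule_iSup_eq_top ▸ Submodule.mem_top
  change orbClass t k V l (weylIncl k V v) ∈ LinearMap.range (orbMap t k V l)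
  induction hv using Submodule.iSup_induction' with
  | mem m v hv =>
    by_cases hm : m = l
    · subst hm
      exact ⟨⟨v, hv⟩, rfl⟩
    · rw [orbClass_weylIncl_eq_zero k V l hm hv]
      exact zero_mem _
  | zero => rw [map_zero, map_zero]; exact zero_mem _
  | add x y _ _ hx hy => rw [map_add, map_add]; exact add_mem hx hy

end OrbClass

section Components

variable {ι : Type v} {E F : Type*} {G : ι → Type*} [AddCommGroup E] [Module ℂ E]
  [AddCommGroup F] [Module ℂ F] [∀ i, AddCommGroup (G i)] [∀ i, Module ℂ (G i)]

/-- If the map `c` vanishes on every summand but the `i`-th, its value on a sum is the value on the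
`i`-th component. -/
theorem apply_directSum_eq [DecidableEq ι] (s : (⨁ j, G j) →ₗ[ℂ] E) (c : E →ₗ[ℂ] F) (i : ι)
    (g : G i →ₗ[ℂ] F) (h : ∀ x, c (s (DirectSum.lof ℂ ι G i x)) = g x)
    (h0 : ∀ j, j ≠ i → ∀ x, c (s (DirectSum.lof ℂ ι G j x)) = 0) (w : ⨁ j, G j) :
    c (s w) = g (w i) := by
  have he : c ∘ₗ s = g ∘ₗ DirectSum.component ℂ ι G i := by
    refine DirectSum.linearMap_ext ℂ fun j => LinearMap.ext fun x => ?_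
    change c (s (DirectSum.lof ℂ ι G j x)) = g (DirectSum.lof ℂ ι G j x i)
    by_cases hj : j = i
    · subst hj
      rw [h, DirectSum.lof_apply]
    · rw [h0 j hj]
      have h1 : DirectSum.lof ℂ ι G j x i = 0 := DirectSum.of_eq_of_ne j i x (Ne.symm hj)
      rw [h1, map_zero]
  exact LinearMap.congr_fun he w

variable {A B : Type*} [AddCommGroup A] [Module ℂ A] [AddCommGroup B] [Module ℂ B] {H : ι → Type*}
  [∀ i, AddCommGroup (H i)] [∀ i, Module ℂ (H i)]

/-- Bijections of a space `A` with `B`, with a direct sum, and of the summands with the spaces `H i`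
combine to an isomorphism of `B` with the direct sum of the `H i`, whose components are the given
maps `c i` as soon as they are so on `A`. -/
theorem exists_directSum_equiv {e : A →ₗ[ℂ] B} (he : Function.Bijective e)
    {s : (⨁ i, G i) →ₗ[ℂ] A} (hs : Function.Bijective s) {g : ∀ i, G i →ₗ[ℂ] H i}
    (hg : ∀ i, Function.Bijective (g i)) {X : Type*} (p : X → B) (c : ∀ i, X → H i)
    (hc : ∀ w x, e (s w) = p x → ∀ i, g i (w i) = c i x) :
    ∃ Φ : B ≃ₗ[ℂ] ⨁ i, H i, (∀ x i, Φ (p x) i = c i x) ∧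
      ∀ w, Φ (e (s w)) = DirectSum.lmap g w := by
  let e₁ := LinearEquiv.ofBijective e he
  let e₂ := LinearEquiv.ofBijective s hs
  let e₃ := DirectSum.congrLinearEquiv fun i => LinearEquiv.ofBijective (g i) (hg i)
  have hΦ : ∀ w, (e₁.symm ≪≫ₗ e₂.symm ≪≫ₗ e₃) (e (s w)) = DirectSum.lmap g w := by
    intro w
    change e₃ (e₂.symm (e₁.symm (e₁ (e₂ w)))) = _
    rw [LinearEquiv.symm_apply_apply, LinearEquiv.symm_apply_apply]
    rfl
  refine ⟨e₁.symm ≪≫ₗ e₂.symm ≪≫ₗ e₃, fun x i => ?_, hΦ⟩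
  obtain ⟨v, hv⟩ := he.2 (p x)
  obtain ⟨w, rfl⟩ := hs.2 v
  rw [← hv, hΦ, DirectSum.lmap_apply]
  exact hc w x hv i

end Components

section Factorisation

variable {N L : ℕ} [NeZero N] {t : Fin L → ℂ} (k : ℂ) (V : Fin L → Type u)
  [∀ i, AddCommGroup (V i)] [∀ i, Module ℂ (V i)]
  [∀ i, LieRingModule (LieAlgebra.SpecialLinear.sl (Fin N) ℂ) (V i)]
  [∀ i, LieModule ℂ (LieAlgebra.SpecialLinear.sl (Fin N) ℂ) (V i)]

theorem orbClass_weylIncl_weightSum (w : ⨁ l : Weights (N := N) V, weightSpace V l.1)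
    (l : Weights (N := N) V) : orbClass t k V l.1 (weylIncl k V (weightSum V w)) =
      orbMap t k V l.1 (w l) := by
  classical
  refine apply_directSum_eq (weightSum V) (orbClass t k V l.1 ∘ₗ weylIncl k V) l
    (orbMap t k V l.1) (fun v => ?_) (fun m hm v => ?_) w
  · rw [weightSum_lof]
    rfl
  · rw [weightSum_lof]
    exact orbClass_weylIncl_eq_zero k V l.1 (fun h => hm (Subtype.ext h)) v.2

theorem trigMap_injective [∀ i, FiniteDimensional ℂ (V i)] (ht0 : ∀ i, t i ≠ 0)
    (ht : ∀ i j, i ≠ j → ∀ a : ℤ, t i ≠ (eps N ^ a : ℂˣ) * t j) :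
    Function.Injective (trigMap (N := N) t k V) := by
  rw [injective_iff_map_eq_zero]
  intro v hv
  obtain ⟨w, rfl⟩ := (weightSum_bijective (N := N) V).2 v
  have hmem := (Submodule.Quotient.mk_eq_zero _).1 hv
  have hw : w = 0 := by
    refine DFinsupp.ext fun l => ?_
    have h := orbClass_eq_zero_of_mem_trigRelations k V l.1 hmem
    rw [orbClass_weylIncl_weightSum] at h
    exact orbMap_injective k V l.1 ht0 ht (h.trans (map_zero _).symm)
  rw [hw, map_zero]

/-- The class of `1 ⊗ m ⊗ 1` depends only on the class of `m` among the trigonometric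
coinvariants. -/
theorem orbClass_eq_of_trigMap_eq {v : ⨂[ℂ] i, V i} {m : ⨂[ℂ] i, Weyl (N := N) k (V i)}
    (h : trigMap (N := N) t k V v = Submodule.Quotient.mk m) (l : Module.Dual ℂ (cartan N)) :
    orbClass t k V l (weylIncl k V v) = orbClass t k V l m := by
  have hm := orbClass_eq_zero_of_mem_trigRelations k V l ((Submodule.Quotient.eq _).1 h)
  exact sub_eq_zero.1 ((map_sub (orbClass t k V l) _ _).symm.trans hm)

end Factorisation

end TwistedWZW

end

theorem mainTheorem3 (N L : ℕ) [NeZero N] (hN : 2 ≤ N) (hL : 1 ≤ L) (k : ℂ)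
    (t : Fin L → ℂ) (ht0 : ∀ i, t i ≠ 0)
    (ht : ∀ i j, i ≠ j → ∀ a : ℤ, t i ≠ (TwistedWZW.eps N ^ a : ℂˣ) * t j)
    (V : Fin L → Type*) [∀ i, AddCommGroup (V i)] [∀ i, Module ℂ (V i)]
    [∀ i, LieRingModule (LieAlgebra.SpecialLinear.sl (Fin N) ℂ) (V i)]
    [∀ i, LieModule ℂ (LieAlgebra.SpecialLinear.sl (Fin N) ℂ) (V i)]
    [∀ i, FiniteDimensional ℂ (V i)] :
    Function.Bijective (TwistedWZW.trigMap (N := N) t k V) ∧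
    (∀ l : Module.Dual ℂ (TwistedWZW.cartan N),
      Function.Bijective (TwistedWZW.orbMap t k V l)) ∧
    Function.Bijective (TwistedWZW.weightSum (N := N) V) ∧
    ∃ Φ : TwistedWZW.CCTrig (N := N) t (fun i => TwistedWZW.Weyl (N := N) k (V i)) ≃ₗ[ℂ]
        ⨁ l : TwistedWZW.Weights (N := N) V, TwistedWZW.CCOrbWeyl t k V l.1,
      (∀ (m : ⨂[ℂ] i, TwistedWZW.Weyl (N := N) k (V i)) (l : TwistedWZW.Weights (N := N) V),
        Φ (Submodule.Quotient.mk m) l = TwistedWZW.orbClass t k V l.1 m) ∧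
      ∀ w : ⨁ l : TwistedWZW.Weights (N := N) V, TwistedWZW.weightSpace V l.1,
        Φ (TwistedWZW.trigMap t k V (TwistedWZW.weightSum V w)) =
          DirectSum.lmap (fun l : TwistedWZW.Weights (N := N) V =>
            TwistedWZW.orbMap t k V l.1) w := by
  have htrig : Function.Bijective (TwistedWZW.trigMap (N := N) t k V) :=
    ⟨TwistedWZW.trigMap_injective k V ht0 ht, TwistedWZW.trigMap_surjective k V ht0 ht⟩
  have horb : ∀ l, Function.Bijective (TwistedWZW.orbMap (N := N) t k V l) := fun l =>
    ⟨TwistedWZW.orbMap_injective k V l ht0 ht, TwistedWZW.orbMap_surjective k V l ht0 ht⟩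
  have hsum := TwistedWZW.weightSum_bijective (N := N) V
  exact ⟨htrig, horb, hsum, TwistedWZW.exists_directSum_equiv htrig hsum (fun l => horb l.1)
    Submodule.Quotient.mk (fun l m => TwistedWZW.orbClass t k V l.1 m) fun w m h l =>
      (TwistedWZW.orbClass_weylIncl_weightSum k V w l).symm.trans
        (TwistedWZW.orbClass_eq_of_trigMap_eq k V h l.1)⟩
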